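/- Let $G$ be a connected, simply-connected, simple complex linear algebraic group with Lie algebra $\mathfrak g$ and adjoint representation $\mathrm{Ad}$. Let $T\subseteq G$ be a compact subgroup whose Zariski closure $H=T_{\mathbb C}$ is a maximal torus of $G$ (that is, $T$ is the maximal compact subgroup of the maximal torus $H$), and let $\mathfrak h$ be the Lie algebra of $H$. Let $\Delta\subseteq\mathrm{Hom}(H,\mathbb C^{*})$ be the set of roots, that is, the nontrivial characters $\beta$ of $H$ whose root space $\mathfrak g_\beta=\{\xi\in\mathfrak g:\mathrm{Ad}_h\xi=\beta(h)\xi\ \ \forall h\in H\}$ is nonzero, and let the Weyl group $W=N_G(H)/H$ act on characters by $(w\cdot\beta)(h)=\beta(g^{-1}hg)$, where $g\in N_G(H)$ represents $w$. The length of a root is taken with respect to the inner product induced by the Killing form; the long (short) roots are those of maximal (minimal) length, so that all roots are both long and short if there is only one length. A long (short) root vector is a nonzero element of $\mathfrak g_\beta$ with $\beta$ long (short). A nilpotent orbit is an orbit of $\mathrm{Ad}(G)$ in $\mathfrak g$ that consists of elements $\xi$ with $\mathrm{ad}_\xi$ nilpotent; $\mathbb P(\Theta)\subseteq\mathbb P(\mathfrak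 g)$ denotes the image of a nonzero nilpotent orbit $\Theta$, and $\mathbb P(\Theta)^T$ its set of $T$-fixed points. (i) For all $\beta,\gamma\in\Delta$, there is $g\in G$ with $\mathrm{Ad}_g(\mathfrak g_\beta)=\mathfrak g_\gamma$ if and only if there is $w\in W$ with $w\cdot\beta=\gamma$. (ii) Long root vectors and short root vectors exist, and for every long root vector $e_{\mathrm{long}}$ and every short root vector $e_{\mathrm{short}}$, the nonzero nilpotent orbits $\Theta$ with $\mathbb P(\Theta)^T\neq\emptyset$ are exactly $\mathrm{Ad}(G)e_{\mathrm{long}}$ and $\mathrm{Ad}(G)e_{\mathrm{short}}$ (which may coincide). -/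

import Mathlib

open scoped LinearAlgebra.Projectivization Topology

attribute [local instance] LieRing.ofAssociativeRing

noncomputable section

namespace NilpotentOrbit

variable {n : ℕ}

/-! ### Linear algebraic groups, as Zariski-closed subgroups of `GL n ℂ` -/

/-- The matrix entries of `g`, as a point of the affine space `ℂ ^ (n × n)`. -/
def entries (g : GL (Fin n) ℂ) : Fin n × Fin n → ℂ :=
  fun p => (g : Matrix (Fin n) (Fin n) ℂ) p.1 p.2

/-- The Zariski topology on `GL n ℂ`. Its basic open sets are the nonvanishing loci of polynomials
in the matrix entries. (Regular functions on `GL n ℂ` have the form `f / det ^ k`, so polynomials in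
the entries give the same open sets.) -/
@[reducible]
def zariski (n : ℕ) : TopologicalSpace (GL (Fin n) ℂ) :=
  TopologicalSpace.generateFrom
    {U | ∃ f : MvPolynomial (Fin n × Fin n) ℂ, U = {g | MvPolynomial.eval (entries g) f ≠ 0}}

/-- The Zariski topology on a subgroup of `GL n ℂ`. The instance topology on such a subgroup is the
classical (Euclidean) one. -/
@[reducible]
def zariskiOn (G : Subgroup (GL (Fin n) ℂ)) : TopologicalSpace G :=
  (zariski n).induced Subtype.val

/-- `G` is a (connected) simply-connected simple complex linear algebraic group.
Connectedness is part of Mathlib's `SimplyConnectedSpace`. A connected algebraic group is simple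
if it is not commutative and has no proper closed normal subgroup of positive dimension. -/
structure IsSimplyConnectedSimple (G : Subgroup (GL (Fin n) ℂ)) : Prop where
  isClosed : IsClosed[zariski n] (G : Set (GL (Fin n) ℂ))
  simplyConnected : SimplyConnectedSpace G
  not_commutative : ¬ ∀ x y : G, x * y = y * x
  simple : ∀ N : Subgroup G, N.Normal → IsClosed[zariskiOn G] (N : Set G) →
    (N : Set G).Finite ∨ N = ⊤

/-- An (algebraic) torus in `G`: a closed, connected, diagonalizable subgroup. -/
structure IsTorus {G : Subgroup (GL (Fin n) ℂ)} (H : Subgroup G) : Prop where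
  isClosed : IsClosed[zariskiOn G] (H : Set G)
  isConnected : @IsConnected G (zariskiOn G) (H : Set G)
  diagonalizable : ∃ P : GL (Fin n) ℂ, ∀ h ∈ H,
    Matrix.IsDiag ((P * (h : GL (Fin n) ℂ) * P⁻¹ : GL (Fin n) ℂ) : Matrix (Fin n) (Fin n) ℂ)

/-- A maximal torus of `G`. -/
def IsMaximalTorus {G : Subgroup (GL (Fin n) ℂ)} (H : Subgroup G) : Prop :=
  Maximal IsTorus H

/-! ### The Lie algebra and the adjoint representation -/

/-- The ideal of polynomials in the matrix entries that vanish on `G`. -/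
def idealOf (G : Subgroup (GL (Fin n) ℂ)) : Ideal (MvPolynomial (Fin n × Fin n) ℂ) :=
  MvPolynomial.vanishingIdeal ℂ (entries '' (G : Set (GL (Fin n) ℂ)))

/-- The left-invariant vector field on the space of matrices with value `A` at the identity:
the derivation `f ↦ (x ↦ d/dε f (x (1 + ε A)))` at `ε = 0` of the polynomial functions. -/
def leftInvariant (A : Matrix (Fin n) (Fin n) ℂ) :
    Derivation ℂ (MvPolynomial (Fin n × Fin n) ℂ) (MvPolynomial (Fin n × Fin n) ℂ) :=
  MvPolynomial.mkDerivation ℂ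
    (fun p => ∑ k, MvPolynomial.X (p.1, k) * MvPolynomial.C (A k p.2))

theorem leftInvariant_X (A : Matrix (Fin n) (Fin n) ℂ) (p : Fin n × Fin n) :
    leftInvariant A (MvPolynomial.X p) =
      ∑ k, MvPolynomial.X (p.1, k) * MvPolynomial.C (A k p.2) :=
  MvPolynomial.mkDerivation_X _ _ _

theorem leftInvariant_add (A B : Matrix (Fin n) (Fin n) ℂ) :
    leftInvariant (A + B) = leftInvariant A + leftInvariant B := by
  apply MvPolynomial.derivation_ext
  intro p
  simp [leftInvariant_X, mul_add, Finset.sum_add_distrib]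

theorem leftInvariant_smul (c : ℂ) (A : Matrix (Fin n) (Fin n) ℂ) :
    leftInvariant (c • A) = c • leftInvariant A := by
  apply MvPolynomial.derivation_ext
  intro p
  simp only [leftInvariant_X, Derivation.smul_apply, Finset.smul_sum, Matrix.smul_apply,
    smul_eq_mul, map_mul, MvPolynomial.smul_eq_C_mul]
  exact Finset.sum_congr rfl fun k _ => by ring

theorem leftInvariant_lie (A B : Matrix (Fin n) (Fin n) ℂ) :
    leftInvariant ⁅A, B⁆ = ⁅leftInvariant A, leftInvariant B⁆ := by
  apply MvPolynomial.derivation_ext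
  intro p
  have key : ∀ A B : Matrix (Fin n) (Fin n) ℂ,
      leftInvariant A (leftInvariant B (MvPolynomial.X p)) =
        ∑ k, MvPolynomial.X (p.1, k) * MvPolynomial.C ((A * B) k p.2) := by
    intro A B
    simp only [leftInvariant_X, map_sum, Derivation.leibniz, MvPolynomial.derivation_C,
      zero_add, smul_eq_mul, Matrix.mul_apply, Finset.mul_sum, map_mul, mul_zero]
    rw [Finset.sum_comm]
    exact Finset.sum_congr rfl fun k _ => Finset.sum_congr rfl fun l _ => by ring
  rw [Derivation.commutator_apply, key, key, leftInvariant_X, ← Finset.sum_sub_distrib]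
  exact Finset.sum_congr rfl fun k _ => by
    rw [Ring.lie_def, Matrix.sub_apply, map_sub, mul_sub]

/-- The Lie algebra of `G`, realized in `𝔤𝔩 n ℂ`: the left-invariant vector fields that are
tangent to `G`, that is, that preserve the ideal of `G`. -/
def lieAlgebra (G : Subgroup (GL (Fin n) ℂ)) : LieSubalgebra ℂ (Matrix (Fin n) (Fin n) ℂ) where
  carrier := {A | ∀ f ∈ idealOf G, leftInvariant A f ∈ idealOf G}
  add_mem' {A B} hA hB f hf := by
    rw [leftInvariant_add]
    exact add_mem (hA f hf) (hB f hf)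
  zero_mem' f hf := by
    have h := leftInvariant_smul (n := n) 0 0
    rw [zero_smul, zero_smul] at h
    rw [h]
    exact zero_mem _
  smul_mem' c A hA f hf := by
    rw [leftInvariant_smul, Derivation.smul_apply, MvPolynomial.smul_eq_C_mul]
    exact Ideal.mul_mem_left _ _ (hA f hf)
  lie_mem' {A B} hA hB f hf := by
    rw [leftInvariant_lie, Derivation.commutator_apply]
    exact sub_mem (hA _ (hB f hf)) (hB _ (hA f hf))

/-- Right translation `f ↦ (x ↦ f (x g))` of polynomial functions. -/
def rightTranslate (g : GL (Fin n) ℂ) :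
    MvPolynomial (Fin n × Fin n) ℂ →ₐ[ℂ] MvPolynomial (Fin n × Fin n) ℂ :=
  MvPolynomial.aeval (fun p => ∑ k, MvPolynomial.X (p.1, k) *
    MvPolynomial.C ((g : Matrix (Fin n) (Fin n) ℂ) k p.2))

theorem aeval_rightTranslate (g x : GL (Fin n) ℂ) (f : MvPolynomial (Fin n × Fin n) ℂ) :
    MvPolynomial.aeval (entries x) (rightTranslate g f) =
      MvPolynomial.aeval (entries (x * g)) f := by
  have h : (MvPolynomial.aeval (R := ℂ) (entries x)).comp (rightTranslate g) =
      MvPolynomial.aeval (entries (x * g)) := by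
    apply MvPolynomial.algHom_ext
    intro p
    simp [rightTranslate, entries, Matrix.mul_apply]
  exact DFunLike.congr_fun h f

theorem rightTranslate_mem {G : Subgroup (GL (Fin n) ℂ)} {g : GL (Fin n) ℂ} (hg : g ∈ G)
    {f : MvPolynomial (Fin n × Fin n) ℂ} (hf : f ∈ idealOf G) :
    rightTranslate g f ∈ idealOf G := by
  rintro _ ⟨x, hx, rfl⟩
  rw [aeval_rightTranslate]
  exact hf _ ⟨x * g, G.mul_mem hx hg, rfl⟩

theorem leftInvariant_rightTranslate (g : GL (Fin n) ℂ) {A B : Matrix (Fin n) (Fin n) ℂ}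
    (hAB : A * (g : Matrix (Fin n) (Fin n) ℂ) = (g : Matrix (Fin n) (Fin n) ℂ) * B)
    (f : MvPolynomial (Fin n × Fin n) ℂ) :
    leftInvariant A (rightTranslate g f) = rightTranslate g (leftInvariant B f) := by
  have hsum : ∀ (M N : Matrix (Fin n) (Fin n) ℂ) (i : Fin n × Fin n),
      ∑ k, (∑ l, MvPolynomial.X (R := ℂ) (i.1, l) * MvPolynomial.C (M l k)) *
        MvPolynomial.C (N k i.2) =
      ∑ l, MvPolynomial.X (i.1, l) * MvPolynomial.C ((M * N) l i.2) := by
    intro M N i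
    simp only [Matrix.mul_apply, map_sum, map_mul, Finset.sum_mul, Finset.mul_sum]
    rw [Finset.sum_comm]
    exact Finset.sum_congr rfl fun k _ => Finset.sum_congr rfl fun l _ => by ring
  induction f using MvPolynomial.induction_on with
  | C a => simp [rightTranslate, MvPolynomial.algebraMap_eq, MvPolynomial.derivation_C]
  | add p q hp hq => simp only [map_add, hp, hq]
  | mul_X p i hp =>
    have hX : leftInvariant A (rightTranslate g (MvPolynomial.X i)) =
        rightTranslate g (leftInvariant B (MvPolynomial.X i)) := by
      have h1 : leftInvariant A (rightTranslate g (MvPolynomial.X i)) =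
          ∑ k, (∑ l, MvPolynomial.X (i.1, l) * MvPolynomial.C (A l k)) *
            MvPolynomial.C ((g : Matrix (Fin n) (Fin n) ℂ) k i.2) := by
        simp only [rightTranslate, MvPolynomial.aeval_X, map_sum, Derivation.leibniz,
          MvPolynomial.derivation_C, leftInvariant_X, smul_eq_mul, mul_zero, zero_add]
        exact Finset.sum_congr rfl fun k _ => mul_comm _ _
      have h2 : rightTranslate g (leftInvariant B (MvPolynomial.X i)) =
          ∑ k, (∑ l, MvPolynomial.X (i.1, l) *
            MvPolynomial.C ((g : Matrix (Fin n) (Fin n) ℂ) l k)) *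
            MvPolynomial.C (B k i.2) := by
        simp [leftInvariant_X, rightTranslate, MvPolynomial.algebraMap_eq]
      rw [h1, h2, hsum, hsum, hAB]
    rw [map_mul, Derivation.leibniz, hp, hX, Derivation.leibniz, map_add, smul_eq_mul,
      smul_eq_mul, smul_eq_mul, smul_eq_mul, map_mul, map_mul]

theorem conj_mem_lieAlgebra {G : Subgroup (GL (Fin n) ℂ)} {g : GL (Fin n) ℂ} (hg : g ∈ G)
    {A : Matrix (Fin n) (Fin n) ℂ} (hA : A ∈ lieAlgebra G) :
    (g : Matrix (Fin n) (Fin n) ℂ) * A * ((g⁻¹ : GL (Fin n) ℂ) : Matrix (Fin n) (Fin n) ℂ) ∈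
      lieAlgebra G := by
  intro f hf
  have hf' : f = rightTranslate g (rightTranslate g⁻¹ f) := by
    have h : (rightTranslate g).comp (rightTranslate g⁻¹) = AlgHom.id ℂ _ := by
      apply MvPolynomial.algHom_ext
      intro i
      have hsum : ∑ k, (∑ l, MvPolynomial.X (R := ℂ) (i.1, l) *
            MvPolynomial.C ((g : Matrix (Fin n) (Fin n) ℂ) l k)) *
            MvPolynomial.C (((g⁻¹ : GL (Fin n) ℂ) : Matrix (Fin n) (Fin n) ℂ) k i.2) =
          ∑ l, MvPolynomial.X (i.1, l) * MvPolynomial.C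
            (((g * g⁻¹ : GL (Fin n) ℂ) : Matrix (Fin n) (Fin n) ℂ) l i.2) := by
        simp only [Units.val_mul, Matrix.mul_apply, map_sum, map_mul, Finset.sum_mul,
          Finset.mul_sum]
        rw [Finset.sum_comm]
        exact Finset.sum_congr rfl fun k _ => Finset.sum_congr rfl fun l _ => by ring
      have h0 : (rightTranslate g) (rightTranslate g⁻¹ (MvPolynomial.X i)) =
          ∑ k, (∑ l, MvPolynomial.X (R := ℂ) (i.1, l) *
            MvPolynomial.C ((g : Matrix (Fin n) (Fin n) ℂ) l k)) *
            MvPolynomial.C (((g⁻¹ : GL (Fin n) ℂ) : Matrix (Fin n) (Fin n) ℂ) k i.2) := by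
        simp only [rightTranslate, MvPolynomial.aeval_X, map_sum, map_mul,
          MvPolynomial.algHom_C, MvPolynomial.algebraMap_eq]
      rw [AlgHom.comp_apply, h0, hsum, mul_inv_cancel, AlgHom.id_apply, Units.val_one]
      rw [Finset.sum_eq_single i.2]
      · simp
      · intro l _ hl
        simp [Matrix.one_apply_ne hl]
      · simp
    exact (DFunLike.congr_fun h f).symm
  rw [hf', leftInvariant_rightTranslate g (B := A)]
  · exact rightTranslate_mem hg (hA _ (rightTranslate_mem (G.inv_mem hg) hf))
  · rw [mul_assoc, ← Units.val_mul, inv_mul_cancel, Units.val_one, mul_one]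

/-- The adjoint action of `G` on its Lie algebra, `Ad g ξ = g ξ g⁻¹`. -/
instance adjointAction (G : Subgroup (GL (Fin n) ℂ)) : DistribMulAction G (lieAlgebra G) where
  smul g ξ := ⟨(g : GL (Fin n) ℂ) * (ξ : Matrix (Fin n) (Fin n) ℂ) * ((g : GL (Fin n) ℂ)⁻¹ :
    GL (Fin n) ℂ), conj_mem_lieAlgebra g.2 ξ.2⟩
  one_smul ξ := Subtype.ext (by
    change ((1 : G) : GL (Fin n) ℂ).val * ξ.val * ((1 : G) : GL (Fin n) ℂ)⁻¹.val = ξ.val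
    simp)
  mul_smul g h ξ := Subtype.ext (by
    change ((g * h : G) : GL (Fin n) ℂ).val * ξ.val * ((g * h : G) : GL (Fin n) ℂ)⁻¹.val =
      (g : GL (Fin n) ℂ).val * ((h : GL (Fin n) ℂ).val * ξ.val * (h : GL (Fin n) ℂ)⁻¹.val) *
        (g : GL (Fin n) ℂ)⁻¹.val
    simp only [Subgroup.coe_mul, mul_inv_rev, Units.val_mul, mul_assoc])
  smul_zero g := Subtype.ext (by
    change (g : GL (Fin n) ℂ).val * 0 * (g : GL (Fin n) ℂ)⁻¹.val = 0
    rw [mul_zero, zero_mul])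
  smul_add g ξ η := Subtype.ext (by
    change (g : GL (Fin n) ℂ).val * (ξ.val + η.val) * (g : GL (Fin n) ℂ)⁻¹.val =
      (g : GL (Fin n) ℂ).val * ξ.val * (g : GL (Fin n) ℂ)⁻¹.val +
        (g : GL (Fin n) ℂ).val * η.val * (g : GL (Fin n) ℂ)⁻¹.val
    rw [mul_add, add_mul])

theorem coe_smul {G : Subgroup (GL (Fin n) ℂ)} (g : G) (ξ : lieAlgebra G) :
    ((g • ξ : lieAlgebra G) : Matrix (Fin n) (Fin n) ℂ) =
      (g : GL (Fin n) ℂ) * (ξ : Matrix (Fin n) (Fin n) ℂ) * ((g : GL (Fin n) ℂ)⁻¹ :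
        GL (Fin n) ℂ) :=
  rfl

instance adjointAction_smulCommClass (G : Subgroup (GL (Fin n) ℂ)) :
    SMulCommClass G ℂ (lieAlgebra G) where
  smul_comm g c ξ := Subtype.ext (by
    change (g : GL (Fin n) ℂ).val * (c • ξ.val) * (g : GL (Fin n) ℂ)⁻¹.val =
      c • ((g : GL (Fin n) ℂ).val * ξ.val * (g : GL (Fin n) ℂ)⁻¹.val)
    rw [mul_smul_comm, smul_mul_assoc])

/-- `Ad g` as a linear map. -/
def Ad {G : Subgroup (GL (Fin n) ℂ)} (g : G) : lieAlgebra G →ₗ[ℂ] lieAlgebra G :=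
  DistribSMul.toLinearMap ℂ (lieAlgebra G) g

/-! ### Roots and the Weyl group -/

variable {G : Subgroup (GL (Fin n) ℂ)}

/-- The weight space of the character `χ` of `H` in the Lie algebra of `G`. -/
def rootSpace (H : Subgroup G) (χ : H →* ℂˣ) : Submodule ℂ (lieAlgebra G) where
  carrier := {ξ | ∀ h : H, (h : G) • ξ = (χ h : ℂ) • ξ}
  add_mem' {ξ η} hξ hη h := by rw [smul_add, hξ h, hη h, smul_add]
  zero_mem' h := by rw [smul_zero, smul_zero]
  smul_mem' c ξ hξ h := by rw [smul_comm, hξ h, smul_comm]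

/-- The roots: the nontrivial characters of `H` with nonzero weight space. (A character with a
nonzero weight space is automatically a morphism of algebraic groups.) -/
def IsRoot (H : Subgroup G) (χ : H →* ℂˣ) : Prop :=
  χ ≠ 1 ∧ rootSpace H χ ≠ ⊥

/-- The Weyl group `N_G(H) / H`. -/
abbrev WeylGroup (H : Subgroup G) : Type :=
  Subgroup.normalizer (H : Set G) ⧸ H.subgroupOf (Subgroup.normalizer (H : Set G))

/-- The action of `N_G(H)` on the characters of `H`: `(g • χ) h = χ (g⁻¹ h g)`. -/
def normalizerAction (H : Subgroup G) :
    Subgroup.normalizer (H : Set G) →* Equiv.Perm (H →* ℂˣ) where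
  toFun g :=
    { toFun := fun χ => χ.comp (H.normalizerMonoidHom g⁻¹).toMonoidHom
      invFun := fun χ => χ.comp (H.normalizerMonoidHom g).toMonoidHom
      left_inv := fun χ => by
        ext h
        simp
      right_inv := fun χ => by
        ext h
        simp }
  map_one' := by
    ext χ h
    simp
  map_mul' g g' := by
    ext χ h
    simp

theorem normalizerAction_apply (H : Subgroup G) (g : Subgroup.normalizer (H : Set G))
    (χ : H →* ℂˣ) (h k : H) (hk : (k : G) = (g : G)⁻¹ * h * g) :
    normalizerAction H g χ h = χ k := by
  have h1 : H.normalizerMonoidHom g⁻¹ h = k := by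
    apply Subtype.ext
    rw [Subgroup.normalizerMonoidHom_apply_apply_coe, hk]
    simp
  change χ (H.normalizerMonoidHom g⁻¹ h) = χ k
  rw [h1]

/-- The action of the Weyl group on the characters of `H`, induced by that of `N_G(H)`. -/
def weylAction (H : Subgroup G) : WeylGroup H →* Equiv.Perm (H →* ℂˣ) :=
  QuotientGroup.lift _ (normalizerAction H) (by
    intro g hg
    ext χ h : 2
    have hgH : (g : G) ∈ H := Subgroup.mem_subgroupOf.mp hg
    rw [normalizerAction_apply H g χ h ((⟨g, hgH⟩ : H)⁻¹ * h * ⟨g, hgH⟩) (by simp), map_mul,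
      map_mul, map_inv, inv_mul_cancel_comm]
    simp)

theorem weylAction_mk (H : Subgroup G) (g : Subgroup.normalizer (H : Set G)) (χ : H →* ℂˣ) :
    weylAction H (QuotientGroup.mk g) χ = normalizerAction H g χ :=
  rfl

/-- The Lie algebra of `H`, as a subspace of the Lie algebra of `G`. -/
def cartan (H : Subgroup G) : Submodule ℂ (lieAlgebra G) :=
  (lieAlgebra (H.map G.subtype)).toSubmodule.comap (lieAlgebra G).toSubmodule.subtype

/-- `t` is the element of the Lie algebra of `H` that represents (the differential of) the root `β`
with respect to the Killing form `κ`: `[ξ, e] = κ(t, ξ) e` for `ξ` in the Lie algebra of `H` and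
`e` in the root space of `β`. -/
def Represents (H : Subgroup G) (β : H →* ℂˣ) (t : lieAlgebra G) : Prop :=
  t ∈ cartan H ∧ ∀ ξ ∈ cartan H, ∀ e ∈ rootSpace H β,
    ⁅ξ, e⁆ = killingForm ℂ (lieAlgebra G) t ξ • e

open Classical in
/-- The squared length `κ(t_β, t_β)` of the root `β`, for the inner product on the real span of the
roots that is induced by the Killing form. (It is a positive real number.) -/
def rootLengthSq (H : Subgroup G) (β : H →* ℂˣ) : ℝ :=
  if h : ∃ t, Represents H β t then (killingForm ℂ (lieAlgebra G) h.choose h.choose).re else 0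

/-- The long roots: the roots of maximal length. -/
def IsLongRoot (H : Subgroup G) (β : H →* ℂˣ) : Prop :=
  IsRoot H β ∧ ∀ γ, IsRoot H γ → rootLengthSq H γ ≤ rootLengthSq H β

/-- The short roots: the roots of minimal length. If all roots have the same length, then they are
both long and short. -/
def IsShortRoot (H : Subgroup G) (β : H →* ℂˣ) : Prop :=
  IsRoot H β ∧ ∀ γ, IsRoot H γ → rootLengthSq H β ≤ rootLengthSq H γ

/-- A root vector for a long root. -/
def IsLongRootVector (H : Subgroup G) (e : lieAlgebra G) : Prop :=
  e ≠ 0 ∧ ∃ β, IsLongRoot H β ∧ e ∈ rootSpace H β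

/-- A root vector for a short root. -/
def IsShortRootVector (H : Subgroup G) (e : lieAlgebra G) : Prop :=
  e ≠ 0 ∧ ∃ β, IsShortRoot H β ∧ e ∈ rootSpace H β

/-! ### Nilpotent orbits -/

/-- The nilpotent cone of the Lie algebra of `G`. -/
def nilpotentCone (G : Subgroup (GL (Fin n) ℂ)) : Set (lieAlgebra G) :=
  {ξ | IsNilpotent (LieAlgebra.ad ℂ (lieAlgebra G) ξ)}

/-- `Θ` is an adjoint orbit of `G` that is contained in the nilpotent cone. -/
def IsNilpotentOrbit (Θ : Set (lieAlgebra G)) : Prop :=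
  (∃ ξ, Θ = MulAction.orbit G ξ) ∧ Θ ⊆ nilpotentCone G

/-- The image of `Θ` in the projective space of the Lie algebra. -/
def projectivize (Θ : Set (lieAlgebra G)) : Set (ℙ ℂ (lieAlgebra G)) :=
  {p | ∃ (ξ : lieAlgebra G) (hξ : ξ ≠ 0), ξ ∈ Θ ∧ p = Projectivization.mk ℂ ξ hξ}

end NilpotentOrbit

end

/-! A point of ℙ(𝔤) fixed by T is a line on which T acts by scalars. Acting by scalars on a given
line is a Zariski-closed condition on the group element, so H acts on it by scalars as well
(`exists_mem_rootSpace_of_fixed`) and the line lies in a weight space of H. The trivial weight space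
is the Cartan subalgebra, which contains no nonzero nilpotent element, so the line is a root line.
Everything thus reduces to deciding which root lines are conjugate under G, and the answer is: those
whose roots have the same length.

Equal length suffices. In an irreducible reduced crystallographic root system, a set of roots stable
under all reflections contains every root of each length that it meets
(`RootPairing.mem_of_length_eq_of_reflectionPerm_mem`). The reflections come from elements exp(e)
exp(-f) exp(e) of N_G(H), for sl₂-triples (`exists_reflection`), and scalars are absorbed by
exponentials of multiples of the coroot. At most two lengths occur, hence at most two orbits.
Conversely, if Ad g carries one root line onto another, then the Killing form takes the same value
on the two coroots (`corootLengthSq_eq_of_smul`), so the roots have the same length and the Weyl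
group already joins them. This is (i).

What remains is to reach abstract Lie theory from the definitions through closed subgroups of GL n
ℂ. Exponentials link a closed subgroup with its Lie algebra (`exp_mem`,
`mem_lieAlgebra_of_exp_mem`). Closed normal subgroups built from centralizers turn simplicity of G
into simplicity of 𝔤 (`isKilling`, `isSimple`). The Lie algebra contains the semisimple parts of its
elements (`semisimple_part_mem`), so maximality of H shows that 𝔥 is all of the fixed space of H
(`cartan_eq_rootSpace_one`). Finally `generatedByExp` lets statements pass from 𝔥 to H; it uses that
the compact group T is Zariski-dense in H. Then 𝔥 is a Cartan subalgebra (`isCartanSubalgebra`), and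
`Corresponds` matches characters of H with its roots. -/

noncomputable section
namespace NilpotentOrbit

open Matrix (diagonal)
open NormedSpace (exp)

variable {n : ℕ}

/-! ### One-parameter subgroups and Lie algebras of closed subgroups -/

/-- The exponential of a matrix, as an element of `GL n ℂ`. -/
def expGL (A : Matrix (Fin n) (Fin n) ℂ) : GL (Fin n) ℂ where
  val := exp A
  inv := exp (-A)
  val_inv := by
    rw [← Matrix.exp_add_of_commute A (-A) (Commute.refl A).neg_right, add_neg_cancel,
      NormedSpace.exp_zero]
  inv_val := by
    rw [← Matrix.exp_add_of_commute (-A) A (Commute.refl A).neg_left, neg_add_cancel,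
      NormedSpace.exp_zero]

@[simp] theorem coe_expGL (A : Matrix (Fin n) (Fin n) ℂ) :
    (expGL A : Matrix (Fin n) (Fin n) ℂ) = exp A := rfl

theorem coe_expGL_inv (A : Matrix (Fin n) (Fin n) ℂ) :
    ((expGL A)⁻¹ : GL (Fin n) ℂ).val = exp (-A) := rfl

@[simp] theorem expGL_zero : expGL (0 : Matrix (Fin n) (Fin n) ℂ) = 1 :=
  Units.ext (by simp [NormedSpace.exp_zero])

theorem expGL_neg (A : Matrix (Fin n) (Fin n) ℂ) : expGL (-A) = (expGL A)⁻¹ :=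
  Units.ext rfl

theorem expGL_add {A B : Matrix (Fin n) (Fin n) ℂ} (h : Commute A B) :
    expGL (A + B) = expGL A * expGL B :=
  Units.ext (Matrix.exp_add_of_commute A B h)

theorem expGL_nsmul (k : ℕ) (A : Matrix (Fin n) (Fin n) ℂ) : expGL (k • A) = expGL A ^ k :=
  Units.ext (by simpa only [coe_expGL, Units.val_pow_eq_pow_val] using Matrix.exp_nsmul k A)

theorem expGL_zsmul (k : ℤ) (A : Matrix (Fin n) (Fin n) ℂ) : expGL (k • A) = expGL A ^ k := by
  obtain ⟨m, rfl | rfl⟩ := k.eq_nat_or_neg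
  · rw [natCast_zsmul, expGL_nsmul, zpow_natCast]
  · rw [neg_smul, natCast_zsmul, expGL_neg, expGL_nsmul, zpow_neg, zpow_natCast]

theorem expGL_conj (g : GL (Fin n) ℂ) (A : Matrix (Fin n) (Fin n) ℂ) :
    expGL (g.val * A * (g⁻¹).val) = g * expGL A * g⁻¹ :=
  Units.ext (Matrix.exp_units_conj g A)

open scoped Matrix.Norms.Operator in
theorem hasDerivAt_functional_exp (l : Matrix (Fin n) (Fin n) ℂ →ₗ[ℂ] ℂ)
    (A : Matrix (Fin n) (Fin n) ℂ) (t : ℂ) :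
    HasDerivAt (fun s : ℂ => l (exp (s • A))) (l (exp (t • A) * A)) t := by
  have h := hasDerivAt_exp_smul_const (𝕂 := ℂ) A t
  exact (LinearMap.toContinuousLinearMap l).hasFDerivAt.comp_hasDerivAt t h

/-- The bridge between the algebraic definition of the Lie algebra and one-parameter subgroups. Both
sides obey the Leibniz rule, so the matrix entries are the only case to compute. -/
theorem hasDerivAt_eval_exp (B A : Matrix (Fin n) (Fin n) ℂ)
    (f : MvPolynomial (Fin n × Fin n) ℂ) (t : ℂ) :
    HasDerivAt (fun s : ℂ => MvPolynomial.eval (fun p => (B * exp (s • A)) p.1 p.2) f)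
      (MvPolynomial.eval (fun p => (B * exp (t • A)) p.1 p.2) (leftInvariant A f)) t := by
  induction f using MvPolynomial.induction_on with
  | C a => simpa [MvPolynomial.derivation_C] using hasDerivAt_const t a
  | add p q hp hq => simpa using! hp.add hq
  | mul_X p i hp =>
    have hX : HasDerivAt (fun s : ℂ => MvPolynomial.eval (fun p => (B * exp (s • A)) p.1 p.2)
        (MvPolynomial.X i)) (MvPolynomial.eval (fun p => (B * exp (t • A)) p.1 p.2)
          (leftInvariant A (MvPolynomial.X i))) t := by
      have h := hasDerivAt_functional_exp
        ((Matrix.entryLinearMap ℂ ℂ i.1 i.2) ∘ₗ (LinearMap.mulLeft ℂ B)) A t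
      convert h using 1
      · simp
      · simp [leftInvariant_X, ← Matrix.mul_assoc, Matrix.mul_apply (N := A)]
    have h := hp.mul hX
    rw [Derivation.leibniz, smul_eq_mul, smul_eq_mul, map_add, map_mul, map_mul]
    convert! h using 1
    · ext s
      exact map_mul _ _ _
    · ring

theorem mem_idealOf {G : Subgroup (GL (Fin n) ℂ)} {f : MvPolynomial (Fin n × Fin n) ℂ} :
    f ∈ idealOf G ↔ ∀ g ∈ G, MvPolynomial.eval (entries g) f = 0 := by
  constructor
  · intro h g hg
    exact h _ ⟨g, hg, rfl⟩
  · rintro h _ ⟨g, hg, rfl⟩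
    exact h g hg

theorem exists_basic_subset {U : Set (GL (Fin n) ℂ)} (hU : IsOpen[zariski n] U)
    {g : GL (Fin n) ℂ} (hg : g ∈ U) :
    ∃ f : MvPolynomial (Fin n × Fin n) ℂ, MvPolynomial.eval (entries g) f ≠ 0 ∧
      ∀ x, MvPolynomial.eval (entries x) f ≠ 0 → x ∈ U := by
  have hU' : TopologicalSpace.GenerateOpen
    {U | ∃ f : MvPolynomial (Fin n × Fin n) ℂ,
      U = {g : GL (Fin n) ℂ | MvPolynomial.eval (entries g) f ≠ 0}} U := hU
  induction hU' with
  | basic s hs =>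
    obtain ⟨f, rfl⟩ := hs
    exact ⟨f, hg, fun x hx => hx⟩
  | univ => exact ⟨1, by simp, fun x _ => trivial⟩
  | inter s t hs ht ihs iht =>
    obtain ⟨f₁, h₁, h₁'⟩ := ihs hs hg.1
    obtain ⟨f₂, h₂, h₂'⟩ := iht ht hg.2
    refine ⟨f₁ * f₂, by simp [h₁, h₂], fun x hx => ?_⟩
    rw [map_mul] at hx
    exact ⟨h₁' x (left_ne_zero_of_mul hx), h₂' x (right_ne_zero_of_mul hx)⟩
  | sUnion S hS ih =>
    obtain ⟨s, hs, hgs⟩ := hg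
    obtain ⟨f, h, h'⟩ := ih s hs (hS s hs) hgs
    exact ⟨f, h, fun x hx => ⟨s, hs, h' x hx⟩⟩

theorem mem_of_forall_idealOf {G : Subgroup (GL (Fin n) ℂ)}
    (hG : IsClosed[zariski n] (G : Set (GL (Fin n) ℂ))) {g : GL (Fin n) ℂ}
    (hg : ∀ f ∈ idealOf G, MvPolynomial.eval (entries g) f = 0) : g ∈ G := by
  by_contra h
  obtain ⟨f, hf, hf'⟩ := exists_basic_subset hG.isOpen_compl h
  refine hf (hg f (mem_idealOf.mpr fun x hx => ?_))
  by_contra h'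
  exact hf' x h' hx

theorem isClosed_zariski_of_forall {S : Set (GL (Fin n) ℂ)}
    (F : Set (MvPolynomial (Fin n × Fin n) ℂ))
    (hS : ∀ g, g ∈ S ↔ ∀ f ∈ F, MvPolynomial.eval (entries g) f = 0) :
    IsClosed[zariski n] S := by
  let _ := zariski n
  have : S = ⋂ f ∈ F, {g | MvPolynomial.eval (entries g) f ≠ 0}ᶜ := by
    ext g
    simp [hS]
  rw [this]
  refine isClosed_biInter fun f _ => isClosed_compl_iff.mpr ?_
  exact TopologicalSpace.isOpen_generateFrom_of_mem ⟨f, rfl⟩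

theorem continuous_entries : Continuous (entries (n := n)) := by
  refine continuous_pi fun p => ?_
  have h : Continuous (fun g : GL (Fin n) ℂ => g.val) := Units.continuous_val
  exact h.matrix_elem p.1 p.2

theorem zariski_coarser : (Units.instTopologicalSpaceUnits : TopologicalSpace (GL (Fin n) ℂ)) ≤ zariski n := by
  refine le_generateFrom ?_
  rintro _ ⟨f, rfl⟩
  exact isOpen_ne_fun ((MvPolynomial.continuous_eval f).comp continuous_entries) continuous_const

/-- For f in the ideal of G, the derivatives of s ↦ f(exp(sA)) at 0 are the values at 1 of iterates
of `leftInvariant A` on f. These stay in the ideal, so every Taylor coefficient of this entire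
function vanishes. -/
theorem exp_mem {G : Subgroup (GL (Fin n) ℂ)}
    (hG : IsClosed[zariski n] (G : Set (GL (Fin n) ℂ))) {A : Matrix (Fin n) (Fin n) ℂ}
    (hA : A ∈ lieAlgebra G) : expGL A ∈ G := by
  refine mem_of_forall_idealOf hG fun f hf => ?_
  let φ (f : MvPolynomial (Fin n × Fin n) ℂ) (s : ℂ) : ℂ :=
    MvPolynomial.eval (fun p => ((1 : Matrix (Fin n) (Fin n) ℂ) * exp (s • A)) p.1 p.2) f
  have hφ : ∀ f s, HasDerivAt (φ f) (φ (leftInvariant A f) s) s := fun f s =>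
    hasDerivAt_eval_exp 1 A f s
  have hφ0 : ∀ f ∈ idealOf G, φ f 0 = 0 := fun f hf => by
    have := mem_idealOf.mp hf 1 G.one_mem
    simp only [φ, zero_smul, NormedSpace.exp_zero, mul_one]
    exact this
  have hit : ∀ k : ℕ, ∀ f ∈ idealOf G, iteratedDeriv k (φ f) 0 = 0 := by
    intro k
    induction k with
    | zero => intro f hf; simpa using hφ0 f hf
    | succ k ih =>
      intro f hf
      rw [iteratedDeriv_succ', show deriv (φ f) = φ (leftInvariant A f) from
        funext fun s => (hφ f s).deriv]
      exact ih _ (hA f hf)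
  have h := Complex.taylorSeries_eq_of_entire' (c := 0) (z := 1) (f := φ f)
    fun s => (hφ f s).differentiableAt
  simp only [hit _ f hf, mul_zero, zero_mul, tsum_zero] at h
  simp only [φ, one_smul, one_mul] at h
  exact h.symm

theorem entries_mul_expGL (g : GL (Fin n) ℂ) (A : Matrix (Fin n) (Fin n) ℂ) :
    entries (g * expGL A) = fun p : Fin n × Fin n => (g.val * exp A) p.1 p.2 := rfl

theorem mem_lieAlgebra {G : Subgroup (GL (Fin n) ℂ)} {A : Matrix (Fin n) (Fin n) ℂ} :
    A ∈ lieAlgebra G ↔ ∀ f ∈ idealOf G, leftInvariant A f ∈ idealOf G := Iff.rfl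

theorem _root_.HasDerivAt.eq_zero_of_ofReal {ψ : ℂ → ℂ} {d : ℂ} (h : HasDerivAt ψ d 0)
    (h0 : ∀ s : ℝ, ψ s = 0) : d = 0 := by
  rw [← Complex.ofReal_zero] at h
  have h1 := h.comp_ofReal
  rw [show (fun s : ℝ => ψ s) = fun _ => 0 from funext h0] at h1
  exact h1.unique (hasDerivAt_const (0 : ℝ) (0 : ℂ))

/-- Differentiate f(g exp(tA)) at t = 0. Real times suffice because the function is holomorphic, and
real times are what limits of integer powers provide. -/
theorem mem_lieAlgebra_of_exp_mem {G : Subgroup (GL (Fin n) ℂ)} {A : Matrix (Fin n) (Fin n) ℂ}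
    (hA : ∀ t : ℝ, expGL ((t : ℂ) • A) ∈ G) : A ∈ lieAlgebra G := by
  rw [mem_lieAlgebra]
  intro f hf
  rw [mem_idealOf]
  intro g hg
  have h0 : ∀ s : ℝ, MvPolynomial.eval (fun p : Fin n × Fin n =>
      (g.val * exp ((s : ℂ) • A)) p.1 p.2) f = 0 := by
    intro s
    have := mem_idealOf.mp hf _ (G.mul_mem hg (hA s))
    rwa [entries_mul_expGL] at this
  have h := (hasDerivAt_eval_exp g.val A f 0).eq_zero_of_ofReal h0
  rw [zero_smul, NormedSpace.exp_zero, mul_one] at h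
  exact h

theorem exp_smul_mem {G : Subgroup (GL (Fin n) ℂ)}
    (hG : IsClosed[zariski n] (G : Set (GL (Fin n) ℂ))) {A : Matrix (Fin n) (Fin n) ℂ}
    (hA : A ∈ lieAlgebra G) (t : ℂ) : expGL (t • A) ∈ G :=
  exp_mem hG ((lieAlgebra G).smul_mem t hA)

/-- A linear functional that is constant on a closed subgroup vanishes on its Lie algebra. -/
theorem functional_eq_zero {G : Subgroup (GL (Fin n) ℂ)}
    (hG : IsClosed[zariski n] (G : Set (GL (Fin n) ℂ))) {A : Matrix (Fin n) (Fin n) ℂ}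
    (hA : A ∈ lieAlgebra G) (l : Matrix (Fin n) (Fin n) ℂ →ₗ[ℂ] ℂ) (c : ℂ)
    (hl : ∀ g ∈ G, l (g : GL (Fin n) ℂ).val = c) : l A = 0 := by
  have h := hasDerivAt_functional_exp l A 0
  have h0 : (fun s : ℂ => l (exp (s • A))) = fun _ => c :=
    funext fun s => hl _ (exp_smul_mem hG hA s)
  rw [h0] at h
  have := h.unique (hasDerivAt_const (0 : ℂ) c)
  simpa [NormedSpace.exp_zero] using this

theorem commute_of_forall_commute {G : Subgroup (GL (Fin n) ℂ)}
    (hG : IsClosed[zariski n] (G : Set (GL (Fin n) ℂ))) {A X : Matrix (Fin n) (Fin n) ℂ}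
    (hA : A ∈ lieAlgebra G) (hX : ∀ g ∈ G, Commute (g : GL (Fin n) ℂ).val X) : Commute A X := by
  change A * X = X * A
  rw [← sub_eq_zero]
  ext i j
  have := functional_eq_zero hG hA ((Matrix.entryLinearMap ℂ ℂ i j) ∘ₗ
    (LinearMap.mulRight ℂ X - LinearMap.mulLeft ℂ X)) 0 fun g hg => by
      simp [(hX g hg).eq]
  simpa using this

/-- A nonzero entry of A is the derivative at 0 of the same entry of exp(tA), which therefore avoids
any finite set of values for small t ≠ 0. -/
theorem infinite_of_exp_mem {N : Set (GL (Fin n) ℂ)} {A : Matrix (Fin n) (Fin n) ℂ} (hA : A ≠ 0)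
    (hN : ∀ t : ℂ, expGL (t • A) ∈ N) : N.Infinite := by
  intro hfin
  obtain ⟨i, j, hij⟩ : ∃ i j, A i j ≠ 0 := by
    by_contra! h
    exact hA (Matrix.ext h)
  have h := hasDerivAt_functional_exp (Matrix.entryLinearMap ℂ ℂ i j) A 0
  have hev : ∀ᶠ t in 𝓝[≠] (0 : ℂ), ∀ c ∈ N, exp (t • A) i j ≠ c.val i j := by
    rw [hfin.eventually_all]
    intro c _
    exact h.eventually_ne (by simpa [NormedSpace.exp_zero] using hij)
  obtain ⟨t, ht⟩ := hev.exists
  exact ht _ (hN t) rfl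

/-- A closed subgroup that contains arbitrarily small exponentials from a subspace contains a
one-parameter subgroup tangent to that subspace. -/
theorem exists_mem_lieAlgebra_of_small {G : Subgroup (GL (Fin n) ℂ)}
    (hG : IsClosed[zariski n] (G : Set (GL (Fin n) ℂ)))
    (W : Submodule ℂ (Matrix (Fin n) (Fin n) ℂ))
    (hW : ∀ V ∈ 𝓝 (0 : Matrix (Fin n) (Fin n) ℂ), ∃ c ∈ V, c ∈ W ∧ c ≠ 0 ∧ expGL c ∈ G) :
    ∃ C ∈ W, C ≠ 0 ∧ C ∈ lieAlgebra G := by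
  open scoped Matrix.Norms.Operator in
  have hex : ∀ k : ℕ, ∃ c : Matrix (Fin n) (Fin n) ℂ, ‖c‖ < 1 / ((k : ℝ) + 1) ∧ c ∈ W ∧ c ≠ 0 ∧
      expGL c ∈ G := by
    intro k
    obtain ⟨c, hc, h⟩ := hW _ (Metric.ball_mem_nhds 0 (Nat.one_div_pos_of_nat (α := ℝ) (n := k)))
    exact ⟨c, by simpa using hc, h⟩
  choose c hc hcW hc0 hcG using hex
  let u : ℕ → Matrix (Fin n) (Fin n) ℂ := fun k => ((‖c k‖⁻¹ : ℝ) : ℂ) • c k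
  have hpos : ∀ k, 0 < ‖c k‖ := fun k => norm_pos_iff.mpr (hc0 k)
  have hu : ∀ k, u k ∈ Metric.sphere (0 : Matrix (Fin n) (Fin n) ℂ) 1 := fun k => by
    simp only [u, mem_sphere_iff_norm, sub_zero, norm_smul, Complex.norm_real, norm_inv, norm_norm]
    exact inv_mul_cancel₀ (hpos k).ne'
  have : ProperSpace (Matrix (Fin n) (Fin n) ℂ) := FiniteDimensional.proper ℂ _
  obtain ⟨C, hC, φ, hφ, hlim⟩ := (isCompact_sphere (0 : Matrix (Fin n) (Fin n) ℂ) 1).tendsto_subseq hu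
  have hc_lim : Filter.Tendsto (fun k => ‖c k‖) Filter.atTop (𝓝 0) :=
    squeeze_zero (fun k => norm_nonneg _) (fun k => (hc k).le)
      tendsto_one_div_add_atTop_nhds_zero_nat
  refine ⟨C, ?_, ?_, mem_lieAlgebra_of_exp_mem fun t => mem_of_forall_idealOf hG fun f hf => ?_⟩
  · have hcl : IsClosed (W : Set (Matrix (Fin n) (Fin n) ℂ)) := W.closed_of_finiteDimensional
    exact hcl.mem_of_tendsto hlim (Filter.Eventually.of_forall fun k => W.smul_mem _ (hcW _))
  · rintro rfl
    simp at hC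
  -- Integer multiples m k • c (φ k) converge to t • C because the c (φ k) shrink to 0 in the
  -- direction C. Their exponentials are powers of elements of G, so every polynomial in the ideal
  -- vanishes at the limit.
  · let m : ℕ → ℤ := fun k => ⌊t / ‖c (φ k)‖⌋
    have hm : Filter.Tendsto (fun k => ((m k : ℝ) * ‖c (φ k)‖ : ℝ)) Filter.atTop (𝓝 t) := by
      have hcφ := hc_lim.comp hφ.tendsto_atTop
      rw [tendsto_iff_dist_tendsto_zero]
      refine squeeze_zero (fun k => dist_nonneg) (fun k => ?_) hcφ
      have hp := hpos (φ k)
      have h1 := Int.floor_le (t / ‖c (φ k)‖)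
      have h2 := Int.lt_floor_add_one (t / ‖c (φ k)‖)
      rw [le_div_iff₀ hp] at h1
      rw [div_lt_iff₀ hp] at h2
      simp only [Function.comp_apply, Real.dist_eq, m]
      rw [abs_le]
      constructor <;> nlinarith
    have hmc : Filter.Tendsto (fun k => (m k) • c (φ k)) Filter.atTop (𝓝 ((t : ℂ) • C)) := by
      have := ((Complex.continuous_ofReal.tendsto t).comp hm).smul hlim
      refine this.congr fun k => ?_
      have hp := (hpos (φ k)).ne'
      simp only [Function.comp_apply, u, smul_smul]
      rw [← Complex.ofReal_mul, mul_assoc, mul_inv_cancel₀ hp, mul_one, Complex.ofReal_intCast,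
        Int.cast_smul_eq_zsmul]
    have hexp : Continuous (fun A : Matrix (Fin n) (Fin n) ℂ =>
        MvPolynomial.eval (fun p : Fin n × Fin n => exp A p.1 p.2) f) := by
      refine (MvPolynomial.continuous_eval f).comp (continuous_pi fun p => ?_)
      have : Continuous (exp : Matrix (Fin n) (Fin n) ℂ → Matrix (Fin n) (Fin n) ℂ) :=
        NormedSpace.exp_continuous
      exact this.matrix_elem p.1 p.2
    have h0 := (hexp.tendsto ((t : ℂ) • C)).comp hmc
    refine tendsto_nhds_unique h0 (tendsto_const_nhds.congr fun k => ?_)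
    refine (mem_idealOf.mp hf (expGL (m k • c (φ k))) ?_).symm
    rw [expGL_zsmul]
    exact G.zpow_mem (hcG _) _

end NilpotentOrbit
end

noncomputable section
namespace NilpotentOrbit

open NormedSpace (exp)

variable {n : ℕ} {G : Subgroup (GL (Fin n) ℂ)}

/-! ### Zariski-closed subsets of `G` -/

theorem isClosed_zariskiOn_of_linear {S : Set G} (F : Set (Matrix (Fin n) (Fin n) ℂ →ₗ[ℂ] ℂ))
    (hS : ∀ g : G, g ∈ S ↔ ∀ l ∈ F, l (g : GL (Fin n) ℂ).val = 0) :
    IsClosed[zariskiOn G] S := by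
  refine (@isClosed_induced_iff _ _ (zariski n) _ _).mpr ?_
  let q (l : Matrix (Fin n) (Fin n) ℂ →ₗ[ℂ] ℂ) : MvPolynomial (Fin n × Fin n) ℂ :=
    ∑ p : Fin n × Fin n, MvPolynomial.C (l (Matrix.single p.1 p.2 1)) * MvPolynomial.X p
  have hq : ∀ l, ∀ g : GL (Fin n) ℂ, MvPolynomial.eval (entries g) (q l) = l g.val := by
    intro l g
    conv_rhs => rw [Matrix.matrix_eq_sum_single g.val]
    simp only [q, map_sum, map_mul, MvPolynomial.eval_C, MvPolynomial.eval_X, entries,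
      Fintype.sum_prod_type]
    refine Finset.sum_congr rfl fun i _ => Finset.sum_congr rfl fun j _ => ?_
    rw [mul_comm, ← smul_eq_mul, ← map_smul, Matrix.smul_single, smul_eq_mul, mul_one]
  refine ⟨{g | ∀ f ∈ q '' F, MvPolynomial.eval (entries g) f = 0},
    isClosed_zariski_of_forall (q '' F) fun g => Iff.rfl, ?_⟩
  ext g
  rw [hS g]
  simp only [Set.mem_preimage, Set.mem_ofPred_eq, Set.forall_mem_image, hq]

/-- Centralizers, pointwise fixators and stabilizers all take this form: once the inverse is
cleared, the conditions are linear in g. -/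
theorem isClosed_intertwining {ι : Sort*} (X Y : ι → Matrix (Fin n) (Fin n) ℂ) :
    IsClosed[zariskiOn G] {g : G | ∀ i, (g : GL (Fin n) ℂ).val * X i =
      Y i * (g : GL (Fin n) ℂ).val} := by
  refine isClosed_zariskiOn_of_linear {l | ∃ i a b, l = (Matrix.entryLinearMap ℂ ℂ a b) ∘ₗ
    (LinearMap.mulRight ℂ (X i) - LinearMap.mulLeft ℂ (Y i))} fun g => ?_
  constructor
  · rintro h _ ⟨i, a, b, rfl⟩
    simp [h i]
  · intro h i
    rw [← sub_eq_zero]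
    ext a b
    simpa using h _ ⟨i, a, b, rfl⟩

theorem isClosed_map_subtype (hG : IsClosed[zariski n] (G : Set (GL (Fin n) ℂ))) {K : Subgroup G}
    (hK : IsClosed[zariskiOn G] (K : Set G)) :
    IsClosed[zariski n] (K.map G.subtype : Set (GL (Fin n) ℂ)) := by
  obtain ⟨Z, hZ, hZK⟩ :=
    (@isClosed_induced_iff _ _ (zariski n) _ _).mp hK
  have : (K.map G.subtype : Set (GL (Fin n) ℂ)) = Z ∩ G := by
    rw [Subgroup.coe_map, ← hZK]
    ext g
    constructor
    · rintro ⟨x, hx, rfl⟩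
      exact ⟨hx, x.2⟩
    · rintro ⟨hx, hg⟩
      exact ⟨⟨g, hg⟩, hx, rfl⟩
  rw [this]
  exact @IsClosed.inter _ _ _ (zariski n) hZ hG

theorem continuous_zariski_mul_mul (a b : GL (Fin n) ℂ) :
    Continuous[zariski n, zariski n] fun g => a * g * b := by
  rw [continuous_generateFrom_iff]
  rintro _ ⟨f, rfl⟩
  refine TopologicalSpace.isOpen_generateFrom_of_mem
    ⟨MvPolynomial.bind₁ (fun p => ∑ k, ∑ l, MvPolynomial.C (a.val p.1 l) * MvPolynomial.X (l, k) *
      MvPolynomial.C (b.val k p.2)) f, ?_⟩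
  ext g
  have : MvPolynomial.eval (entries g) (MvPolynomial.bind₁ (fun p => ∑ k, ∑ l,
      MvPolynomial.C (a.val p.1 l) * MvPolynomial.X (l, k) * MvPolynomial.C (b.val k p.2)) f) =
      MvPolynomial.eval (entries (a * g * b)) f := by
    rw [MvPolynomial.eval, MvPolynomial.eval₂Hom_bind₁]
    congr 2
    funext p
    simp [entries, Matrix.mul_apply, Finset.sum_mul]
  simp [this]

theorem continuous_zariskiOn_mul_mul (a b : G) :
    Continuous[zariskiOn G, zariskiOn G] fun g => a * g * b := by
  refine (@continuous_induced_rng _ _ _ _ _ (zariski n) (zariskiOn G)).mpr ?_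
  exact @Continuous.comp _ _ _ (zariskiOn G) (zariski n) (zariski n) _ _
    (continuous_zariski_mul_mul a.val b.val) (@continuous_induced_dom _ _ _ (zariski n))

theorem zariskiOn_coarser : (inferInstance : TopologicalSpace G) ≤ zariskiOn G :=
  induced_mono zariski_coarser

/-! ### The adjoint action by Lie algebra automorphisms -/

theorem coe_lie (ξ η : lieAlgebra G) : ((⁅ξ, η⁆ : lieAlgebra G) : Matrix (Fin n) (Fin n) ℂ) =
    ξ.val * η.val - η.val * ξ.val := rfl

theorem smul_lie_adjoint (g : G) (ξ η : lieAlgebra G) : g • ⁅ξ, η⁆ = ⁅g • ξ, g • η⁆ := by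
  apply Subtype.ext
  simp only [coe_smul, coe_lie, mul_sub, sub_mul]
  congr 1 <;> simp [mul_assoc]

/-- `Ad g` as an automorphism of the Lie algebra. -/
def AdEquiv (g : G) : lieAlgebra G ≃ₗ⁅ℂ⁆ lieAlgebra G where
  toFun ξ := g • ξ
  invFun ξ := g⁻¹ • ξ
  map_add' := smul_add g
  map_smul' c ξ := smul_comm g c ξ
  map_lie' {ξ η} := smul_lie_adjoint g ξ η
  left_inv := inv_smul_smul g
  right_inv := smul_inv_smul g

@[simp] theorem AdEquiv_apply (g : G) (ξ : lieAlgebra G) : AdEquiv g ξ = g • ξ := rfl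

theorem smul_eq_iff (g : G) (ξ η : lieAlgebra G) :
    g • ξ = η ↔ (g : GL (Fin n) ℂ).val * ξ.val = η.val * (g : GL (Fin n) ℂ).val := by
  rw [Subtype.ext_iff, coe_smul]
  constructor
  · intro h
    rw [← h, mul_assoc _ _ (g : GL (Fin n) ℂ).val, ← Units.val_mul]
    simp
  · intro h
    rw [h, mul_assoc, ← Units.val_mul]
    simp

theorem killingForm_smul_smul (g : G) (ξ η : lieAlgebra G) :
    killingForm ℂ (lieAlgebra G) (g • ξ) (g • η) = killingForm ℂ (lieAlgebra G) ξ η :=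
  LieAlgebra.killingForm_of_equiv_apply (AdEquiv g) ξ η

/-- The exponential of an element of the Lie algebra. -/
def expG (hG : IsClosed[zariski n] (G : Set (GL (Fin n) ℂ))) (ξ : lieAlgebra G) : G :=
  ⟨expGL ξ.val, exp_mem hG ξ.2⟩

theorem coe_expG (hG : IsClosed[zariski n] (G : Set (GL (Fin n) ℂ))) (ξ : lieAlgebra G) :
    (expG hG ξ : GL (Fin n) ℂ) = expGL ξ.val := rfl

theorem smul_expG (hG : IsClosed[zariski n] (G : Set (GL (Fin n) ℂ))) (g : G) (ξ : lieAlgebra G) :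
    expG hG (g • ξ) = g * expG hG ξ * g⁻¹ :=
  Subtype.ext (expGL_conj g.val ξ.val)

theorem commute_of_exp_commute {A B : Matrix (Fin n) (Fin n) ℂ}
    (h : ∀ t : ℂ, Commute (exp (t • A)) B) : Commute A B := by
  change A * B = B * A
  rw [← sub_eq_zero]
  ext i j
  have h1 := hasDerivAt_functional_exp ((Matrix.entryLinearMap ℂ ℂ i j) ∘ₗ
    (LinearMap.mulRight ℂ B - LinearMap.mulLeft ℂ B)) A 0
  have h0 : (fun s : ℂ => ((Matrix.entryLinearMap ℂ ℂ i j) ∘ₗ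
    (LinearMap.mulRight ℂ B - LinearMap.mulLeft ℂ B)) (exp (s • A))) = fun _ => 0 := by
    funext s
    simp [(h s).eq]
  rw [h0] at h1
  simpa [NormedSpace.exp_zero] using h1.unique (hasDerivAt_const (0 : ℂ) (0 : ℂ))

theorem lie_eq_zero_iff_commute (ξ η : lieAlgebra G) : ⁅ξ, η⁆ = 0 ↔ Commute ξ.val η.val := by
  rw [Subtype.ext_iff, coe_lie, ZeroMemClass.coe_zero, sub_eq_zero]
  rfl

theorem exp_commute_exp {A B : Matrix (Fin n) (Fin n) ℂ} (h : Commute A B) :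
    Commute (exp A) (exp B) := h.exp

theorem infinite_of_expG_mem (hG : IsClosed[zariski n] (G : Set (GL (Fin n) ℂ))) {N : Set G}
    {ξ : lieAlgebra G} (hξ : ξ ≠ 0) (hN : ∀ t : ℂ, expG hG (t • ξ) ∈ N) : N.Infinite := by
  have h := infinite_of_exp_mem (N := Subtype.val '' N) (A := ξ.val)
    (fun h => hξ (Subtype.ext h)) fun t => ⟨expG hG (t • ξ), hN t, rfl⟩
  exact h.of_image _

/-! ### Semisimplicity of the Lie algebra -/

/-- A stable abelian ideal of the Lie algebra of a simple group vanishes. -/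
theorem eq_bot_of_abelian_of_stable (hG : IsSimplyConnectedSimple G)
    (I : LieIdeal ℂ (lieAlgebra G)) (hab : ∀ x ∈ I, ∀ y ∈ I, ⁅x, y⁆ = 0)
    (hst : ∀ g : G, ∀ x ∈ I, g • x ∈ I) : I = ⊥ := by
  by_contra hI
  obtain ⟨x, hxI, hx⟩ := show ∃ x ∈ I, x ≠ 0 by
    by_contra! h
    exact hI ((LieSubmodule.eq_bot_iff I).mpr h)
  let S : Set G := expG hG.isClosed '' I
  let C := Subgroup.centralizer S
  -- The double centralizer of exp(I) is closed as a centralizer, normal because I is stable, and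
  -- contains exp(I). It is also commutative: S ⊆ C gives N ≤ C, and N centralizes C.
  let N := Subgroup.centralizer (C : Set G)
  have hSc : ∀ g : G, ∀ s ∈ S, g * s * g⁻¹ ∈ S := by
    rintro g _ ⟨y, hy, rfl⟩
    exact ⟨g • y, hst g y hy, smul_expG _ g y⟩
  have hCn : ∀ g : G, ∀ c ∈ C, g * c * g⁻¹ ∈ C := by
    intro g c hc
    rw [Subgroup.mem_centralizer_iff] at hc ⊢
    intro s hs
    have h := hc _ (hSc g⁻¹ s hs)
    rw [inv_inv] at h
    calc s * (g * c * g⁻¹) = g * (g⁻¹ * s * g * c) * g⁻¹ := by group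
      _ = g * c * g⁻¹ * s := by rw [h]; group
  have hN : N.Normal := by
    refine ⟨fun c hc g => ?_⟩
    rw [Subgroup.mem_centralizer_iff] at hc ⊢
    intro s hs
    have h := hc _ (hCn g⁻¹ s hs)
    rw [inv_inv] at h
    calc s * (g * c * g⁻¹) = g * (g⁻¹ * s * g * c) * g⁻¹ := by group
      _ = g * c * g⁻¹ * s := by rw [h]; group
  have hSC : S ⊆ C := by
    rintro _ ⟨y, hy, rfl⟩
    rw [SetLike.mem_coe, Subgroup.mem_centralizer_iff]
    rintro _ ⟨z, hz, rfl⟩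
    refine Subtype.ext (Units.ext ?_)
    exact exp_commute_exp ((lie_eq_zero_iff_commute z y).mp (hab z hz y hy))
  have hSN : S ⊆ N := by
    intro s hs
    rw [SetLike.mem_coe, Subgroup.mem_centralizer_iff]
    intro c hc
    exact ((Subgroup.mem_centralizer_iff.mp hc) s hs).symm
  have hclosed : IsClosed[zariskiOn G] (N : Set G) := by
    convert! isClosed_intertwining (G := G) (fun c : C => (c : GL (Fin n) ℂ).val)
      (fun c : C => (c : GL (Fin n) ℂ).val) using 1
    ext g
    rw [SetLike.mem_coe, Subgroup.mem_centralizer_iff]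
    simp only [Set.mem_ofPred_eq, Subtype.forall]
    refine forall₂_congr fun c _ => ?_
    rw [eq_comm, Subtype.ext_iff, Units.ext_iff]
    rfl
  rcases hG.simple N hN hclosed with hfin | htop
  · exact infinite_of_expG_mem hG.isClosed hx
      (fun t => hSN ⟨t • x, I.smul_mem t hxI, rfl⟩) hfin
  · refine hG.not_commutative fun a b => ?_
    have ha : a ∈ N := htop ▸ Subgroup.mem_top a
    have hb : b ∈ N := htop ▸ Subgroup.mem_top b
    have hNC : N ≤ C := Subgroup.centralizer_le hSC
    exact (Subgroup.mem_centralizer_iff.mp hb) a (hNC ha)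

theorem lie_stable {I J : LieIdeal ℂ (lieAlgebra G)} (hI : ∀ g : G, ∀ x ∈ I, g • x ∈ I)
    (hJ : ∀ g : G, ∀ x ∈ J, g • x ∈ J) (g : G) : ∀ x ∈ ⁅I, J⁆, g • x ∈ ⁅I, J⁆ := by
  intro x hx
  rw [← LieSubmodule.mem_toSubmodule, LieSubmodule.lieIdeal_oper_eq_linear_span] at hx
  induction hx using Submodule.span_induction with
  | mem x hx =>
    obtain ⟨⟨a, ha⟩, ⟨b, hb⟩, rfl⟩ := hx
    rw [smul_lie_adjoint]
    exact LieSubmodule.lie_mem_lie (hI g a ha) (hJ g b hb)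
  | zero => rw [smul_zero]; exact zero_mem _
  | add x y _ _ hx hy => rw [smul_add]; exact add_mem hx hy
  | smul c x _ hx => rw [smul_comm]; exact Submodule.smul_mem _ c hx

/-- The radical of the Killing form is a solvable ideal stable under Ad, and so are the terms of its
derived series. The last nonzero term would be abelian and stable, which
`eq_bot_of_abelian_of_stable` excludes. -/
theorem isKilling (hG : IsSimplyConnectedSimple G) : LieAlgebra.IsKilling ℂ (lieAlgebra G) := by
  let r := LieIdeal.killingCompl ℂ (lieAlgebra G) ⊤
  have hr : ∀ g : G, ∀ x ∈ r, g • x ∈ r := by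
    intro g x hx
    rw [LieIdeal.mem_killingCompl] at hx ⊢
    intro y _
    rw [← killingForm_smul_smul g⁻¹, inv_smul_smul]
    exact hx _ trivial
  have hsol : LieAlgebra.IsSolvable r :=
    (LieAlgebra.LieIdeal.solvable_iff_le_radical ℂ (lieAlgebra G) r).mpr
      (LieAlgebra.killingCompl_top_le_radical ℂ (lieAlgebra G))
  have hst : ∀ k, ∀ g : G, ∀ x ∈ LieAlgebra.derivedSeriesOfIdeal ℂ (lieAlgebra G) k r,
      g • x ∈ LieAlgebra.derivedSeriesOfIdeal ℂ (lieAlgebra G) k r := by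
    intro k
    induction k with
    | zero => simpa using hr
    | succ k ih =>
      rw [LieAlgebra.derivedSeriesOfIdeal_succ]
      exact lie_stable ih ih
  have hbot : ∀ k, LieAlgebra.derivedSeriesOfIdeal ℂ (lieAlgebra G) k r = ⊥ → r = ⊥ := by
    intro k
    induction k with
    | zero => intro h; simpa using h
    | succ k ih =>
      intro h
      rw [LieAlgebra.derivedSeriesOfIdeal_succ] at h
      refine ih (eq_bot_of_abelian_of_stable hG _ (fun x hx y hy => ?_) (hst k))
      have := LieSubmodule.lie_mem_lie hx hy
      rwa [h, LieSubmodule.mem_bot] at this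
  refine ⟨?_⟩
  obtain ⟨k, hk⟩ := (LieAlgebra.isSolvable_iff ℂ r).mp hsol
  exact hbot k ((LieIdeal.derivedSeries_eq_bot_iff r k).mp hk)

end NilpotentOrbit
end

noncomputable section
namespace NilpotentOrbit

open NormedSpace (exp)

variable {n : ℕ} {G : Subgroup (GL (Fin n) ℂ)}

/-! ### Simplicity of the Lie algebra -/

theorem image_exp_mem_nhds {V : Set (Matrix (Fin n) (Fin n) ℂ)} (hV : V ∈ 𝓝 0) :
    exp '' V ∈ 𝓝 (1 : Matrix (Fin n) (Fin n) ℂ) := by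
  open scoped Matrix.Norms.Operator in
  have h : HasStrictFDerivAt (exp : Matrix (Fin n) (Fin n) ℂ → Matrix (Fin n) (Fin n) ℂ)
      (ContinuousLinearEquiv.refl ℂ (Matrix (Fin n) (Fin n) ℂ) :
        Matrix (Fin n) (Fin n) ℂ →L[ℂ] Matrix (Fin n) (Fin n) ℂ) 0 :=
    hasStrictFDerivAt_exp_zero
  have h1 := h.map_nhds_eq_of_equiv
  rw [NormedSpace.exp_zero] at h1
  exact h1.ge (Filter.image_mem_map hV)

/-- Since exp maps neighbourhoods of 0 onto neighbourhoods of 1, either G contains exponentials of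
arbitrarily small nonzero matrices, which yield a tangent direction, or G is discrete. A discrete
connected group is trivial, hence commutative. -/
theorem nontrivial_lieAlgebra (hG : IsSimplyConnectedSimple G) : Nontrivial (lieAlgebra G) := by
  have := hG.simplyConnected
  have hcomm := hG.not_commutative
  obtain ⟨C, -, hC, hCG⟩ := exists_mem_lieAlgebra_of_small hG.isClosed ⊤ fun V hV => by
    have hO : {g : G | (g : GL (Fin n) ℂ).val ∈ exp '' V} ∈ 𝓝 (1 : G) := by
      have hc : Continuous fun g : G => (g : GL (Fin n) ℂ).val :=
        Units.continuous_val.comp continuous_subtype_val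
      refine hc.continuousAt.preimage_mem_nhds ?_
      simpa using image_exp_mem_nhds hV
    by_contra! hV'
    have h1 : {(1 : G)} ∈ 𝓝 (1 : G) := by
      refine Filter.mem_of_superset hO ?_
      rintro g ⟨c, hc, hcg⟩
      have hcg' : expGL c = g.val := Units.ext hcg
      by_cases hc0 : c = 0
      · subst hc0
        exact Subtype.ext (by rw [← hcg', expGL_zero]; rfl)
      · exact absurd (hcg' ▸ g.2) (hV' c hc trivial hc0)
    have : DiscreteTopology G := discreteTopology_of_isOpen_singleton_one
      (isOpen_singleton_iff_nhds_eq_pure 1 |>.mpr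
        (le_antisymm (Filter.le_pure_iff.mpr h1) (pure_le_nhds 1)))
    have : Subsingleton G := PreconnectedSpace.trivial_of_discrete
    exact hcomm fun x y => Subsingleton.elim _ _
  exact ⟨⟨C, hCG⟩, 0, fun h => hC (congrArg Subtype.val h)⟩

/-- The permutation of the ideals of the Lie algebra that is induced by `Ad g`. -/
def idealIso (g : G) : LieIdeal ℂ (lieAlgebra G) ≃o LieIdeal ℂ (lieAlgebra G) where
  toFun I := LieIdeal.comap (AdEquiv g⁻¹).toLieHom I
  invFun I := LieIdeal.comap (AdEquiv g).toLieHom I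
  left_inv I := by
    ext x
    simp [LieIdeal.mem_comap]
  right_inv I := by
    ext x
    simp [LieIdeal.mem_comap]
  map_rel_iff' {I J} := by
    constructor
    · intro h x hx
      have := h (x := g • x) (by simpa [LieIdeal.mem_comap] using hx)
      simpa [LieIdeal.mem_comap] using this
    · intro h x hx
      exact h hx

theorem mem_idealIso {g : G} {I : LieIdeal ℂ (lieAlgebra G)} {x : lieAlgebra G} :
    x ∈ idealIso g I ↔ g⁻¹ • x ∈ I := Iff.rfl

/-- Ad permutes the minimal ideals, of which there are finitely many. The sets of g that carry I
into a given one are closed and partition G into finitely many pieces, so the piece of 1 is clopen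
and connectedness makes it all of G. -/
theorem smul_mem_of_isAtom (hG : IsSimplyConnectedSimple G) {I : LieIdeal ℂ (lieAlgebra G)}
    (hI : IsAtom I) (g : G) {x : lieAlgebra G} (hx : x ∈ I) : g • x ∈ I := by
  have := isKilling hG
  have := hG.simplyConnected
  have hfin : {J : LieIdeal ℂ (lieAlgebra G) | IsAtom J}.Finite :=
    WellFoundedGT.finite_of_sSupIndep LieAlgebra.IsSemisimple.sSupIndep_isAtom
  let C (J : LieIdeal ℂ (lieAlgebra G)) : Set G := {g | ∀ x ∈ I, g • x ∈ J}
  have hclosed : ∀ J, IsClosed (C J) := by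
    intro J
    have hJ : IsClosed ((J.toSubmodule.map (lieAlgebra G).toSubmodule.subtype : Submodule ℂ
        (Matrix (Fin n) (Fin n) ℂ)) : Set (Matrix (Fin n) (Fin n) ℂ)) :=
      Submodule.closed_of_finiteDimensional _
    have : C J = ⋂ x ∈ I, (fun g : G => ((g • x : lieAlgebra G) : Matrix (Fin n) (Fin n) ℂ)) ⁻¹'
        (J.toSubmodule.map (lieAlgebra G).toSubmodule.subtype) := by
      ext g
      simp [C]
    rw [this]
    refine isClosed_biInter fun x _ => hJ.preimage ?_
    simp only [coe_smul]
    have h1 : Continuous fun g : G => (g : GL (Fin n) ℂ).val :=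
      Units.continuous_val.comp continuous_subtype_val
    have h2 : Continuous fun g : G => ((g : GL (Fin n) ℂ)⁻¹).val :=
      Units.continuous_val.comp (continuous_inv.comp continuous_subtype_val)
    exact (h1.mul continuous_const).mul h2
  have hcover : ∀ g, ∃ J, IsAtom J ∧ g ∈ C J := fun g =>
    ⟨idealIso g I, ((idealIso g).isAtom_iff I).mpr hI, fun x hx => by
      rwa [mem_idealIso, inv_smul_smul]⟩
  obtain ⟨x₀, hx₀I, hx₀⟩ : ∃ x ∈ I, x ≠ 0 := by
    by_contra! h
    exact hI.1 ((LieSubmodule.eq_bot_iff I).mpr h)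
  have hcompl : (C I)ᶜ = ⋃ J ∈ {J : LieIdeal ℂ (lieAlgebra G) | IsAtom J} \ {I}, C J := by
    ext g
    simp only [Set.mem_compl_iff, Set.mem_iUnion, exists_prop]
    constructor
    · intro hg
      obtain ⟨J, hJ, hgJ⟩ := hcover g
      exact ⟨J, ⟨hJ, fun h => hg (h ▸ hgJ)⟩, hgJ⟩
    · rintro ⟨J, ⟨hJ, hne⟩, hgJ⟩ hgI
      have hbot := (hJ.disjoint_of_ne hI hne).eq_bot
      have : g • x₀ ∈ J ⊓ I := ⟨hgJ x₀ hx₀I, hgI x₀ hx₀I⟩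
      rw [hbot, LieSubmodule.mem_bot, smul_eq_zero_iff_eq] at this
      exact hx₀ this
  have hopen : IsOpen (C I) := by
    rw [← isClosed_compl_iff, hcompl]
    exact (hfin.subset Set.sdiff_subset).isClosed_biUnion fun J _ => hclosed J
  have huniv : C I = Set.univ :=
    IsClopen.eq_univ ⟨hclosed I, hopen⟩ ⟨1, fun x hx => by rwa [one_smul]⟩
  have hg : g ∈ C I := huniv ▸ Set.mem_univ g
  exact hg x hx

/-- Let N be the pointwise fixator of a minimal ideal I. It is closed and normal, and N = G would
make I abelian, so N is finite. Another minimal ideal J commutes with I, so exp(J) would be an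
infinite subset of N. Hence I is the only minimal ideal and equals 𝔤. -/
theorem isSimple (hG : IsSimplyConnectedSimple G) : LieAlgebra.IsSimple ℂ (lieAlgebra G) := by
  have := isKilling hG
  have := nontrivial_lieAlgebra hG
  have hex : ∃ I : LieIdeal ℂ (lieAlgebra G), IsAtom I := by
    by_contra! h
    have h1 := LieAlgebra.IsSemisimple.sSup_atoms_eq_top (R := ℂ) (L := lieAlgebra G)
    rw [Set.eq_empty_of_forall_notMem (s := {I : LieIdeal ℂ (lieAlgebra G) | IsAtom I}) h,
      sSup_empty] at h1
    exact bot_ne_top h1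
  obtain ⟨I, hI⟩ := hex
  let N : Subgroup G :=
    { carrier := {g | ∀ x : I, g • (x : lieAlgebra G) = x}
      mul_mem' := fun {a b} ha hb x => by rw [mul_smul, hb, ha]
      one_mem' := fun x => one_smul _ _
      inv_mem' := fun {a} ha x => by rw [inv_smul_eq_iff, ha] }
  have hN : N.Normal := by
    refine ⟨fun a ha g x => ?_⟩
    have h := ha ⟨g⁻¹ • x, smul_mem_of_isAtom hG hI g⁻¹ x.2⟩
    rw [mul_smul, mul_smul, h, smul_inv_smul]
  have hclosed : IsClosed[zariskiOn G] (N : Set G) := by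
    convert! isClosed_intertwining (G := G) (fun x : I => x.val.val) (fun x : I => x.val.val)
      using 1
    ext g
    exact forall_congr' fun x => smul_eq_iff g x x
  have hab := LieAlgebra.IsSemisimple.non_abelian_of_isAtom I hI
  have hfin : (N : Set G).Finite := by
    refine (hG.simple N hN hclosed).resolve_right fun htop => hab ⟨fun x y => ?_⟩
    refine Subtype.ext ((lie_eq_zero_iff_commute x.val y.val).mpr ?_)
    refine commute_of_exp_commute fun t => ?_
    have : expG hG.isClosed (t • x.val) ∈ N := htop ▸ Subgroup.mem_top _
    exact (smul_eq_iff _ _ _).mp (this y)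
  have htop : I = ⊤ := by
    rw [eq_top_iff, ← LieAlgebra.IsSemisimple.sSup_atoms_eq_top]
    refine sSup_le fun J hJ => ?_
    by_contra hle
    have hbot := (hJ.disjoint_of_ne hI (fun h => hle h.le)).eq_bot
    obtain ⟨y, hyJ, hy⟩ : ∃ x ∈ J, x ≠ 0 := by
      by_contra! h
      exact hJ.1 ((LieSubmodule.eq_bot_iff J).mpr h)
    refine infinite_of_expG_mem hG.isClosed (N := N) hy (fun t x => ?_) hfin
    rw [smul_eq_iff]
    have hc : ⁅t • y, x.val⁆ = 0 := by
      have h1 : ⁅t • y, x.val⁆ ∈ J ⊓ I :=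
        ⟨lie_mem_left ℂ _ J _ _ (J.smul_mem t hyJ), lie_mem_right ℂ _ I _ _ x.2⟩
      rwa [hbot, LieSubmodule.mem_bot] at h1
    have h2 := (lie_eq_zero_iff_commute _ _).mp hc
    have h3 : Commute (exp (t • y).val) x.val.val := h2.exp_left
    exact h3
  refine ⟨fun J => ?_, fun h => hab ?_⟩
  · rcases hI.le_iff.mp (htop ▸ le_top : J ≤ I) with h | h
    · exact Or.inl h
    · exact Or.inr (h.trans htop)
  · exact ⟨fun x y => Subtype.ext (h.trivial x.val y.val)⟩

end NilpotentOrbit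
end

noncomputable section
namespace NilpotentOrbit

open scoped Pointwise

variable {n : ℕ} {G : Subgroup (GL (Fin n) ℂ)}

/-! ### Jordan decomposition in the Lie algebra -/

/-- The product of X - μ over the finitely many eigenvalues is squarefree and kills each
eigenvector, hence kills everything. -/
theorem isSemisimple_of_span_eigenvectors {V : Type*} [AddCommGroup V] [Module ℂ V]
    [FiniteDimensional ℂ V] (f : Module.End ℂ V) (s : Set V) (hs : ∀ v ∈ s, ∃ μ : ℂ, f v = μ • v)
    (hspan : Submodule.span ℂ s = ⊤) : f.IsSemisimple := by
  have hfin : Set.Finite {μ : ℂ | f.HasEigenvalue μ} := f.finite_hasEigenvalue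
  refine Module.End.isSemisimple_of_squarefree_aeval_eq_zero
    (p := ∏ μ ∈ hfin.toFinset, (Polynomial.X - Polynomial.C μ)) ?_ ?_
  · refine Polynomial.Separable.squarefree ?_
    exact Polynomial.separable_prod_X_sub_C_iff'.mpr fun x _ y _ h => h
  · refine LinearMap.ext_on hspan fun v hv => ?_
    obtain ⟨μ, hμ⟩ := hs v hv
    by_cases hv0 : v = 0
    · simp [hv0]
    have hev : f.HasEigenvector μ v := Module.End.hasEigenvector_iff.mpr
      ⟨Module.End.mem_eigenspace_iff.mpr hμ, hv0⟩
    rw [Module.End.aeval_apply_of_hasEigenvector hev, Polynomial.eval_prod,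
      Finset.prod_eq_zero (i := μ)]
    · simp
    · simpa using Module.End.hasEigenvalue_of_hasEigenvector hev
    · simp

/-- For a possibly infinite commuting family the joint generalized eigenspaces span. Semisimplicity
turns their vectors into joint eigenvectors, and the rows of Q come from a basis chosen among these.
-/
theorem exists_simultaneous_diag {ι : Type*} (F : ι → Matrix (Fin n) (Fin n) ℂ)
    (hc : ∀ i j, Commute (F i) (F j)) (hs : ∀ i, Module.End.IsSemisimple (Matrix.toLin' (F i))) :
    ∃ Q : GL (Fin n) ℂ, ∀ i, (Q.val * F i * (Q⁻¹).val).IsDiag := by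
  have htop := Module.End.iSup_iInf_maxGenEigenspace_eq_top_of_iSup_maxGenEigenspace_eq_top_of_commute
    (fun i => Matrix.toLin' (F i))
    (fun i j _ => by
      change Matrix.toLin' (F i) * Matrix.toLin' (F j) = Matrix.toLin' (F j) * Matrix.toLin' (F i)
      rw [Module.End.mul_eq_comp, Module.End.mul_eq_comp, ← Matrix.toLin'_mul, ← Matrix.toLin'_mul,
        (hc i j).eq])
    fun i => Module.End.iSup_maxGenEigenspace_eq_top _
  let B : Set (Fin n → ℂ) := {v | ∃ χ : ι → ℂ, ∀ i, Matrix.toLin' (F i) v = χ i • v}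
  have hB : Submodule.span ℂ B = ⊤ := by
    rw [eq_top_iff, ← htop]
    refine iSup_le fun χ v hv => Submodule.subset_span ⟨χ, fun i => ?_⟩
    have h := (Submodule.mem_iInf _).mp hv i
    rw [(hs i).isFinitelySemisimple.maxGenEigenspace_eq_eigenspace] at h
    exact Module.End.mem_eigenspace_iff.mp h
  obtain ⟨b, hbB, hbspan, hbli⟩ := exists_linearIndependent ℂ B
  let b₀ : Module.Basis b ℂ (Fin n → ℂ) := Module.Basis.mk hbli (by
    rw [Subtype.range_coe, hbspan, hB])
  let b₁ : Module.Basis (Fin n) ℂ (Fin n → ℂ) :=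
    b₀.reindex (b₀.indexEquiv (Pi.basisFun ℂ (Fin n)))
  have hb₁ : ∀ j, ∃ χ : ι → ℂ, ∀ i, Matrix.toLin' (F i) (b₁ j) = χ i • b₁ j := by
    intro j
    have : b₁ j ∈ B := by
      simp only [b₁, Module.Basis.reindex_apply, b₀, Module.Basis.mk_apply]
      exact hbB (Subtype.coe_prop _)
    exact this
  refine ⟨⟨b₁.toMatrix (Pi.basisFun ℂ (Fin n)), (Pi.basisFun ℂ (Fin n)).toMatrix b₁,
    Module.Basis.toMatrix_mul_toMatrix_flip _ _, Module.Basis.toMatrix_mul_toMatrix_flip _ _⟩,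
    fun i => ?_⟩
  have h := basis_toMatrix_mul_linearMap_toMatrix_mul_basis_toMatrix b₁ (Pi.basisFun ℂ (Fin n))
    b₁ (Pi.basisFun ℂ (Fin n)) (Matrix.toLin' (F i))
  rw [LinearMap.toMatrix_eq_toMatrix', LinearMap.toMatrix'_toLin'] at h
  change (b₁.toMatrix (Pi.basisFun ℂ (Fin n)) * F i * (Pi.basisFun ℂ (Fin n)).toMatrix b₁).IsDiag
  rw [h]
  intro k j hkj
  obtain ⟨χ, hχ⟩ := hb₁ j
  rw [LinearMap.toMatrix_apply, hχ, map_smul, Module.Basis.repr_self]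
  simp [hkj.symm]

theorem isSemisimple_of_isDiag {S : Matrix (Fin n) (Fin n) ℂ} {Q : GL (Fin n) ℂ}
    (hS : (Q.val * S * (Q⁻¹).val).IsDiag) : Module.End.IsSemisimple (Matrix.toLin' S) := by
  obtain ⟨d, hd⟩ : ∃ d, Q.val * S * (Q⁻¹).val = Matrix.diagonal d :=
    ⟨_, ((Matrix.isDiag_iff_diagonal_diag _).mp hS).symm⟩
  have hSQ : S * (Q⁻¹).val = (Q⁻¹).val * Matrix.diagonal d := by
    rw [← hd, ← mul_assoc, ← mul_assoc, ← Units.val_mul, inv_mul_cancel, Units.val_one, one_mul]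
  refine isSemisimple_of_span_eigenvectors _ (Set.range (Q⁻¹).val.col) ?_ ?_
  · rintro _ ⟨j, rfl⟩
    refine ⟨d j, ?_⟩
    ext i
    have := congrFun (congrFun hSQ i) j
    rw [Matrix.mul_diagonal] at this
    simp only [Matrix.toLin'_apply, Pi.smul_apply, smul_eq_mul, Matrix.col_apply]
    rw [mul_comm, ← this]
    rfl
  · rw [← Matrix.range_mulVecLin, LinearMap.range_eq_top]
    intro v
    refine ⟨Q.val.mulVec v, ?_⟩
    rw [Matrix.mulVecLin_apply, Matrix.mulVec_mulVec, ← Units.val_mul]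
    simp

/-- Leibniz puts one D on either factor, lowering i or j. The exponent i + j is not sharp, but local
nilpotency is all that is wanted. -/
theorem Derivation.pow_mul_eq_zero {R : Type*} [CommRing R] [Algebra ℂ R] (D : Derivation ℂ R R)
    (m : ℕ) : ∀ i j, i + j = m → ∀ a b, (D.toLinearMap ^ i) a = 0 → (D.toLinearMap ^ j) b = 0 →
      (D.toLinearMap ^ m) (a * b) = 0 := by
  induction m with
  | zero =>
    intro i j hij a b ha hb
    obtain ⟨rfl, rfl⟩ : i = 0 ∧ j = 0 := by omega
    simp_all
  | succ m ih =>
    intro i j hij a b ha hb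
    rcases i with _ | i
    · have : a = 0 := by simpa using ha
      simp [this]
    rcases j with _ | j
    · have : b = 0 := by simpa using hb
      simp [this]
    rw [pow_succ, Module.End.mul_apply] at ha hb ⊢
    have h : D.toLinearMap (a * b) = a * D.toLinearMap b + b * D.toLinearMap a := by
      simp
    rw [h, map_add, ih (i + 1) j (by omega) a _ (by rwa [pow_succ, Module.End.mul_apply]) hb,
      ih (j + 1) i (by omega) b _ (by rwa [pow_succ, Module.End.mul_apply]) ha, add_zero]

/-- The polynomials of degree at most one in the matrix entries. -/
def affinePolys (n : ℕ) : Submodule ℂ (MvPolynomial (Fin n × Fin n) ℂ) :=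
  Submodule.span ℂ (insert 1 (Set.range MvPolynomial.X))

/-- Containing the constants makes the powers increase, so they exhaust the polynomial ring by
finite-dimensional subspaces stable under every `leftInvariant A`. The Jordan decomposition of these
derivations takes place there. -/
theorem one_le_affinePolys : 1 ≤ affinePolys n := by
  rw [Submodule.one_le]
  exact Submodule.subset_span (Set.mem_insert _ _)

instance (d : ℕ) : FiniteDimensional ℂ (affinePolys n ^ d : Submodule ℂ _) := by
  rw [FiniteDimensional, Module.Finite.iff_fg]
  exact Submodule.FG.pow (Submodule.fg_span ((Set.finite_range _).insert _)) d

theorem exists_mem_affinePolys_pow (f : MvPolynomial (Fin n × Fin n) ℂ) :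
    ∃ d, f ∈ affinePolys n ^ d := by
  induction f using MvPolynomial.induction_on with
  | C a =>
    refine ⟨1, ?_⟩
    rw [pow_one, MvPolynomial.C_eq_smul_one]
    exact Submodule.smul_mem _ _ (Submodule.subset_span (Set.mem_insert _ _))
  | add p q hp hq =>
    obtain ⟨d, hd⟩ := hp
    obtain ⟨e, he⟩ := hq
    refine ⟨max d e, add_mem ?_ ?_⟩
    · exact pow_le_pow_right₀ one_le_affinePolys (le_max_left d e) hd
    · exact pow_le_pow_right₀ one_le_affinePolys (le_max_right d e) he
  | mul_X p i hp =>
    obtain ⟨d, hd⟩ := hp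
    refine ⟨d + 1, ?_⟩
    rw [pow_succ]
    exact Submodule.mul_mem_mul hd (Submodule.subset_span (Set.mem_insert_of_mem _ ⟨i, rfl⟩))

theorem leftInvariant_mem_affinePolys_pow (A : Matrix (Fin n) (Fin n) ℂ) (d : ℕ) :
    ∀ f ∈ affinePolys n ^ d, (leftInvariant A).toLinearMap f ∈ affinePolys n ^ d := by
  have h1 : ∀ f ∈ affinePolys n, leftInvariant A f ∈ affinePolys n := by
    intro f hf
    induction hf using Submodule.span_induction with
    | mem x hx =>
      rcases hx with rfl | ⟨p, rfl⟩
      · simp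
      · rw [leftInvariant_X]
        refine sum_mem fun k _ => ?_
        rw [mul_comm, ← MvPolynomial.smul_eq_C_mul]
        exact Submodule.smul_mem _ _ (Submodule.subset_span (Set.mem_insert_of_mem _ ⟨_, rfl⟩))
    | zero => simp
    | add x y _ _ hx hy => rw [map_add]; exact add_mem hx hy
    | smul c x _ hx => rw [Derivation.map_smul]; exact Submodule.smul_mem _ _ hx
  induction d with
  | zero =>
    intro f hf
    rw [pow_zero, Submodule.mem_one] at hf
    obtain ⟨c, rfl⟩ := hf
    simp
  | succ d ih =>
    intro f hf
    rw [pow_succ] at hf ⊢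
    induction hf using Submodule.mul_induction_on' with
    | mem_mul_mem a ha b hb =>
      have h : (leftInvariant A).toLinearMap (a * b) =
          a * leftInvariant A b + leftInvariant A a * b := by
        simp [mul_comm b]
      rw [h]
      exact add_mem (Submodule.mul_mem_mul ha (h1 b hb)) (Submodule.mul_mem_mul (ih a ha) hb)
    | add x _ y _ hx hy => rw [map_add]; exact add_mem hx hy

theorem leftInvariant_commute {A B : Matrix (Fin n) (Fin n) ℂ} (h : Commute A B)
    (f : MvPolynomial (Fin n × Fin n) ℂ) :
    leftInvariant A (leftInvariant B f) = leftInvariant B (leftInvariant A f) := by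
  have h1 : ⁅A, B⁆ = (0 : ℂ) • (0 : Matrix (Fin n) (Fin n) ℂ) := by
    rw [Ring.lie_def, h.eq, sub_self, zero_smul]
  have h2 := leftInvariant_lie A B
  rw [h1, leftInvariant_smul, zero_smul] at h2
  have h3 := DFunLike.congr_fun h2 f
  rw [Derivation.commutator_apply] at h3
  exact (sub_eq_zero.mp h3.symm)

/-- On the matrix of coordinates the k-th power of `leftInvariant N` is right multiplication by N ^
k. Leibniz extends local nilpotency from the coordinates to products. -/
theorem leftInvariant_pow_eq_zero {N : Matrix (Fin n) (Fin n) ℂ} (hN : IsNilpotent N)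
    (f : MvPolynomial (Fin n × Fin n) ℂ) : ∃ k, ((leftInvariant N).toLinearMap ^ k) f = 0 := by
  obtain ⟨m, hm⟩ := hN
  have hX : ∀ k p, ((leftInvariant N).toLinearMap ^ k) (MvPolynomial.X p) =
      ∑ l, MvPolynomial.X (p.1, l) * MvPolynomial.C ((N ^ k) l p.2) := by
    intro k
    induction k with
    | zero =>
      intro p
      rw [Finset.sum_eq_single p.2]
      · simp
      · intro l _ hl
        simp [Matrix.one_apply_ne hl]
      · simp
    | succ k ih =>
      intro p
      rw [pow_succ, Module.End.mul_apply]
      change ((leftInvariant N).toLinearMap ^ k) (leftInvariant N (MvPolynomial.X p)) = _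
      simp only [leftInvariant_X, map_sum, mul_comm (MvPolynomial.X _),
        ← MvPolynomial.smul_eq_C_mul, map_smul, ih, pow_succ, Matrix.mul_apply, Finset.smul_sum,
        smul_smul]
      rw [Finset.sum_comm]
      simp only [← MvPolynomial.smul_eq_C_mul, Finset.sum_mul, mul_comm (N _ _)]
  induction f using MvPolynomial.induction_on with
  | C a => exact ⟨1, by simp [MvPolynomial.derivation_C]⟩
  | add p q hp hq =>
    obtain ⟨i, hi⟩ := hp
    obtain ⟨j, hj⟩ := hq
    refine ⟨i + j, ?_⟩
    rw [map_add, add_comm i j, pow_add, Module.End.mul_apply, hi, ← pow_add, add_comm j i, pow_add,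
      Module.End.mul_apply, hj, map_zero, map_zero, add_zero]
  | mul_X p i hp =>
    obtain ⟨k, hk⟩ := hp
    exact ⟨k + m, Derivation.pow_mul_eq_zero _ _ k m rfl _ _ hk (by rw [hX, hm]; simp)⟩

/-- The entries of the coordinate matrix times Q⁻¹ are eigenvectors of the derivation, and products
of eigenvectors of a derivation are again eigenvectors. -/
theorem exists_eigenvectors_leftInvariant {S : Matrix (Fin n) (Fin n) ℂ} {Q : GL (Fin n) ℂ}
    (hS : (Q.val * S * (Q⁻¹).val).IsDiag) (d : ℕ) :
    ∃ s : Set (MvPolynomial (Fin n × Fin n) ℂ), Submodule.span ℂ s = affinePolys n ^ d ∧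
      ∀ v ∈ s, ∃ μ : ℂ, leftInvariant S v = μ • v := by
  obtain ⟨D, hD⟩ : ∃ D, Q.val * S * (Q⁻¹).val = Matrix.diagonal D :=
    ⟨_, ((Matrix.isDiag_iff_diagonal_diag _).mp hS).symm⟩
  have hSQ : S * (Q⁻¹).val = (Q⁻¹).val * Matrix.diagonal D := by
    rw [← hD, ← mul_assoc, ← mul_assoc, ← Units.val_mul, inv_mul_cancel, Units.val_one, one_mul]
  let Y (p : Fin n × Fin n) : MvPolynomial (Fin n × Fin n) ℂ :=
    ∑ k, (Q⁻¹).val k p.2 • MvPolynomial.X (p.1, k)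
  have hY : ∀ p, leftInvariant S (Y p) = D p.2 • Y p := by
    intro p
    have h1 : leftInvariant S (Y p) =
        ∑ l, (S * (Q⁻¹).val) l p.2 • MvPolynomial.X (R := ℂ) (p.1, l) := by
      simp only [Y, map_sum, Derivation.map_smul, leftInvariant_X, mul_comm (MvPolynomial.X _),
        ← MvPolynomial.smul_eq_C_mul, Finset.smul_sum, smul_smul, Matrix.mul_apply,
        Finset.sum_smul]
      rw [Finset.sum_comm]
      simp only [mul_comm]
    rw [h1, hSQ]
    simp only [Matrix.mul_diagonal, Y, Finset.smul_sum, smul_smul, mul_comm]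
  have hXY : ∀ p : Fin n × Fin n, MvPolynomial.X p = ∑ j, Q.val j p.2 • Y (p.1, j) := by
    intro p
    have h1 : ∑ j, Q.val j p.2 • Y (p.1, j) =
        ∑ k, ((Q⁻¹).val * Q.val) k p.2 • MvPolynomial.X (R := ℂ) (p.1, k) := by
      simp only [Y, Finset.smul_sum, smul_smul, Matrix.mul_apply, Finset.sum_smul]
      rw [Finset.sum_comm]
      simp only [mul_comm]
    rw [h1, ← Units.val_mul, inv_mul_cancel, Units.val_one, Finset.sum_eq_single p.2]
    · simp
    · intro l _ hl
      simp [Matrix.one_apply_ne hl]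
    · simp
  have hspan : affinePolys n = Submodule.span ℂ (insert 1 (Set.range Y)) := by
    refine le_antisymm (Submodule.span_le.mpr ?_) (Submodule.span_le.mpr ?_)
    · rintro _ (rfl | ⟨p, rfl⟩)
      · exact Submodule.subset_span (Set.mem_insert _ _)
      · rw [hXY]
        exact sum_mem fun k _ => Submodule.smul_mem _ _
          (Submodule.subset_span (Set.mem_insert_of_mem _ ⟨_, rfl⟩))
    · rintro _ (rfl | ⟨p, rfl⟩)
      · exact Submodule.subset_span (Set.mem_insert _ _)
      · exact sum_mem fun k _ => Submodule.smul_mem _ _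
          (Submodule.subset_span (Set.mem_insert_of_mem _ ⟨_, rfl⟩))
  refine ⟨(insert 1 (Set.range Y)) ^ d, by rw [hspan, Submodule.span_pow], ?_⟩
  induction d with
  | zero =>
    intro v hv
    rw [pow_zero, Set.mem_one] at hv
    exact ⟨0, by simp [hv]⟩
  | succ d ih =>
    intro v hv
    rw [pow_succ] at hv
    obtain ⟨a, ha, b, hb, rfl⟩ := Set.mem_mul.mp hv
    obtain ⟨μ, hμ⟩ := ih a ha
    obtain ⟨ν, hν⟩ : ∃ ν : ℂ, leftInvariant S b = ν • b := by
      rcases hb with rfl | ⟨p, rfl⟩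
      · exact ⟨0, by simp⟩
      · exact ⟨_, hY p⟩
    refine ⟨μ + ν, ?_⟩
    rw [Derivation.leibniz, hμ, hν, add_smul, smul_eq_mul, smul_eq_mul, mul_smul_comm,
      mul_smul_comm, mul_comm b a, add_comm]

/-- The semisimple part of an endomorphism preserves the invariant subspaces. -/
theorem mem_of_semisimple_part {V : Type*} [AddCommGroup V] [Module ℂ V] [FiniteDimensional ℂ V]
    {f g : Module.End ℂ V} (hfg : Commute f g) (hg : g.IsSemisimple) (hnil : IsNilpotent (f - g))
    (W : Submodule ℂ V) (hW : ∀ w ∈ W, f w ∈ W) : ∀ w ∈ W, g w ∈ W := by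
  let fW : Module.End ℂ W := LinearMap.restrict f hW
  have htop := Module.End.iSup_maxGenEigenspace_eq_top fW
  intro w hw
  have hw' : (⟨w, hw⟩ : W) ∈ ⨆ μ, fW.maxGenEigenspace μ := by
    rw [htop]
    trivial
  have key : ∀ x : W, x ∈ ⨆ μ, fW.maxGenEigenspace μ → g x ∈ W := by
    intro x hx
    induction hx using Submodule.iSup_induction' with
    | mem μ x hx =>
      have h1 := Submodule.inf_genEigenspace f W hW (μ := μ) (k := ⊤)
      have h2 : (x : V) ∈ W ⊓ f.genEigenspace μ ⊤ := by
        rw [h1]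
        exact Submodule.mem_map_of_mem (f := W.subtype) hx
      rw [Module.End.apply_eq_of_mem_of_comm_of_isFinitelySemisimple_of_isNil h2.2 hfg
        hg.isFinitelySemisimple hnil]
      exact W.smul_mem _ x.2
    | zero => simp
    | add x y _ _ hx hy =>
      rw [Submodule.coe_add, map_add]
      exact add_mem hx hy
  exact key ⟨w, hw⟩ hw'

/-- The Lie algebra contains the semisimple parts of its elements. -/
theorem semisimple_part_mem {S N : Matrix (Fin n) (Fin n) ℂ} {Q : GL (Fin n) ℂ}
    (hS : (Q.val * S * (Q⁻¹).val).IsDiag) (hN : IsNilpotent N) (hSN : Commute S N)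
    (h : S + N ∈ lieAlgebra G) : S ∈ lieAlgebra G := by
  rw [mem_lieAlgebra] at h ⊢
  intro f hf
  obtain ⟨d, hd⟩ := exists_mem_affinePolys_pow f
  -- On V the derivation of S is the semisimple part of the derivation of S + N, so it preserves
  -- every subspace that the latter preserves, in particular the part of the ideal of G inside V.
  let V : Submodule ℂ (MvPolynomial (Fin n × Fin n) ℂ) := affinePolys n ^ d
  let res (B : Matrix (Fin n) (Fin n) ℂ) : Module.End ℂ V :=
    (leftInvariant B).toLinearMap.restrict (leftInvariant_mem_affinePolys_pow B d)
  have hres : ∀ B (v : V), ((res B v : V) : MvPolynomial (Fin n × Fin n) ℂ) =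
      leftInvariant B v := fun B v => rfl
  have hss : (res S).IsSemisimple := by
    obtain ⟨s, hs, hsev⟩ := exists_eigenvectors_leftInvariant hS d
    refine isSemisimple_of_span_eigenvectors (res S) (Subtype.val ⁻¹' s) ?_ ?_
    · intro v hv
      obtain ⟨μ, hμ⟩ := hsev v hv
      exact ⟨μ, Subtype.ext hμ⟩
    · have hsV : s ⊆ V := by
        change s ⊆ (affinePolys n ^ d : Submodule ℂ _)
        rw [← hs]
        exact Submodule.subset_span
      have h1 : (Submodule.span ℂ (Subtype.val ⁻¹' s : Set V)).map V.subtype = V := by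
        rw [Submodule.map_span, V.coe_subtype]
        have h2 : (Subtype.val : V → _) '' (Subtype.val ⁻¹' s) = s := by
          refine Set.image_preimage_eq_of_subset fun x hx => ?_
          exact ⟨⟨x, hsV hx⟩, rfl⟩
        rw [h2, hs]
      refine Submodule.map_injective_of_injective V.injective_subtype ?_
      rw [h1, Submodule.map_top, Submodule.range_subtype]
  have hsub : res (S + N) - res S = res N := by
    ext v : 2
    rw [LinearMap.sub_apply, Submodule.coe_sub, hres, hres, hres, leftInvariant_add]
    simp
  have hnil : IsNilpotent (res (S + N) - res S) := by
    rw [hsub, Module.End.isNilpotent_iff_of_finite]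
    intro v
    obtain ⟨k, hk⟩ := leftInvariant_pow_eq_zero hN v.val
    refine ⟨k, Subtype.ext ?_⟩
    have : ∀ k, (((res N) ^ k) v).val = ((leftInvariant N).toLinearMap ^ k) v.val := by
      intro k
      induction k with
      | zero => rfl
      | succ k ih =>
        rw [pow_succ', pow_succ', Module.End.mul_apply, Module.End.mul_apply, hres, ih]
        rfl
    rw [this, hk]
    rfl
  have hcomm : Commute (res (S + N)) (res S) := by
    ext v : 2
    rw [Module.End.mul_apply, Module.End.mul_apply, hres, hres, hres, hres]
    exact leftInvariant_commute ((Commute.refl S).add_left hSN.symm) _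
  let W : Submodule ℂ V := ((idealOf G).restrictScalars ℂ).comap V.subtype
  have hW : ∀ w ∈ W, res (S + N) w ∈ W := fun w hw => h _ hw
  exact mem_of_semisimple_part hcomm hss hnil W hW ⟨f, hd⟩ hf

/-- Jordan decomposition of an element of the Lie algebra. -/
theorem exists_jordan {A : Matrix (Fin n) (Fin n) ℂ} (hA : A ∈ lieAlgebra G) :
    ∃ S N : Matrix (Fin n) (Fin n) ℂ, A = S + N ∧ S ∈ lieAlgebra G ∧ N ∈ lieAlgebra G ∧
      Module.End.IsSemisimple (Matrix.toLin' S) ∧ IsNilpotent N ∧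
      ∀ X, Commute A X → Commute S X ∧ Commute N X := by
  let e := Matrix.toLinAlgEquiv' (R := ℂ) (n := Fin n)
  obtain ⟨N', hN', S', hS', hNn, hSs, hA'⟩ :=
    Module.End.exists_isNilpotent_isSemisimple (K := ℂ) (V := Fin n → ℂ) (f := e A)
  have hcomm : ∀ B ∈ Algebra.adjoin ℂ {(e A : Module.End ℂ (Fin n → ℂ))}, ∀ X, Commute A X →
      Commute (e.symm B) X := by
    intro B hB X hX
    have h1 : Commute (e A : Module.End ℂ (Fin n → ℂ)) (e X) := hX.map e
    have h2 := Algebra.commute_of_mem_adjoin_singleton_of_commute hB h1.symm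
    have h3 := h2.map e.symm
    rw [e.symm_apply_apply] at h3
    exact h3.symm
  have hSN : Commute (e.symm S') (e.symm N') :=
    hcomm S' hS' _ (hcomm N' hN' _ (Commute.refl A)).symm
  have hsum : A = e.symm S' + e.symm N' := by
    rw [← map_add, add_comm, ← hA', e.symm_apply_apply]
  have hSs' : Module.End.IsSemisimple (Matrix.toLin' (e.symm S')) := by
    have : Matrix.toLin' (e.symm S') = S' := e.apply_symm_apply S'
    rw [this]
    exact hSs
  have hNn' : IsNilpotent (e.symm N') := hNn.map e.symm
  obtain ⟨Q, hQ⟩ := exists_simultaneous_diag (fun _ : Unit => e.symm S')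
    (fun _ _ => Commute.refl _) fun _ => hSs'
  have hSmem := semisimple_part_mem (hQ ()) hNn' hSN (hsum ▸ hA)
  refine ⟨_, _, hsum, hSmem, ?_, hSs', hNn', fun X hX => ⟨hcomm S' hS' X hX, hcomm N' hN' X hX⟩⟩
  have : e.symm N' = A - e.symm S' := by rw [hsum, add_sub_cancel_left]
  rw [this]
  exact sub_mem hA hSmem

end NilpotentOrbit
end

noncomputable section
namespace NilpotentOrbit

open NormedSpace (exp)

variable {n : ℕ} {G : Subgroup (GL (Fin n) ℂ)}

/-! ### The Lie algebra of a maximal torus -/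

/-- C is the connected component of 1 in D. Only left translations are assumed continuous, since
multiplication need not be jointly continuous in the Zariski topology; they suffice because a⁻¹C is
a connected subset of D through 1 for each a in C. -/
theorem exists_connected_subgroup {Γ : Type*} [Group Γ] [TopologicalSpace Γ]
    (hmul : ∀ a : Γ, Continuous fun g => a * g) (D : Subgroup Γ) (hD : IsClosed (D : Set Γ)) :
    ∃ C : Subgroup Γ, C ≤ D ∧ IsClosed (C : Set Γ) ∧ IsConnected (C : Set Γ) ∧
      ∀ S : Set Γ, IsPreconnected S → 1 ∈ S → S ⊆ D → S ⊆ C := by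
  let C : Set Γ := connectedComponentIn D 1
  have h1 : (1 : Γ) ∈ C := mem_connectedComponentIn D.one_mem
  have hpre : IsPreconnected C := isPreconnected_connectedComponentIn
  have hsub : C ⊆ D := connectedComponentIn_subset _ _
  have hmax : ∀ S : Set Γ, IsPreconnected S → 1 ∈ S → S ⊆ D → S ⊆ C :=
    fun S hS h hSD => hS.subset_connectedComponentIn h hSD
  have hdiv : ∀ a ∈ C, ∀ b ∈ C, a⁻¹ * b ∈ C := by
    intro a ha b hb
    refine hmax ((fun g => a⁻¹ * g) '' C) (hpre.image _ (hmul _).continuousOn)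
      ⟨a, ha, inv_mul_cancel a⟩ ?_ ⟨b, hb, rfl⟩
    rintro _ ⟨g, hg, rfl⟩
    exact D.mul_mem (D.inv_mem (hsub ha)) (hsub hg)
  have hinv : ∀ a ∈ C, a⁻¹ ∈ C := fun a ha => by simpa using hdiv a ha 1 h1
  refine ⟨⟨⟨⟨C, fun {a b} ha hb => by simpa using hdiv _ (hinv a ha) b hb⟩, h1⟩,
    fun {a} ha => hinv a ha⟩, hsub, ?_, ⟨⟨1, h1⟩, hpre⟩, hmax⟩
  refine isClosed_of_closure_subset ?_
  exact hmax _ hpre.closure (subset_closure h1) (hD.closure_subset_iff.mpr hsub)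

theorem isDiag_commute {A B : Matrix (Fin n) (Fin n) ℂ} (hA : A.IsDiag) (hB : B.IsDiag) :
    Commute A B := by
  rw [← hA.diagonal_diag, ← hB.diagonal_diag]
  exact Matrix.commute_diagonal _ _

theorem commute_of_isDiag_conj {P : GL (Fin n) ℂ} {A B : Matrix (Fin n) (Fin n) ℂ}
    (hA : (P.val * A * (P⁻¹).val).IsDiag) (hB : (P.val * B * (P⁻¹).val).IsDiag) :
    Commute A B := by
  have h := (isDiag_commute hA hB).eq
  have h' : ∀ X Y : Matrix (Fin n) (Fin n) ℂ,
      (P⁻¹).val * (P.val * X * (P⁻¹).val * (P.val * Y * (P⁻¹).val)) * P.val = X * Y := by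
    intro X Y
    simp [mul_assoc]
  rw [commute_iff_eq, ← h', h, h']

/-- The matrix entries of `P g P⁻¹`, as linear functionals of `g`. -/
def conjEntry (P : GL (Fin n) ℂ) (i j : Fin n) : Matrix (Fin n) (Fin n) ℂ →ₗ[ℂ] ℂ :=
  Matrix.entryLinearMap ℂ ℂ i j ∘ₗ LinearMap.mulRight ℂ (P⁻¹).val ∘ₗ LinearMap.mulLeft ℂ P.val

theorem conjEntry_apply (P : GL (Fin n) ℂ) (i j : Fin n) (A : Matrix (Fin n) (Fin n) ℂ) :
    conjEntry P i j A = (P.val * A * (P⁻¹).val) i j := rfl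

theorem isDiag_of_mem_lieAlgebra {K : Subgroup (GL (Fin n) ℂ)}
    (hK : IsClosed[zariski n] (K : Set (GL (Fin n) ℂ))) {P : GL (Fin n) ℂ}
    (hP : ∀ g ∈ K, (P.val * g.val * (P⁻¹).val).IsDiag) {A : Matrix (Fin n) (Fin n) ℂ}
    (hA : A ∈ lieAlgebra K) : (P.val * A * (P⁻¹).val).IsDiag :=
  fun i j hij => functional_eq_zero hK hA (conjEntry P i j) 0 fun g hg => hP g hg hij

theorem isClosed_isDiag (P : GL (Fin n) ℂ) :
    IsClosed[zariskiOn G] {g : G | (P.val * (g : GL (Fin n) ℂ).val * (P⁻¹).val).IsDiag} := by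
  refine isClosed_zariskiOn_of_linear {l | ∃ i j, i ≠ j ∧ l = conjEntry P i j} fun g => ?_
  constructor
  · rintro h _ ⟨i, j, hij, rfl⟩
    exact h hij
  · intro h i j hij
    exact h _ ⟨i, j, hij, rfl⟩

/-- The subgroup of the elements of `G` that `P` conjugates to diagonal matrices. -/
def diagSubgroup (G : Subgroup (GL (Fin n) ℂ)) (P : GL (Fin n) ℂ) : Subgroup G where
  carrier := {g : G | (P.val * (g : GL (Fin n) ℂ).val * (P⁻¹).val).IsDiag}
  mul_mem' {a b} ha hb := by
    have ha' : (P.val * (a : GL (Fin n) ℂ).val * (P⁻¹).val).IsDiag := ha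
    have hb' : (P.val * (b : GL (Fin n) ℂ).val * (P⁻¹).val).IsDiag := hb
    have h : (P.val * (a : GL (Fin n) ℂ).val * (P⁻¹).val *
        (P.val * (b : GL (Fin n) ℂ).val * (P⁻¹).val)).IsDiag := by
      rw [← ha'.diagonal_diag, ← hb'.diagonal_diag, Matrix.diagonal_mul_diagonal]
      exact Matrix.isDiag_diagonal _
    simpa [mul_assoc] using h
  one_mem' := by
    simp [Matrix.isDiag_one]
  inv_mem' {a} ha := by
    have h : (P.val * (a : GL (Fin n) ℂ).val * (P⁻¹).val)⁻¹ =
        P.val * ((a⁻¹ : G) : GL (Fin n) ℂ).val * (P⁻¹).val := by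
      refine Matrix.inv_eq_left_inv ?_
      simp [mul_assoc]
    have h2 : (P.val * (a : GL (Fin n) ℂ).val * (P⁻¹).val).IsDiag := ha
    rw [Set.mem_ofPred_eq, ← h, ← h2.diagonal_diag, Matrix.inv_diagonal]
    exact Matrix.isDiag_diagonal _

theorem continuous_exp_smul (A : Matrix (Fin n) (Fin n) ℂ) :
    Continuous fun t : ℂ => exp (t • A) :=
  continuous_matrix fun i j => continuous_iff_continuousAt.mpr fun t =>
    (hasDerivAt_functional_exp (Matrix.entryLinearMap ℂ ℂ i j) A t).continuousAt

theorem continuous_expG (hG : IsClosed[zariski n] (G : Set (GL (Fin n) ℂ))) (ξ : lieAlgebra G) :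
    Continuous fun t : ℝ => expG hG ((t : ℂ) • ξ) := by
  refine Continuous.subtype_mk ?_ _
  refine Units.continuous_iff.mpr ⟨(continuous_exp_smul ξ.val).comp Complex.continuous_ofReal, ?_⟩
  refine ((continuous_exp_smul (-ξ.val)).comp Complex.continuous_ofReal).congr fun t => ?_
  change exp ((t : ℂ) • -ξ.val) = exp (-((t : ℂ) • ξ.val))
  rw [smul_neg]

variable {H : Subgroup G}

theorem commute_of_isMaximalTorus (hH : IsMaximalTorus H) {a b : G} (ha : a ∈ H) (hb : b ∈ H) :
    Commute (a : GL (Fin n) ℂ).val (b : GL (Fin n) ℂ).val := by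
  obtain ⟨P, hP⟩ := hH.prop.diagonalizable
  exact commute_of_isDiag_conj (P := P) (hP a ha) (hP b hb)

theorem isDiag_of_mem_cartan (hG : IsClosed[zariski n] (G : Set (GL (Fin n) ℂ)))
    (hH : IsClosed[zariskiOn G] (H : Set G)) {P : GL (Fin n) ℂ}
    (hP : ∀ h ∈ H, ((P * (h : GL (Fin n) ℂ) * P⁻¹ : GL (Fin n) ℂ) :
      Matrix (Fin n) (Fin n) ℂ).IsDiag) {ξ : lieAlgebra G}
    (hξ : ξ ∈ cartan H) : (P.val * ξ.val * (P⁻¹).val).IsDiag := by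
  refine isDiag_of_mem_lieAlgebra (isClosed_map_subtype hG hH) ?_ hξ
  rintro _ ⟨h, hh, rfl⟩
  exact hP h hh

theorem expG_mem_of_mem_cartan (hG : IsClosed[zariski n] (G : Set (GL (Fin n) ℂ)))
    (hH : IsClosed[zariskiOn G] (H : Set G)) {ξ : lieAlgebra G}
    (hξ : ξ ∈ cartan H) : expG hG ξ ∈ H := by
  obtain ⟨h, hh, heq⟩ := exp_mem (isClosed_map_subtype hG hH) hξ
  have : h = expG hG ξ := Subtype.ext heq
  exact this ▸ hh

theorem mem_cartan_of_expG_mem (hG : IsClosed[zariski n] (G : Set (GL (Fin n) ℂ)))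
    {ξ : lieAlgebra G} (hξ : ∀ t : ℝ, expG hG ((t : ℂ) • ξ) ∈ H) : ξ ∈ cartan H :=
  mem_lieAlgebra_of_exp_mem fun t => ⟨_, hξ t, rfl⟩

/-- Diagonalize H and ξ together. The identity component of the elements of G that are diagonal in
this basis is a torus containing H and all exp(tξ), so by maximality it equals H. -/
theorem mem_cartan_of_isSemisimple (hG : IsClosed[zariski n] (G : Set (GL (Fin n) ℂ)))
    (hH : IsMaximalTorus H) {ξ : lieAlgebra G}
    (hc : ∀ h ∈ H, Commute (h : GL (Fin n) ℂ).val ξ.val)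
    (hs : Module.End.IsSemisimple (Matrix.toLin' ξ.val)) : ξ ∈ cartan H := by
  obtain ⟨P, hP⟩ := hH.prop.diagonalizable
  obtain ⟨Q, hQ⟩ := exists_simultaneous_diag (ι := Option H)
    (fun o => o.elim ξ.val fun h => ((h : G) : GL (Fin n) ℂ).val)
    (by
      rintro (_ | a) (_ | b)
      · exact Commute.refl _
      · exact (hc b b.2).symm
      · exact hc a a.2
      · exact commute_of_isMaximalTorus hH a.2 b.2)
    (by
      rintro (_ | a)
      · exact hs
      · exact isSemisimple_of_isDiag (Q := P) (hP a a.2))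
  obtain ⟨C, hCD, hCcl, hCco, hCmax⟩ := @exists_connected_subgroup G _ (zariskiOn G)
    (fun a => by simpa using continuous_zariskiOn_mul_mul a 1) (diagSubgroup G Q)
    (isClosed_isDiag Q)
  have hHC : H ≤ C := hCmax H hH.prop.isConnected.2 H.one_mem fun h hh => hQ (some ⟨h, hh⟩)
  have hC : IsTorus C := ⟨hCcl, hCco, Q, fun h hh => hCD hh⟩
  have hle : C ≤ H := hH.le_of_ge hC hHC
  refine mem_cartan_of_expG_mem hG fun t => hle ?_
  have hcont : @Continuous ℝ G _ (zariskiOn G) fun t : ℝ => expG hG ((t : ℂ) • ξ) :=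
    continuous_le_rng zariskiOn_coarser (continuous_expG hG ξ)
  refine hCmax (Set.range fun t : ℝ => expG hG ((t : ℂ) • ξ))
    (@isPreconnected_range ℝ G _ (zariskiOn G) _ _ hcont) ⟨0, ?_⟩ ?_ ⟨t, rfl⟩
  · refine Subtype.ext ?_
    simp [coe_expG]
  · rintro _ ⟨s, rfl⟩
    have h1 : Q.val * exp ((s : ℂ) • ξ.val) * (Q⁻¹).val =
        exp (Q.val * ((s : ℂ) • ξ.val) * (Q⁻¹).val) := (Matrix.exp_units_conj Q _).symm
    have h2 : (Q.val * ((s : ℂ) • ξ.val) * (Q⁻¹).val).IsDiag := by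
      rw [mul_smul_comm, smul_mul_assoc]
      exact (hQ none).smul _
    change (Q.val * exp ((s : ℂ) • ξ.val) * (Q⁻¹).val).IsDiag
    rw [h1, ← h2.diagonal_diag, Matrix.exp_diagonal]
    exact Matrix.isDiag_diagonal _

theorem mem_rootSpace {χ : H →* ℂˣ} {ξ : lieAlgebra G} :
    ξ ∈ rootSpace H χ ↔ ∀ h : H, (h : G) • ξ = (χ h : ℂ) • ξ := Iff.rfl

theorem exists_mem_rootSpace_of_smul_eq_smul {x : lieAlgebra G}
    (hx : ∀ h : H, ∃ c : ℂ, (h : G) • x = c • x) : ∃ χ : H →* ℂˣ, x ∈ rootSpace H χ := by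
  rcases eq_or_ne x 0 with rfl | hx0
  · exact ⟨1, zero_mem _⟩
  choose χ heig using hx
  let c : H →* ℂ :=
    { toFun := χ
      map_one' := by
        have h := heig 1
        rw [OneMemClass.coe_one, one_smul] at h
        have h2 : (1 : ℂ) • x = χ 1 • x := by rw [one_smul]; exact h
        exact (smul_left_injective ℂ hx0 h2).symm
      map_mul' := fun a b => by
        have h := heig (a * b)
        rw [Subgroup.coe_mul, mul_smul, heig b, smul_comm, heig a, smul_smul] at h
        rw [mul_comm]
        exact (smul_left_injective ℂ hx0 h).symm }
  exact ⟨c.toHomUnits, fun h => heig h⟩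

/-- The operators Ad h commute, so their joint generalized eigenspaces span. In a basis
diagonalizing H, each Ad h multiplies the (i, j) entry by a scalar, so generalized eigenvectors are
genuine ones. -/
theorem iSup_rootSpace_eq_top (hH : IsMaximalTorus H) :
    ⨆ χ : H →* ℂˣ, rootSpace H χ = ⊤ := by
  obtain ⟨P, hP⟩ := hH.prop.diagonalizable
  have htop := Module.End.iSup_iInf_maxGenEigenspace_eq_top_of_iSup_maxGenEigenspace_eq_top_of_commute
    (fun h : H => Ad (h : G))
    (fun a b _ => by
      refine LinearMap.ext fun x => ?_
      change (a : G) • (b : G) • x = (b : G) • (a : G) • x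
      have hab : (a : G) * b = b * a :=
        Subtype.ext (Units.ext (commute_of_isMaximalTorus hH a.2 b.2))
      rw [smul_smul, smul_smul, hab])
    (fun h => Module.End.iSup_maxGenEigenspace_eq_top _)
  rw [eq_top_iff, ← htop]
  refine iSup_le fun χ x hx => ?_
  have heig : ∀ h : H, (h : G) • x = χ h • x := by
    intro h
    have hx' := (Submodule.mem_iInf _).mp hx h
    rw [Module.End.mem_maxGenEigenspace] at hx'
    obtain ⟨k, hk⟩ := hx'
    obtain ⟨d, hd⟩ : ∃ d, P.val * ((h : G) : GL (Fin n) ℂ).val * (P⁻¹).val = Matrix.diagonal d :=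
      ⟨_, ((Matrix.isDiag_iff_diagonal_diag _).mp (hP h h.2)).symm⟩
    obtain ⟨e, he⟩ : ∃ e, P.val * (((h : G) : GL (Fin n) ℂ)⁻¹).val * (P⁻¹).val =
        Matrix.diagonal e :=
      ⟨_, ((Matrix.isDiag_iff_diagonal_diag _).mp (hP (h⁻¹ : H) (h⁻¹ : H).2)).symm⟩
    have hAd : ∀ (y : lieAlgebra G) i j, conjEntry P i j ((h : G) • y : lieAlgebra G).val =
        d i * e j * conjEntry P i j y.val := by
      intro y i j
      have : P.val * ((h : G) • y : lieAlgebra G).val * (P⁻¹).val =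
          Matrix.diagonal d * (P.val * y.val * (P⁻¹).val) * Matrix.diagonal e := by
        rw [← hd, ← he, coe_smul]
        simp [mul_assoc]
      rw [conjEntry_apply, conjEntry_apply, this, Matrix.mul_diagonal, Matrix.diagonal_mul]
      ring
    have hpow : ∀ (m : ℕ) i j,
        conjEntry P i j (((Ad (h : G) - algebraMap ℂ _ (χ h)) ^ m) x).val =
        (d i * e j - χ h) ^ m * conjEntry P i j x.val := by
      intro m i j
      induction m with
      | zero => simp
      | succ m ih =>
        rw [pow_succ', Module.End.mul_apply, LinearMap.sub_apply,
          Module.algebraMap_end_apply]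
        change conjEntry P i j (((h : G) • (((Ad (h : G) - algebraMap ℂ _ (χ h)) ^ m) x) :
          lieAlgebra G).val - χ h • (((Ad (h : G) - algebraMap ℂ _ (χ h)) ^ m) x).val) = _
        rw [map_sub, map_smul, hAd, ih, smul_eq_mul]
        ring
    have hval : P.val * ((h : G) • x : lieAlgebra G).val * (P⁻¹).val =
        P.val * (χ h • x : lieAlgebra G).val * (P⁻¹).val := by
      ext i j
      have h0 := hpow k i j
      have hk' : ((Ad (h : G) - algebraMap ℂ _ (χ h)) ^ k) x = 0 := by
        rw [← hk]; rfl
      rw [hk', ZeroMemClass.coe_zero, map_zero] at h0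
      have h1 : (d i * e j - χ h) * conjEntry P i j x.val = 0 := by
        rcases mul_eq_zero.mp h0.symm with h0 | h0
        · rw [eq_zero_of_pow_eq_zero h0, zero_mul]
        · rw [h0, mul_zero]
      change conjEntry P i j ((h : G) • x : lieAlgebra G).val = conjEntry P i j (χ h • x.val)
      rw [hAd, map_smul, smul_eq_mul]
      linear_combination h1
    have := congrArg (fun M => (P⁻¹).val * M * P.val) hval
    refine Subtype.ext ?_
    simpa [mul_assoc] using this
  obtain ⟨ψ, hψ⟩ := exists_mem_rootSpace_of_smul_eq_smul fun h => ⟨χ h, heig h⟩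
  exact Submodule.mem_iSup_of_mem ψ hψ

theorem eq_zero_of_killingForm_eq_zero (hG : IsSimplyConnectedSimple G) {ξ : lieAlgebra G}
    (h : ∀ η, killingForm ℂ (lieAlgebra G) ξ η = 0) : ξ = 0 := by
  have := isKilling hG
  have h1 : ξ ∈ LieIdeal.killingCompl ℂ (lieAlgebra G) ⊤ := by
    rw [LieIdeal.mem_killingCompl]
    intro y _
    rw [LieModule.traceForm_comm]
    exact h y
  rwa [LieAlgebra.IsKilling.killingCompl_top_eq_bot, LieSubmodule.mem_bot] at h1

theorem killingForm_rootSpace_eq_zero {χ ψ : H →* ℂˣ} (h : ∃ a, χ a * ψ a ≠ 1) {ξ η : lieAlgebra G}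
    (hξ : ξ ∈ rootSpace H χ) (hη : η ∈ rootSpace H ψ) :
    killingForm ℂ (lieAlgebra G) ξ η = 0 := by
  obtain ⟨a, ha⟩ := h
  have h1 := killingForm_smul_smul (a : G) ξ η
  rw [hξ a, hη a, map_smul, map_smul, LinearMap.smul_apply, smul_eq_mul, smul_eq_mul] at h1
  have h2 : ((χ a : ℂ) * ψ a - 1) * killingForm ℂ (lieAlgebra G) ξ η = 0 := by
    linear_combination h1
  refine (mul_eq_zero.mp h2).resolve_left fun h3 => ha (Units.ext ?_)
  simpa [sub_eq_zero] using h3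

/-- By invariance of the Killing form, weight spaces are orthogonal unless their characters are
inverse. So the trivial weight space pairs only with itself, and nondegeneracy on 𝔤 restricts to it.
-/
theorem eq_zero_of_killingForm_fixed_eq_zero (hG : IsSimplyConnectedSimple G)
    (hH : IsMaximalTorus H) {ξ : lieAlgebra G} (hξ : ξ ∈ rootSpace H 1)
    (h : ∀ η ∈ rootSpace H 1, killingForm ℂ (lieAlgebra G) ξ η = 0) : ξ = 0 := by
  refine eq_zero_of_killingForm_eq_zero hG fun η => ?_
  have hη : η ∈ ⨆ χ : H →* ℂˣ, rootSpace H χ := by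
    rw [iSup_rootSpace_eq_top hH]
    exact Submodule.mem_top
  induction hη using Submodule.iSup_induction' with
  | mem χ x hx =>
    rcases eq_or_ne χ 1 with rfl | hχ
    · exact h x hx
    · exact killingForm_rootSpace_eq_zero (by
        by_contra! h'
        exact hχ (MonoidHom.ext fun a => by simpa using h' a)) hξ hx
  | zero => exact map_zero _
  | add x y _ _ hx hy => rw [map_add, hx, hy, add_zero]

/-- The elements of the Lie algebra that are fixed by `H`, as a Lie subalgebra. -/
def fixedSubalgebra (H : Subgroup G) : LieSubalgebra ℂ (lieAlgebra G) where
  toSubmodule := rootSpace H 1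
  lie_mem' {x y} hx hy h := by
    rw [smul_lie_adjoint, hx h, hy h]
    simp

theorem mem_fixedSubalgebra {ξ : lieAlgebra G} :
    ξ ∈ fixedSubalgebra H ↔ ξ ∈ rootSpace H 1 := Iff.rfl

theorem mem_rootSpace_one_iff {ξ : lieAlgebra G} :
    ξ ∈ rootSpace H 1 ↔ ∀ h ∈ H, Commute (h : GL (Fin n) ℂ).val ξ.val := by
  rw [mem_rootSpace]
  constructor
  · intro hξ h hh
    have h1 := hξ ⟨h, hh⟩
    rw [MonoidHom.one_apply, Units.val_one, one_smul, smul_eq_iff] at h1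
    exact h1
  · intro hξ h
    rw [MonoidHom.one_apply, Units.val_one, one_smul, smul_eq_iff]
    exact hξ h h.2

theorem mem_rootSpace_one_of_mem_cartan (hG : IsClosed[zariski n] (G : Set (GL (Fin n) ℂ)))
    (hH : IsMaximalTorus H) {ξ : lieAlgebra G} (hξ : ξ ∈ cartan H) : ξ ∈ rootSpace H 1 := by
  obtain ⟨P, hP⟩ := hH.prop.diagonalizable
  exact mem_rootSpace_one_iff.mpr fun h hh =>
    commute_of_isDiag_conj (P := P) (hP h hh) (isDiag_of_mem_cartan hG hH.prop.isClosed hP hξ)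

theorem lie_eq_zero_of_mem_cartan (hG : IsClosed[zariski n] (G : Set (GL (Fin n) ℂ)))
    (hH : IsMaximalTorus H) {ξ η : lieAlgebra G} (hξ : ξ ∈ cartan H) (hη : η ∈ rootSpace H 1) :
    ⁅ξ, η⁆ = 0 := by
  rw [lie_eq_zero_iff_commute]
  refine commute_of_forall_commute (isClosed_map_subtype hG hH.prop.isClosed) hξ ?_
  rintro _ ⟨h, hh, rfl⟩
  exact mem_rootSpace_one_iff.mp hη h hh

theorem isNilpotent_ad_of_isNilpotent_val {ξ : lieAlgebra G} (hξ : IsNilpotent ξ.val) :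
    IsNilpotent (LieAlgebra.ad ℂ (lieAlgebra G) ξ) :=
  LieAlgebra.isNilpotent_ad_of_isNilpotent hξ

theorem exists_jordan_fixed (hG : IsClosed[zariski n] (G : Set (GL (Fin n) ℂ)))
    (hH : IsMaximalTorus H) {ξ : lieAlgebra G} (hξ : ξ ∈ rootSpace H 1) :
    ∃ S N : lieAlgebra G, ξ = S + N ∧ S ∈ cartan H ∧ N ∈ rootSpace H 1 ∧
      IsNilpotent (LieAlgebra.ad ℂ (lieAlgebra G) N) := by
  obtain ⟨S, N, hA, hS, hN, hSs, hNn, hc⟩ := exists_jordan ξ.2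
  rw [mem_rootSpace_one_iff] at hξ
  refine ⟨⟨S, hS⟩, ⟨N, hN⟩, Subtype.ext hA, ?_, ?_, isNilpotent_ad_of_isNilpotent_val hNn⟩
  · exact mem_cartan_of_isSemisimple hG hH (fun h hh => ((hc _ (hξ h hh).symm).1).symm) hSs
  · exact mem_rootSpace_one_iff.mpr fun h hh => ((hc _ (hξ h hh).symm).2).symm

/-- Engel's criterion: the semisimple part of a fixed element lies in 𝔥, which is central among the
fixed elements, so only the nilpotent part contributes to ad. -/
theorem isNilpotent_fixedSubalgebra (hG : IsClosed[zariski n] (G : Set (GL (Fin n) ℂ)))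
    (hH : IsMaximalTorus H) : LieRing.IsNilpotent (fixedSubalgebra H) := by
  rw [LieAlgebra.isNilpotent_iff_forall (R := ℂ)]
  rintro ⟨x, hx⟩
  obtain ⟨S, N, rfl, hS, hN, hNn⟩ := exists_jordan_fixed hG hH hx
  have h1 := LieSubalgebra.isNilpotent_ad_of_isNilpotent_ad (fixedSubalgebra H)
    (x := ⟨N, hN⟩) hNn
  have h2 : LieAlgebra.ad ℂ (fixedSubalgebra H) ⟨S + N, hx⟩ =
      LieAlgebra.ad ℂ (fixedSubalgebra H) ⟨N, hN⟩ := by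
    ext y : 1
    refine Subtype.ext ?_
    change ⁅S + N, y.val⁆ = ⁅N, y.val⁆
    rw [add_lie, lie_eq_zero_of_mem_cartan hG hH hS y.2, zero_add]
  rw [h2]
  exact h1

/-- The nilpotent part N of a fixed element is orthogonal to the whole fixed subalgebra: that
subalgebra is nilpotent, so traces are sums over its weights, and these vanish at N. Nondegeneracy
there gives N = 0, leaving only the semisimple part, which lies in 𝔥. -/
theorem cartan_eq_rootSpace_one (hG : IsSimplyConnectedSimple G) (hH : IsMaximalTorus H) :
    cartan H = rootSpace H 1 := by
  refine le_antisymm (fun ξ hξ => mem_rootSpace_one_of_mem_cartan hG.isClosed hH hξ) fun ξ hξ => ?_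
  obtain ⟨S, N, rfl, hS, hN, hNn⟩ := exists_jordan_fixed hG.isClosed hH hξ
  have := isNilpotent_fixedSubalgebra hG.isClosed hH
  have hN0 : N = 0 := by
    refine eq_zero_of_killingForm_fixed_eq_zero hG hH hN fun η hη => ?_
    have h1 : killingForm ℂ (lieAlgebra G) N η =
        LieModule.traceForm ℂ (fixedSubalgebra H) (lieAlgebra G) ⟨N, hN⟩ ⟨η, hη⟩ := rfl
    rw [h1, LieModule.traceForm_eq_sum_finrank_nsmul_mul]
    refine Finset.sum_eq_zero fun χ _ => ?_
    rw [LieModule.Weight.apply_eq_zero_of_isNilpotent ⟨N, hN⟩ hNn χ, zero_mul, smul_zero]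
  rw [hN0, add_zero]
  exact hS

end NilpotentOrbit
end

noncomputable section
namespace NilpotentOrbit

open NormedSpace (exp)

variable {n : ℕ} {G : Subgroup (GL (Fin n) ℂ)} {H : Subgroup G}

/-! ### A maximal torus is generated by exponentials -/

/-- The subgroup K and the union of the other listed cosets are disjoint closed sets covering the
connected A, and A meets K in 1. -/
theorem le_of_subset_cosets {Γ : Type*} [Group Γ] [TopologicalSpace Γ]
    (hmul : ∀ a : Γ, Continuous fun g => a * g) {A K : Subgroup Γ}
    (hA : IsPreconnected (A : Set Γ)) (hK : IsClosed (K : Set Γ)) (s : Finset Γ)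
    (h : ∀ a ∈ A, ∃ t ∈ s, t⁻¹ * a ∈ K) : A ≤ K := by
  classical
  let Z : Set Γ := ⋃ t ∈ s.filter (· ∉ K), {g | t⁻¹ * g ∈ K}
  have hZ : IsClosed Z := isClosed_biUnion_finset fun t _ => hK.preimage (hmul t⁻¹)
  intro a ha
  by_contra haK
  obtain ⟨z, -, hzK, hzZ⟩ := isPreconnected_closed_iff.mp hA K Z hK hZ
    (fun x hx => by
      obtain ⟨t, ht, htx⟩ := h x hx
      by_cases htK : t ∈ K
      · left
        simpa using K.mul_mem htK htx
      · right
        simp only [Z, Set.mem_iUnion, Finset.mem_filter]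
        exact ⟨t, ⟨ht, htK⟩, htx⟩)
    ⟨1, A.one_mem, K.one_mem⟩
    ⟨a, ha, by
      obtain ⟨t, ht, hta⟩ := h a ha
      simp only [Z, Set.mem_iUnion, Finset.mem_filter]
      refine ⟨t, ⟨ht, fun htK => haK ?_⟩, hta⟩
      simpa using K.mul_mem htK hta⟩
  simp only [Z, Set.mem_iUnion, Finset.mem_filter] at hzZ
  obtain ⟨t, ⟨-, htK⟩, htz⟩ := hzZ
  refine htK ?_
  have := K.mul_mem hzK (K.inv_mem htz)
  simpa using this

/-- By compactness, the local inclusion of T in K puts T inside finitely many cosets of K. Their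
union is Zariski-closed, so it contains H, and connectedness of H leaves only K. -/
theorem closure_le_of_nhds {T : Subgroup G} (hT : IsCompact (T : Set G))
    (hTH : closure[zariskiOn G] (T : Set G) = (H : Set G))
    (hH : @IsPreconnected G (zariskiOn G) (H : Set G)) {K : Subgroup G}
    (hK : IsClosed[zariskiOn G] (K : Set G)) (h : {g : G | g ∈ T → g ∈ K} ∈ 𝓝 (1 : G)) :
    H ≤ K := by
  obtain ⟨s, hsT, hs⟩ := hT.elim_nhds_subcover (fun t => {g : G | t⁻¹ * g ∈ T → t⁻¹ * g ∈ K})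
    fun t _ => by
      have hc : Continuous fun g : G => t⁻¹ * g := continuous_const.mul continuous_id
      refine hc.continuousAt.preimage_mem_nhds (x := t) (t := {g : G | g ∈ T → g ∈ K}) ?_
      rwa [inv_mul_cancel]
  have hmul (a : G) : Continuous[zariskiOn G, zariskiOn G] fun g => a * g := by
    simpa using continuous_zariskiOn_mul_mul a 1
  refine @le_of_subset_cosets G _ (zariskiOn G) hmul H K hH hK s fun a ha => ?_
  have hcl : IsClosed[zariskiOn G] (⋃ t ∈ s, {g : G | t⁻¹ * g ∈ K}) :=
    @isClosed_biUnion_finset _ _ (zariskiOn G) s _ fun t _ =>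
      @IsClosed.preimage _ _ (zariskiOn G) (zariskiOn G) _ (hmul t⁻¹) _ hK
  have hsub : (T : Set G) ⊆ ⋃ t ∈ s, {g : G | t⁻¹ * g ∈ K} := by
    intro g hg
    have hg' := hs hg
    simp only [Set.mem_iUnion] at hg' ⊢
    obtain ⟨t, ht, htg⟩ := hg'
    exact ⟨t, ht, htg (T.mul_mem (T.inv_mem (hsT t ht)) hg)⟩
  have ha' : a ∈ ⋃ t ∈ s, {g : G | t⁻¹ * g ∈ K} := by
    refine (@closure_minimal _ (zariskiOn G) _ _ hsub hcl) ?_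
    rw [hTH]
    exact ha
  simp only [Set.mem_iUnion] at ha'
  obtain ⟨t, ht, hta⟩ := ha'
  exact ⟨t, ht, hta⟩

/-- Every Zariski-closed subgroup of `G` that contains the exponentials of the elements of the Lie
algebra of `H` contains `H`. -/
def GeneratedByExp (hG : IsClosed[zariski n] (G : Set (GL (Fin n) ℂ))) (H : Subgroup G) : Prop :=
  ∀ K : Subgroup G, IsClosed[zariskiOn G] (K : Set G) → (∀ ξ ∈ cartan H, expG hG ξ ∈ K) → H ≤ K

/-- The logarithm of the matrices that `P` conjugates to diagonal ones. -/
def diagLog (P g : GL (Fin n) ℂ) : Matrix (Fin n) (Fin n) ℂ :=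
  (P⁻¹).val * Matrix.diagonal (fun i => Complex.log ((P.val * g.val * (P⁻¹).val) i i)) * P.val

theorem diagLog_one (P : GL (Fin n) ℂ) : diagLog P 1 = 0 := by
  simp [diagLog]

theorem isDiag_diagLog (P g : GL (Fin n) ℂ) : (P.val * diagLog P g * (P⁻¹).val).IsDiag := by
  have : P.val * diagLog P g * (P⁻¹).val =
      Matrix.diagonal (fun i => Complex.log ((P.val * g.val * (P⁻¹).val) i i)) := by
    simp [diagLog, mul_assoc]
  rw [this]
  exact Matrix.isDiag_diagonal _

theorem expGL_diagLog {P g : GL (Fin n) ℂ} (hg : (P.val * g.val * (P⁻¹).val).IsDiag) :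
    expGL (diagLog P g) = g := by
  have h : P.val * g.val * (P⁻¹).val = Matrix.diagonal
      fun i => (P.val * g.val * (P⁻¹).val) i i := hg.diagonal_diag.symm
  have hne : ∀ i, (P.val * g.val * (P⁻¹).val) i i ≠ 0 := by
    have hu : IsUnit (P.val * g.val * (P⁻¹).val) := (P * g * P⁻¹).isUnit
    rw [h, Matrix.isUnit_diagonal, Pi.isUnit_iff] at hu
    exact fun i => (hu i).ne_zero
  apply Units.ext
  rw [coe_expGL, diagLog]
  have h1 := Matrix.exp_units_conj P⁻¹
    (Matrix.diagonal (fun i => Complex.log ((P.val * g.val * (P⁻¹).val) i i)))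
  rw [inv_inv] at h1
  rw [h1, Matrix.exp_diagonal]
  have h2 : exp (fun i => Complex.log ((P.val * g.val * (P⁻¹).val) i i)) =
      fun i => (P.val * g.val * (P⁻¹).val) i i := by
    funext i
    rw [Pi.coe_exp, ← Complex.exp_eq_exp_ℂ, Complex.exp_log (hne i)]
  rw [h2, ← h]
  simp [mul_assoc]

theorem continuousAt_diagLog (P : GL (Fin n) ℂ) :
    ContinuousAt (fun g : G => diagLog P (g : GL (Fin n) ℂ)) 1 := by
  have hcoe : Continuous fun g : G => (P.val * (g : GL (Fin n) ℂ).val * (P⁻¹).val) :=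
    (continuous_const.mul (Units.continuous_val.comp continuous_subtype_val)).mul continuous_const
  have hd : ContinuousAt (fun g : G => Matrix.diagonal
      (fun i => Complex.log ((P.val * (g : GL (Fin n) ℂ).val * (P⁻¹).val) i i))) 1 := by
    have h0 : ContinuousAt (fun g : G => (fun i => Complex.log ((P.val * (g : GL (Fin n) ℂ).val *
        (P⁻¹).val) i i))) 1 := by
      refine continuousAt_pi.mpr fun i => ?_
      refine ContinuousAt.clog (hcoe.matrix_elem i i).continuousAt ?_
      simp
    exact (continuous_id.matrix_diagonal.continuousAt).comp h0
  exact (continuousAt_const.mul hd).mul continuousAt_const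

theorem lieAlgebra_mono {K : Subgroup (GL (Fin n) ℂ)}
    (hK : IsClosed[zariski n] (K : Set (GL (Fin n) ℂ))) (hKG : K ≤ G) :
    lieAlgebra K ≤ lieAlgebra G :=
  fun _ hA => mem_lieAlgebra_of_exp_mem fun t => hKG (exp_smul_mem hK hA t)

/-- It suffices that elements of T near 1 lie in K. Split the logarithm of such an element as b + c,
with b in 𝔥 and c in a fixed complement; the diagonal parts commute, so exp(c) is in H. If the
element is outside K then c ≠ 0. Arbitrarily small such c would produce, by
`exists_mem_lieAlgebra_of_small`, a nonzero vector of 𝔥 in the complement. -/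
theorem generatedByExp (hG : IsClosed[zariski n] (G : Set (GL (Fin n) ℂ))) {T : Subgroup G}
    (hT : IsCompact (T : Set G)) (hTH : closure[zariskiOn G] (T : Set G) = (H : Set G))
    (hH : IsTorus H) : GeneratedByExp hG H := by
  intro K hK hexp
  refine closure_le_of_nhds hT hTH hH.isConnected.2 hK ?_
  by_contra hcon
  have hTle : T ≤ H := fun t ht => by
    have : t ∈ closure[zariskiOn G] (T : Set G) := @subset_closure _ (zariskiOn G) _ _ ht
    rwa [hTH] at this
  obtain ⟨P, hP⟩ := hH.diagonalizable
  let Hm : Subgroup (GL (Fin n) ℂ) := H.map G.subtype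
  have hHm : IsClosed[zariski n] (Hm : Set (GL (Fin n) ℂ)) := isClosed_map_subtype hG hH.isClosed
  have hHmG : Hm ≤ G := by
    rintro _ ⟨g, -, rfl⟩
    exact g.2
  let L : Submodule ℂ (Matrix (Fin n) (Fin n) ℂ) := (lieAlgebra Hm).toSubmodule
  let D : Submodule ℂ (Matrix (Fin n) (Fin n) ℂ) :=
    ⨅ i, ⨅ j, ⨅ (_ : i ≠ j), LinearMap.ker (conjEntry P i j)
  have hD : ∀ A, A ∈ D ↔ (P.val * A * (P⁻¹).val).IsDiag := by
    intro A
    simp only [D, Submodule.mem_iInf, LinearMap.mem_ker, conjEntry_apply]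
    rfl
  have hLD : ∀ A ∈ L, A ∈ D := by
    intro A hA
    rw [hD]
    refine isDiag_of_mem_lieAlgebra hHm ?_ hA
    rintro _ ⟨h, hh, rfl⟩
    exact hP h hh
  obtain ⟨W, hW⟩ := L.exists_isCompl
  let π := W.projection L hW.symm
  have hπ : Continuous π := LinearMap.continuous_of_finiteDimensional π
  obtain ⟨C, hCW, hC0, hC⟩ := exists_mem_lieAlgebra_of_small hHm (W ⊓ D) fun V hV => by
    have hev : ∀ᶠ g : G in 𝓝 1, π (diagLog P (g : GL (Fin n) ℂ)) ∈ V := by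
      have hcont : ContinuousAt (fun g : G => π (diagLog P (g : GL (Fin n) ℂ))) 1 :=
        ContinuousAt.comp (g := π) hπ.continuousAt (continuousAt_diagLog P)
      refine hcont.preimage_mem_nhds ?_
      simpa [diagLog_one] using hV
    obtain ⟨g, hg, hgV⟩ := ((Filter.frequently_iff.mpr fun {U} hU => by
      by_contra! h'
      refine hcon (Filter.mem_of_superset hU fun g hg => ?_)
      rw [Set.mem_ofPred_eq]
      exact h' g hg : ∃ᶠ g : G in 𝓝 1, g ∈ T ∧ g ∉ K).and_eventually hev).exists
    have hgd := hP g (hTle hg.1)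
    have hb : diagLog P (g : GL (Fin n) ℂ) - π (diagLog P (g : GL (Fin n) ℂ)) ∈ L :=
      Submodule.sub_projection_mem hW.symm _
    have ha : diagLog P (g : GL (Fin n) ℂ) ∈ D := (hD _).mpr (isDiag_diagLog _ _)
    have hc : π (diagLog P (g : GL (Fin n) ℂ)) ∈ D := by
      have := D.sub_mem ha (hLD _ hb)
      rwa [sub_sub_cancel] at this
    have hcomm : Commute (diagLog P (g : GL (Fin n) ℂ) - π (diagLog P (g : GL (Fin n) ℂ)))
        (π (diagLog P (g : GL (Fin n) ℂ))) :=
      commute_of_isDiag_conj ((hD _).mp (hLD _ hb)) ((hD _).mp hc)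
    have hprod := expGL_add hcomm
    rw [sub_add_cancel, expGL_diagLog hgd] at hprod
    have hbH : expGL (diagLog P (g : GL (Fin n) ℂ) - π (diagLog P (g : GL (Fin n) ℂ))) ∈ Hm :=
      exp_mem hHm hb
    refine ⟨_, hgV, ⟨Submodule.projection_apply_mem hW.symm _, hc⟩, fun h0 => hg.2 ?_, ?_⟩
    · rw [h0, sub_zero] at hb
      have := hexp ⟨diagLog P (g : GL (Fin n) ℂ), lieAlgebra_mono hHm hHmG hb⟩ hb
      have heq : expG hG ⟨diagLog P (g : GL (Fin n) ℂ), lieAlgebra_mono hHm hHmG hb⟩ = g :=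
        Subtype.ext (expGL_diagLog hgd)
      rwa [heq] at this
    · have hgH : (g : GL (Fin n) ℂ) ∈ Hm := ⟨g, hTle hg.1, rfl⟩
      rw [eq_inv_mul_of_mul_eq hprod.symm]
      exact Hm.mul_mem (Hm.inv_mem hbH) hgH
  exact hC0 (Submodule.disjoint_def.mp hW.disjoint C hC hCW.1)

/-- A is diagonalizable, hence so is ad A, and a diagonalizable operator has the same kernel as its
square. -/
theorem lie_eq_zero_of_lie_lie_eq_zero {P : GL (Fin n) ℂ} {A B : Matrix (Fin n) (Fin n) ℂ}
    (hA : (P.val * A * (P⁻¹).val).IsDiag) (h : ⁅A, ⁅A, B⁆⁆ = 0) : Commute A B := by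
  obtain ⟨d, hd⟩ : ∃ d, P.val * A * (P⁻¹).val = Matrix.diagonal d :=
    ⟨_, ((Matrix.isDiag_iff_diagonal_diag _).mp hA).symm⟩
  have hlie : ∀ X i j, conjEntry P i j ⁅A, X⁆ = (d i - d j) * conjEntry P i j X := by
    intro X i j
    have : P.val * ⁅A, X⁆ * (P⁻¹).val = Matrix.diagonal d * (P.val * X * (P⁻¹).val) -
        (P.val * X * (P⁻¹).val) * Matrix.diagonal d := by
      rw [← hd, Ring.lie_def]
      simp [mul_assoc, mul_sub, sub_mul]
    rw [conjEntry_apply, conjEntry_apply, this, Matrix.sub_apply, Matrix.mul_diagonal,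
      Matrix.diagonal_mul]
    ring
  have h0 : P.val * ⁅A, B⁆ * (P⁻¹).val = 0 := by
    ext i j
    have h1 := hlie ⁅A, B⁆ i j
    rw [h, map_zero, hlie, ← mul_assoc] at h1
    change conjEntry P i j ⁅A, B⁆ = 0
    rw [hlie]
    rcases mul_eq_zero.mp h1.symm with h2 | h2
    · rw [mul_self_eq_zero.mp h2, zero_mul]
    · rw [h2, mul_zero]
  have h3 := congrArg (fun M => (P⁻¹).val * M * P.val) h0
  simp only [mul_zero, zero_mul] at h3
  rw [commute_iff_lie_eq, ← h3]
  simp [mul_assoc]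

theorem mem_fixedSubalgebra_iff (hG : IsSimplyConnectedSimple G) (hH : IsMaximalTorus H)
    {ξ : lieAlgebra G} : ξ ∈ fixedSubalgebra H ↔ ξ ∈ cartan H := by
  rw [mem_fixedSubalgebra, cartan_eq_rootSpace_one hG hH]

/-- An element of `G` is in the stabilizer of `x` if its linear action fixes `x`. -/
theorem isClosed_stabilizer (x : lieAlgebra G) :
    IsClosed[zariskiOn G] (MulAction.stabilizer G x : Set G) := by
  have h := isClosed_intertwining (G := G) (fun _ : Unit => x.val) (fun _ => x.val)
  convert h using 1
  ext g
  simp [MulAction.mem_stabilizer_iff, smul_eq_iff]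

theorem expG_smul_eq_self (hG : IsClosed[zariski n] (G : Set (GL (Fin n) ℂ))) {ξ x : lieAlgebra G}
    (h : ⁅ξ, x⁆ = 0) : expG hG ξ • x = x := by
  rw [smul_eq_iff]
  rw [lie_eq_zero_iff_commute] at h
  exact h.exp_left

/-- Infinitesimal invariance becomes invariance under H by applying `GeneratedByExp` to the closed
stabilizer of x. -/
theorem mem_rootSpace_one_of_lie_eq_zero {hG : IsClosed[zariski n] (G : Set (GL (Fin n) ℂ))}
    (hgen : GeneratedByExp hG H) {x : lieAlgebra G} (h : ∀ ξ ∈ cartan H, ⁅ξ, x⁆ = 0) :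
    x ∈ rootSpace H 1 := by
  have hle := hgen (MulAction.stabilizer G x) (isClosed_stabilizer x)
    fun ξ hξ => expG_smul_eq_self hG (h ξ hξ)
  intro a
  simpa using hle a.2

/-- If x normalizes the fixed subalgebra, then [ξ, [ξ, x]] = 0 for ξ in 𝔥. Diagonalizability of ξ
improves this to [ξ, x] = 0, so H fixes x. -/
theorem isCartanSubalgebra (hG : IsSimplyConnectedSimple G) (hH : IsMaximalTorus H)
    (hgen : GeneratedByExp hG.isClosed H) : (fixedSubalgebra H).IsCartanSubalgebra where
  nilpotent := isNilpotent_fixedSubalgebra hG.isClosed hH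
  self_normalizing := by
    refine le_antisymm (fun x hx => ?_) (LieSubalgebra.le_normalizer _)
    rw [LieSubalgebra.mem_normalizer_iff'] at hx
    obtain ⟨P, hP⟩ := hH.prop.diagonalizable
    refine mem_rootSpace_one_of_lie_eq_zero hgen fun ξ hξ => ?_
    have h1 : ⁅ξ, x⁆ ∈ rootSpace H 1 := hx ξ ((mem_fixedSubalgebra_iff hG hH).mpr hξ)
    have h2 := lie_eq_zero_of_mem_cartan hG.isClosed hH hξ h1
    rw [lie_eq_zero_iff_commute]
    exact lie_eq_zero_of_lie_lie_eq_zero (isDiag_of_mem_cartan hG.isClosed hH.prop.isClosed hP hξ)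
      (congrArg Subtype.val h2)

end NilpotentOrbit
end

noncomputable section

/-! ### Roots of equal length in an irreducible root system -/

namespace RootPairing

variable {ι R M N : Type*} [Finite ι] [Field R] [CharZero R] [AddCommGroup M] [Module R M]
  [AddCommGroup N] [Module R N] (P : RootPairing ι R M N)

/-- The roots of S as long as i span a reflection-stable subspace, which is everything by
irreducibility, so one of them, k, is not orthogonal to j. Equal length leaves the pairings ±1 or
±2, and in each case an explicit word in the reflections of j and k takes k to j. -/
theorem mem_of_length_eq_of_reflectionPerm_mem [P.IsReduced] [P.IsCrystallographic]
    [P.IsIrreducible] (B : P.InvariantForm) {i j : ι}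
    (hij : B.form (P.root i) (P.root i) = B.form (P.root j) (P.root j)) (S : Set ι) (hi : i ∈ S)
    (hS : ∀ a, ∀ k ∈ S, P.reflectionPerm a k ∈ S) : j ∈ S := by
  let S' : Set ι := {k ∈ S | B.form (P.root k) (P.root k) = B.form (P.root i) (P.root i)}
  have hS' : ∀ a, ∀ k ∈ S', P.reflectionPerm a k ∈ S' := by
    rintro a k ⟨hk, hk'⟩
    refine ⟨hS a k hk, ?_⟩
    rw [P.root_reflectionPerm, B.apply_reflection_reflection, hk']
  obtain ⟨k, hk, hkj⟩ : ∃ k ∈ S', B.form (P.root j) (P.root k) ≠ 0 := by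
    by_contra! h
    have htop : Submodule.span R (P.root '' S') = ⊤ := by
      refine IsIrreducible.eq_top_of_invtSubmodule_reflection (P := P) _ (fun a => ?_) ?_
      · rw [Module.End.mem_invtSubmodule, Submodule.span_le]
        rintro _ ⟨k, hk, rfl⟩
        refine Submodule.subset_span ⟨P.reflectionPerm a k, hS' a k hk, ?_⟩
        rw [P.root_reflectionPerm]
        rfl
      · intro h0
        exact P.ne_zero i ((Submodule.eq_bot_iff _).mp h0 _ (Submodule.subset_span ⟨i, ⟨hi, rfl⟩, rfl⟩))
    have hle : Submodule.span R (P.root '' S') ≤ LinearMap.ker (B.form (P.root j)) := by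
      rw [Submodule.span_le]
      rintro _ ⟨k, hk, rfl⟩
      exact h k hk
    rw [htop] at hle
    exact B.apply_root_ne_zero j (LinearMap.ext fun x => hle Submodule.mem_top)
  have hne : P.pairingIn ℤ j k ≠ 0 := by
    intro h0
    rw [Ne, B.apply_root_root_zero_iff, ← P.algebraMap_pairingIn ℤ, h0, map_zero] at hkj
    exact hkj rfl
  have hrefl : ∀ a b, P.root (P.reflectionPerm a b) = P.root b - P.pairing b a • P.root a :=
    fun a b => by rw [P.root_reflectionPerm, P.reflection_apply_root]
  have hmem := P.pairingIn_pairingIn_mem_set_of_length_eq (B := B) (i := k) (j := j)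
    (hk.2.trans hij)
  have hp1 := P.algebraMap_pairingIn ℤ k j
  have hp2 := P.algebraMap_pairingIn ℤ j k
  simp only [Set.mem_insert_iff, Prod.mk.injEq, Set.mem_singleton_iff] at hmem
  rcases hmem with ⟨-, h⟩ | ⟨h, h'⟩ | ⟨h, h'⟩ | ⟨h, h'⟩ | ⟨h, h'⟩
  · exact absurd h hne
  · have : P.reflectionPerm j (P.reflectionPerm k (P.reflectionPerm j k)) = j := by
      apply P.root.injective
      rw [P.root_reflectionPerm, P.root_reflectionPerm, hrefl, ← hp1, h, map_sub, map_smul,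
        P.reflection_apply_self, P.reflection_apply_root, ← hp2, h']
      simp only [map_one, one_smul]
      abel_nf
      simp
    exact this ▸ hS _ _ (hS _ _ (hS _ _ hk.1))
  · have : P.reflectionPerm k (P.reflectionPerm j k) = j := by
      apply P.root.injective
      rw [P.root_reflectionPerm, hrefl, ← hp1, h, map_sub, map_smul,
        P.reflection_apply_self, P.reflection_apply_root, ← hp2, h']
      simp
    exact this ▸ hS _ _ (hS _ _ hk.1)
  · have : k = j := (P.pairingIn_two_two_iff ℤ k j).mp ⟨h, h'⟩
    exact this ▸ hk.1
  · have h3 := (P.pairingIn_neg_two_neg_two_iff ℤ k j).mp ⟨h, h'⟩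
    have : P.reflectionPerm j k = j := by
      apply P.root.injective
      rw [P.root_reflectionPerm, h3, map_neg, P.reflection_apply_self, neg_neg]
    exact this ▸ hS _ _ hk.1

end RootPairing

/-! ### Lengths of coroots for the Killing form -/

namespace LieAlgebra.IsKilling

open LieModule Module

variable {L : Type*} [LieRing L] [LieAlgebra ℂ L] [FiniteDimensional ℂ L] [IsKilling ℂ L]
  {H : LieSubalgebra ℂ L} [H.IsCartanSubalgebra]

/-- The square of the length of the coroot of `α`, for the Killing form. -/
def corootLengthSq (α : Weight ℂ H L) : ℂ := killingForm ℂ L (coroot α) (coroot α)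

/-- Coroots live in the Cartan subalgebra, where the Killing form is at hand, so lengths are
compared in the dual root system; this identifies them with its canonical invariant form. -/
theorem corootForm_coroot_eq (α : H.root) :
    (rootSystem H).flip.toInvariantForm.form ((rootSystem H).flip.root α)
      ((rootSystem H).flip.root α) = corootLengthSq α.1 := by
  change (rootSystem H).CorootForm (coroot α.1) (coroot α.1) = _
  rw [corootForm_rootSystem_eq_killing]
  rfl

theorem mem_of_corootLengthSq_eq [IsSimple ℂ L] {α β : H.root}
    (h : corootLengthSq α.1 = corootLengthSq β.1) (S : Set H.root) (hα : α ∈ S)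
    (hS : ∀ a, ∀ k ∈ S, (rootSystem H).reflectionPerm a k ∈ S) : β ∈ S := by
  refine (rootSystem H).flip.mem_of_length_eq_of_reflectionPerm_mem
    (rootSystem H).flip.toInvariantForm (i := α) (j := β) ?_ S hα hS
  rw [corootForm_coroot_eq, corootForm_coroot_eq, h]

/-- An irreducible root system has at most two lengths, so two of any three agree. -/
theorem corootLengthSq_eq_or [IsSimple ℂ L] (α β γ : H.root) :
    corootLengthSq α.1 = corootLengthSq β.1 ∨ corootLengthSq α.1 = corootLengthSq γ.1 ∨
      corootLengthSq β.1 = corootLengthSq γ.1 := by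
  have : Nonempty H.root := ⟨α⟩
  obtain ⟨i, j, hij⟩ := (rootSystem H).flip.toInvariantForm.exists_apply_eq_or
  simp only [corootForm_coroot_eq] at hij
  rcases hij α with h1 | h1 <;> rcases hij β with h2 | h2 <;> rcases hij γ with h3 | h3 <;>
    simp [h1, h2, h3]

/-- The value is the sum of the squares of the integers β(α^∨) over the roots β, and β = α
contributes 4. Hence it can be compared through real parts without loss. -/
theorem exists_corootLengthSq_eq_natCast {α : Weight ℂ H L} (hα : α.IsNonZero) :
    ∃ N : ℕ, 0 < N ∧ corootLengthSq α = N := by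
  have h1 : corootLengthSq α = ∑ β ∈ H.root, β (coroot α) * β (coroot α) := by
    change (killingForm ℂ L).restrict H (coroot α) (coroot α) = _
    rw [restrict_killingForm_eq_sum]
    simp only [LinearMap.sum_apply]
    rfl
  have h2 : ∀ β : Weight ℂ H L, β (coroot α) * β (coroot α) =
      (((chainBotCoeff α β - chainTopCoeff α β : ℤ).natAbs ^ 2 : ℕ) : ℂ) := by
    intro β
    rw [apply_coroot_eq_cast, ← sq, ← Int.cast_pow, ← Int.natAbs_sq]
    norm_cast
  refine ⟨∑ β ∈ H.root, (chainBotCoeff α β - chainTopCoeff α β : ℤ).natAbs ^ 2, ?_, ?_⟩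
  · refine Finset.sum_pos' (fun _ _ => Nat.zero_le _) ⟨α, by simpa using hα, ?_⟩
    refine pow_pos (Int.natAbs_pos.mpr fun h0 => ?_) 2
    have h3 := apply_coroot_eq_cast α α
    rw [h0, root_apply_coroot hα] at h3
    norm_num at h3
  · rw [h1, Nat.cast_sum]
    exact Finset.sum_congr rfl fun β _ => h2 β

/-- With t dual to α, the coroot is 2t/α(t). So root and coroot lengths are inversely related. -/
theorem apply_cartanEquivDual_symm_mul_corootLengthSq {α : Weight ℂ H L} (hα : α.IsNonZero) :
    α ((cartanEquivDual H).symm α) * corootLengthSq α = 4 := by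
  have h := traceForm_coroot α (coroot α)
  change corootLengthSq α = _ at h
  have h0 := root_apply_cartanEquivDual_symm_ne_zero hα
  rw [h, root_apply_coroot hα]
  simp
  field_simp
  norm_num

end LieAlgebra.IsKilling
end

noncomputable section
namespace NilpotentOrbit

open NormedSpace (exp)
open LieModule (Weight)
open LieAlgebra.IsKilling

variable {n : ℕ} {G : Subgroup (GL (Fin n) ℂ)} {H : Subgroup G}

/-! ### The adjoint action of exponentials -/

open scoped Matrix.Norms.Operator in
-- If v' = [X, v], then exp(-tX) v(t) exp(tX) is constant. This checks closed formulas for Ad(exp ξ)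
-- x without expanding exp(ad ξ).
theorem exp_smul_mul_of_hasDerivAt {X : Matrix (Fin n) (Fin n) ℂ}
    {v : ℂ → Matrix (Fin n) (Fin n) ℂ}
    (hv : ∀ t, HasDerivAt v (X * v t - v t * X) t) (t : ℂ) :
    exp (t • X) * v 0 = v t * exp (t • X) := by
  let u : ℂ → Matrix (Fin n) (Fin n) ℂ := fun s => exp (s • -X) * v s * exp (s • X)
  have hu : ∀ s, HasDerivAt u 0 s := by
    intro s
    have h := ((hasDerivAt_exp_smul_const (𝕂 := ℂ) (-X) s).mul (hv s)).mul
      (hasDerivAt_exp_smul_const' (𝕂 := ℂ) X s)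
    refine h.congr_deriv ?_
    change (exp (s • -X) * -X * v s + exp (s • -X) * (X * v s - v s * X)) * exp (s • X) +
      (exp (s • -X) * v s) * (X * exp (s • X)) = 0
    noncomm_ring
  have hc : u t = u 0 := is_const_of_deriv_eq_zero (fun s => (hu s).differentiableAt)
    (fun s => (hu s).deriv) t 0
  have h1 : exp (t • X) * exp (t • -X) = 1 := by
    have h := (expGL (t • X)).mul_inv
    rwa [coe_expGL, coe_expGL_inv, ← smul_neg] at h
  simp only [u, zero_smul, NormedSpace.exp_zero, one_mul, mul_one] at hc
  rw [← hc, mul_assoc, ← mul_assoc, h1, one_mul]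

open scoped Matrix.Norms.Operator in
theorem expG_smul_of_lie_eq_smul (hG : IsClosed[zariski n] (G : Set (GL (Fin n) ℂ)))
    {ξ x : lieAlgebra G} {c : ℂ} (h : ⁅ξ, x⁆ = c • x) : expG hG ξ • x = Complex.exp c • x := by
  have h' : ξ.val * x.val - x.val * ξ.val = c • x.val := congrArg Subtype.val h
  have hv : ∀ t, HasDerivAt (fun t : ℂ => Complex.exp (t * c) • x.val)
      (ξ.val * (Complex.exp (t * c) • x.val) - (Complex.exp (t * c) • x.val) * ξ.val) t := by
    intro t
    have h1 := (((hasDerivAt_id t).mul_const c).cexp).smul_const x.val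
    refine h1.congr_deriv ?_
    rw [mul_smul_comm, smul_mul_assoc, ← smul_sub, h', smul_smul]
    simp
  have h2 := exp_smul_mul_of_hasDerivAt hv 1
  rw [smul_eq_iff, coe_expG, coe_expGL]
  simpa using h2

open scoped Matrix.Norms.Operator in
theorem expG_smul_of_lie_lie_lie_eq_zero (hG : IsClosed[zariski n] (G : Set (GL (Fin n) ℂ)))
    {ξ x : lieAlgebra G} (h : ⁅ξ, ⁅ξ, ⁅ξ, x⁆⁆⁆ = 0) :
    expG hG ξ • x = x + ⁅ξ, x⁆ + (1 / 2 : ℂ) • ⁅ξ, ⁅ξ, x⁆⁆ := by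
  have hlie : ∀ y : lieAlgebra G, ξ.val * y.val - y.val * ξ.val = (⁅ξ, y⁆ : lieAlgebra G).val :=
    fun y => rfl
  have hv : ∀ t, HasDerivAt (fun t : ℂ => x.val + t • (⁅ξ, x⁆ : lieAlgebra G).val +
      (t ^ 2 / 2) • (⁅ξ, ⁅ξ, x⁆⁆ : lieAlgebra G).val)
      (ξ.val * (x.val + t • (⁅ξ, x⁆ : lieAlgebra G).val +
        (t ^ 2 / 2) • (⁅ξ, ⁅ξ, x⁆⁆ : lieAlgebra G).val) -
      (x.val + t • (⁅ξ, x⁆ : lieAlgebra G).val +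
        (t ^ 2 / 2) • (⁅ξ, ⁅ξ, x⁆⁆ : lieAlgebra G).val) * ξ.val) t := by
    intro t
    have h1 := (((hasDerivAt_id t).smul_const (⁅ξ, x⁆ : lieAlgebra G).val).const_add x.val).add
      ((((hasDerivAt_id t).pow 2).div_const 2).smul_const (⁅ξ, ⁅ξ, x⁆⁆ : lieAlgebra G).val)
    refine h1.congr_deriv ?_
    have h2 : ξ.val * (x.val + t • (⁅ξ, x⁆ : lieAlgebra G).val +
        (t ^ 2 / 2) • (⁅ξ, ⁅ξ, x⁆⁆ : lieAlgebra G).val) -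
      (x.val + t • (⁅ξ, x⁆ : lieAlgebra G).val +
        (t ^ 2 / 2) • (⁅ξ, ⁅ξ, x⁆⁆ : lieAlgebra G).val) * ξ.val =
        (⁅ξ, x⁆ : lieAlgebra G).val + t • (⁅ξ, ⁅ξ, x⁆⁆ : lieAlgebra G).val +
        (t ^ 2 / 2) • (⁅ξ, ⁅ξ, ⁅ξ, x⁆⁆⁆ : lieAlgebra G).val := by
      have hsmul : ∀ (c : ℂ) (y : lieAlgebra G), ξ.val * (c • y.val) - (c • y.val) * ξ.val =
          c • (⁅ξ, y⁆ : lieAlgebra G).val := by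
        intro c y
        rw [mul_smul_comm, smul_mul_assoc, ← smul_sub, hlie]
      rw [← hsmul (t ^ 2 / 2) ⁅ξ, ⁅ξ, x⁆⁆, ← hsmul t ⁅ξ, x⁆]
      simp only [mul_add, add_mul]
      rw [add_sub_add_comm, add_sub_add_comm, hlie x]
    rw [h2, h]
    simp
  have h2 := exp_smul_mul_of_hasDerivAt hv 1
  rw [smul_eq_iff, coe_expG, coe_expGL]
  simpa using h2

/-- The SL₂ representative of the nontrivial Weyl element. On the span of k, h, e, f the third
powers of ad e and ad f vanish, so each exponential acts by a quadratic formula. -/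
theorem reflection_smul (hG : IsClosed[zariski n] (G : Set (GL (Fin n) ℂ)))
    {h e f k : lieAlgebra G} (ht : IsSl2Triple h e f) {c : ℂ} (hke : ⁅k, e⁆ = c • e)
    (hkf : ⁅k, f⁆ = -(c • f)) :
    (expG hG e * expG hG (-f) * expG hG e) • k = k - c • h := by
  have he2 : ⁅h, e⁆ = (2 : ℂ) • e := by rw [ht.lie_h_e_nsmul, two_smul, two_smul]
  have hf2 : ⁅h, f⁆ = -((2 : ℂ) • f) := by rw [ht.lie_h_f_nsmul, two_smul, two_smul]
  have hek : ⁅e, k⁆ = -(c • e) := by rw [← lie_skew, hke]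
  have hfk : ⁅f, k⁆ = c • f := by rw [← lie_skew, hkf, neg_neg]
  have heh : ⁅e, h⁆ = -((2 : ℂ) • e) := by rw [← lie_skew, he2]
  have hfh : ⁅f, h⁆ = (2 : ℂ) • f := by rw [← lie_skew, hf2, neg_neg]
  have hfe : ⁅f, e⁆ = -h := by rw [← lie_skew, ht.lie_e_f]
  have hE : ∀ {x y : lieAlgebra G}, ⁅e, x⁆ = y → ⁅e, ⁅e, y⁆⁆ = 0 →
      expG hG e • x = x + y + (1 / 2 : ℂ) • ⁅e, y⁆ := by
    intro x y h1 h2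
    rw [expG_smul_of_lie_lie_lie_eq_zero hG (by rw [h1, h2]), h1]
  have hF : ∀ {x y : lieAlgebra G}, ⁅f, x⁆ = y → ⁅f, ⁅f, y⁆⁆ = 0 →
      expG hG (-f) • x = x - y + (1 / 2 : ℂ) • ⁅f, y⁆ := by
    intro x y h1 h2
    rw [expG_smul_of_lie_lie_lie_eq_zero hG (by simp [neg_lie, h1, h2])]
    simp [neg_lie, h1, sub_eq_add_neg]
  have e1 : expG hG e • k = k - c • e := by
    rw [hE hek (by simp)]
    simp [sub_eq_add_neg]
  have e2 : expG hG e • h = h - (2 : ℂ) • e := by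
    rw [hE heh (by simp)]
    simp [sub_eq_add_neg]
  have e3 : expG hG e • e = e := by
    rw [hE (lie_self e) (by simp)]
    simp
  have f1 : expG hG (-f) • k = k - c • f := by
    rw [hF hfk (by simp)]
    simp
  have f2 : expG hG (-f) • e = e + h - f := by
    rw [hF hfe (by simp [hfh]), lie_neg, hfh]
    module
  have e4 : expG hG e • f = f + h - e := by
    rw [hE ht.lie_e_f (by simp [heh]), heh]
    module
  rw [mul_smul, mul_smul, e1, smul_sub, smul_comm _ c, f1, f2, smul_sub, smul_sub, smul_comm _ c,
    smul_comm _ c, smul_sub, smul_add, e1, e2, e3, e4]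
  module

/-! ### Root spaces and the roots of the Cartan subalgebra -/

/-- The preimage of H under conjugation by g is a closed subgroup containing exp(𝔥), hence all of H.
-/
theorem mem_normalizer_of_smul_mem {hG : IsClosed[zariski n] (G : Set (GL (Fin n) ℂ))}
    (hH : IsClosed[zariskiOn G] (H : Set G)) (hgen : GeneratedByExp hG H) {g : G}
    (h1 : ∀ ξ ∈ cartan H, g • ξ ∈ cartan H) (h2 : ∀ ξ ∈ cartan H, g⁻¹ • ξ ∈ cartan H) :
    g ∈ Subgroup.normalizer (H : Set G) := by
  have key : ∀ a : G, (∀ ξ ∈ cartan H, a • ξ ∈ cartan H) → ∀ h ∈ H, a * h * a⁻¹ ∈ H := by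
    intro a ha
    have hle := hgen (H.comap (MulAut.conj a).toMonoidHom)
      (@IsClosed.preimage _ _ (zariskiOn G) (zariskiOn G) _
        (continuous_zariskiOn_mul_mul a a⁻¹) _ hH) fun ξ hξ => by
        change a * expG hG ξ * a⁻¹ ∈ H
        rw [← smul_expG]
        exact expG_mem_of_mem_cartan hG hH (ha ξ hξ)
    exact fun h hh => hle hh
  rw [Subgroup.mem_normalizer_iff]
  refine fun h => ⟨key g h1 h, fun hh => ?_⟩
  have := key g⁻¹ h2 _ hh
  simpa [mul_assoc] using this

open scoped Matrix.Norms.Operator in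
theorem hasDerivAt_exp_mul_mul_exp (A X : Matrix (Fin n) (Fin n) ℂ) (i j : Fin n) :
    HasDerivAt (fun t : ℂ => (exp (t • A) * X * exp (t • -A)) i j) ((A * X - X * A) i j) 0 := by
  have h := ((hasDerivAt_exp_smul_const (𝕂 := ℂ) A 0).mul_const X).mul
    (hasDerivAt_exp_smul_const (𝕂 := ℂ) (-A) 0)
  have h' : HasDerivAt (fun t : ℂ => exp (t • A) * X * exp (t • -A)) (A * X - X * A) 0 := by
    refine h.congr_deriv ?_
    simp [NormedSpace.exp_zero, sub_eq_add_neg]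
  exact (LinearMap.toContinuousLinearMap
    (Matrix.entryLinearMap ℂ ℂ i j)).hasFDerivAt.comp_hasDerivAt 0 h'

/-- The character χ is an abstract homomorphism and cannot be differentiated directly. The
derivative is read off from a nonzero entry of one weight vector y, and cross-multiplying with that
entry eliminates χ for any other x. -/
theorem exists_lie_eq_smul (hG : IsClosed[zariski n] (G : Set (GL (Fin n) ℂ)))
    (hH : IsClosed[zariskiOn G] (H : Set G)) (χ : H →* ℂˣ) {ξ : lieAlgebra G}
    (hξ : ξ ∈ cartan H) : ∃ c : ℂ, ∀ x ∈ rootSpace H χ, ⁅ξ, x⁆ = c • x := by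
  by_cases hbot : rootSpace H χ = ⊥
  · refine ⟨0, fun x hx => ?_⟩
    rw [hbot, Submodule.mem_bot] at hx
    simp [hx]
  obtain ⟨y, hy, hy0⟩ := (Submodule.ne_bot_iff _).mp hbot
  obtain ⟨p, q, hpq⟩ : ∃ p q, y.val p q ≠ 0 := by
    by_contra! h
    exact hy0 (Subtype.ext (Matrix.ext h))
  have hmem : ∀ t : ℂ, expG hG (t • ξ) ∈ H := fun t =>
    expG_mem_of_mem_cartan hG hH ((cartan H).smul_mem t hξ)
  have hval : ∀ (t : ℂ), ∀ x ∈ rootSpace H χ, exp (t • ξ.val) * x.val * exp (t • -ξ.val) =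
      (χ ⟨_, hmem t⟩ : ℂ) • x.val := by
    intro t x hx
    have h := congrArg Subtype.val (hx ⟨_, hmem t⟩)
    rw [smul_neg]
    exact h
  refine ⟨(ξ.val * y.val - y.val * ξ.val) p q / y.val p q, fun x hx => Subtype.ext ?_⟩
  ext i j
  have h1 := ((hasDerivAt_exp_mul_mul_exp ξ.val x.val i j).mul_const (y.val p q)).sub
    ((hasDerivAt_exp_mul_mul_exp ξ.val y.val p q).mul_const (x.val i j))
  have h2 : (fun t : ℂ => (exp (t • ξ.val) * x.val * exp (t • -ξ.val)) i j * y.val p q) -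
      (fun t : ℂ => (exp (t • ξ.val) * y.val * exp (t • -ξ.val)) p q * x.val i j) =
      fun _ => 0 := by
    funext t
    rw [Pi.sub_apply, hval t x hx, hval t y hy, Matrix.smul_apply, Matrix.smul_apply, smul_eq_mul,
      smul_eq_mul]
    ring
  rw [h2] at h1
  have h3 := h1.unique (hasDerivAt_const 0 0)
  change (ξ.val * x.val - x.val * ξ.val) i j = _ * x.val i j
  field_simp
  linear_combination h3

theorem smul_mem_rootSpace (g : Subgroup.normalizer (H : Set G)) {χ : H →* ℂˣ} {x : lieAlgebra G}
    (hx : x ∈ rootSpace H χ) : (g : G) • x ∈ rootSpace H (normalizerAction H g χ) := by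
  intro h
  have hk : (g : G)⁻¹ * h * g ∈ H := (Subgroup.mem_normalizer_iff''.mp g.2 h).mp h.2
  rw [normalizerAction_apply H g χ h ⟨_, hk⟩ rfl,
    ← smul_comm (g : G) (χ ⟨_, hk⟩ : ℂ) x, ← hx ⟨_, hk⟩, smul_smul, smul_smul]
  simp [mul_assoc]

theorem Ad_apply (g : G) (x : lieAlgebra G) : Ad g x = g • x := rfl

theorem map_Ad_rootSpace (g : Subgroup.normalizer (H : Set G)) (χ : H →* ℂˣ) :
    (rootSpace H χ).map (Ad (g : G)) = rootSpace H (normalizerAction H g χ) := by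
  refine le_antisymm ?_ fun x hx => ?_
  · rintro _ ⟨x, hx, rfl⟩
    exact smul_mem_rootSpace g hx
  · have h := smul_mem_rootSpace g⁻¹ hx
    rw [← Equiv.Perm.mul_apply, ← map_mul, inv_mul_cancel, map_one, Equiv.Perm.one_apply] at h
    refine ⟨_, h, ?_⟩
    rw [Ad_apply, smul_smul]
    simp

theorem eq_of_mem_rootSpace {χ ψ : H →* ℂˣ} {x : lieAlgebra G} (hx0 : x ≠ 0)
    (hx : x ∈ rootSpace H χ) (hx' : x ∈ rootSpace H ψ) : χ = ψ := by
  ext h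
  have h1 := hx h
  rw [hx' h] at h1
  exact (smul_left_injective ℂ hx0 h1).symm

end NilpotentOrbit
end

noncomputable section
namespace NilpotentOrbit

open LieModule (Weight)
open LieAlgebra.IsKilling

variable {n : ℕ} {G : Subgroup (GL (Fin n) ℂ)} {H : Subgroup G}

/-! ### Characters of H and weights of its Lie algebra -/

section Weights

variable [(fixedSubalgebra H).IsCartanSubalgebra]

/-- The weight space of the character `χ` is the root space of the nonzero weight `α`. -/
structure Corresponds (χ : H →* ℂˣ) (α : Weight ℂ (fixedSubalgebra H) (lieAlgebra G)) : Prop where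
  isNonZero : α.IsNonZero
  rootSpace_eq : rootSpace H χ = (LieAlgebra.rootSpace (fixedSubalgebra H) α).toSubmodule

variable {χ ψ : H →* ℂˣ} {α β : Weight ℂ (fixedSubalgebra H) (lieAlgebra G)}

theorem Corresponds.mem_iff (h : Corresponds χ α) {x : lieAlgebra G} :
    x ∈ rootSpace H χ ↔ x ∈ LieAlgebra.rootSpace (fixedSubalgebra H) α := by
  rw [h.rootSpace_eq]
  rfl

theorem Corresponds.exists_ne_zero (h : Corresponds χ α) : ∃ x ∈ rootSpace H χ, x ≠ 0 := by
  obtain ⟨x, hx, hx0⟩ := α.exists_ne_zero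
  exact ⟨x, h.mem_iff.mpr hx, hx0⟩

theorem Corresponds.char_eq (h : Corresponds χ α) (h' : Corresponds ψ α) : χ = ψ := by
  obtain ⟨x, hx, hx0⟩ := h.exists_ne_zero
  exact eq_of_mem_rootSpace hx0 hx (h'.mem_iff.mpr (h.mem_iff.mp hx))

variable [LieAlgebra.IsKilling ℂ (lieAlgebra G)]

theorem Corresponds.lie_eq (h : Corresponds χ α) {x : lieAlgebra G} (hx : x ∈ rootSpace H χ)
    (k : fixedSubalgebra H) : ⁅(k : lieAlgebra G), x⁆ = α k • x :=
  lie_eq_smul_of_mem_rootSpace (h.mem_iff.mp hx) k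

theorem Corresponds.exists_smul_eq (h : Corresponds χ α) {x y : lieAlgebra G} (hx0 : x ≠ 0)
    (hx : x ∈ rootSpace H χ) (hy : y ∈ rootSpace H χ) : ∃ c : ℂ, c • x = y := by
  have h1 := finrank_rootSpace_eq_one α h.isNonZero
  obtain ⟨c, hc⟩ := (finrank_eq_one_iff_of_nonzero'
    (⟨x, h.mem_iff.mp hx⟩ : LieAlgebra.rootSpace (fixedSubalgebra H) α)
    (fun h0 => hx0 (congrArg Subtype.val h0))).mp h1 ⟨y, h.mem_iff.mp hy⟩
  exact ⟨c, congrArg Subtype.val hc⟩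

/-- The differential of χ is a weight. Were it zero, `GeneratedByExp` would make H fix the root
vectors, forcing χ = 1. Root spaces of a nonzero weight are lines, so the inclusion of a nonzero
space is an equality. -/
theorem exists_corresponds (hG : IsSimplyConnectedSimple G) (hH : IsMaximalTorus H)
    (hgen : GeneratedByExp hG.isClosed H) (hχ : IsRoot H χ) :
    ∃ α : Weight ℂ (fixedSubalgebra H) (lieAlgebra G), Corresponds χ α := by
  choose c hc using fun k : fixedSubalgebra H => exists_lie_eq_smul hG.isClosed hH.prop.isClosed χ
    ((mem_fixedSubalgebra_iff hG hH).mp k.2)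
  have hle : rootSpace H χ ≤ (LieAlgebra.rootSpace (fixedSubalgebra H) c).toSubmodule := by
    intro x hx
    refine LieModule.weightSpace_le_genWeightSpace _ c ?_
    rw [LieModule.mem_weightSpace]
    exact fun k => hc k x hx
  obtain ⟨x, hx, hx0⟩ := (Submodule.ne_bot_iff _).mp hχ.2
  let α : Weight ℂ (fixedSubalgebra H) (lieAlgebra G) := ⟨c, fun h0 => hx0 (by
    have hx' : x ∈ LieAlgebra.rootSpace (fixedSubalgebra H) c := hle hx
    rw [LieAlgebra.rootSpace, h0] at hx'
    exact hx')⟩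
  have hα : α.IsNonZero := by
    intro h0
    have h0' : c = 0 := h0
    have h1 : x ∈ rootSpace H 1 := mem_rootSpace_one_of_lie_eq_zero hgen fun ξ hξ => by
      have := hc ⟨ξ, (mem_fixedSubalgebra_iff hG hH).mpr hξ⟩ x hx
      rwa [h0', Pi.zero_apply, zero_smul] at this
    exact hχ.1 (eq_of_mem_rootSpace hx0 hx h1)
  refine ⟨α, hα, Submodule.eq_of_le_of_finrank_le hle ?_⟩
  have h1 : Module.finrank ℂ (LieAlgebra.rootSpace (fixedSubalgebra H) α) = 1 :=
    finrank_rootSpace_eq_one α hα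
  change Module.finrank ℂ (LieAlgebra.rootSpace (fixedSubalgebra H) α) ≤ _
  rw [h1, Submodule.one_le_finrank_iff]
  exact hχ.2

/-- H fixes 𝔥 pointwise, so it preserves each root space. That space is a line, on which H acts by a
character. -/
theorem exists_isRoot_corresponds (hG : IsSimplyConnectedSimple G) (hH : IsMaximalTorus H)
    (hgen : GeneratedByExp hG.isClosed H) (hα : α.IsNonZero) :
    ∃ χ : H →* ℂˣ, IsRoot H χ ∧ Corresponds χ α := by
  obtain ⟨x, hx, hx0⟩ := α.exists_ne_zero
  have hlie : ∀ k : fixedSubalgebra H, ⁅(k : lieAlgebra G), x⁆ = α k • x :=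
    fun k => lie_eq_smul_of_mem_rootSpace hx k
  obtain ⟨χ, hχ⟩ := exists_mem_rootSpace_of_smul_eq_smul (H := H) (x := x) fun h => by
    have hmem : (h : G) • x ∈ LieAlgebra.rootSpace (fixedSubalgebra H) α := by
      refine LieModule.weightSpace_le_genWeightSpace _ _ ?_
      rw [LieModule.mem_weightSpace]
      intro k
      have hk : (h : G) • (k : lieAlgebra G) = k := by simpa using k.2 h
      change ⁅(k : lieAlgebra G), (h : G) • x⁆ = _
      rw [← smul_comm, ← hlie k, smul_lie_adjoint, hk]
    obtain ⟨c, hc⟩ := (finrank_eq_one_iff_of_nonzero'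
      (⟨x, hx⟩ : LieAlgebra.rootSpace (fixedSubalgebra H) α)
      (fun h0 => hx0 (congrArg Subtype.val h0))).mp (finrank_rootSpace_eq_one α hα) ⟨_, hmem⟩
    exact ⟨c, (congrArg Subtype.val hc).symm⟩
  have hroot : IsRoot H χ := by
    refine ⟨?_, (Submodule.ne_bot_iff _).mpr ⟨x, hχ, hx0⟩⟩
    rintro rfl
    refine hα (funext fun k => ?_)
    have h1 := lie_eq_zero_of_mem_cartan hG.isClosed hH ((mem_fixedSubalgebra_iff hG hH).mp k.2) hχ
    rw [hlie k] at h1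
    exact (smul_eq_zero.mp h1).resolve_right hx0
  obtain ⟨β, hβ⟩ := exists_corresponds hG hH hgen hroot
  have hαβ : α = β := by
    refine LieModule.Weight.ext fun k => ?_
    have h1 := hβ.lie_eq hχ k
    rw [hlie k] at h1
    exact smul_left_injective ℂ hx0 h1
  exact ⟨χ, hroot, hαβ ▸ hβ⟩

theorem Corresponds.rootLengthSq_eq (hG : IsSimplyConnectedSimple G) (hH : IsMaximalTorus H)
    (h : Corresponds χ α) : rootLengthSq H χ = (4 / corootLengthSq α).re := by
  let t := (cartanEquivDual (fixedSubalgebra H)).symm α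
  have ht : ∀ k : fixedSubalgebra H, killingForm ℂ (lieAlgebra G) t k = α k := by
    intro k
    have h1 : cartanEquivDual (fixedSubalgebra H) t k = α k := by
      rw [LinearEquiv.apply_symm_apply, LieModule.Weight.toLinear_apply]
    rw [← h1, cartanEquivDual_apply_apply]
    rfl
  have hrep : Represents H χ t := by
    refine ⟨(mem_fixedSubalgebra_iff hG hH).mp t.2, fun ξ hξ e he => ?_⟩
    have h1 := h.lie_eq he ⟨ξ, (mem_fixedSubalgebra_iff hG hH).mpr hξ⟩
    rw [← ht] at h1
    exact h1
  have hex : ∃ s, Represents H χ s := ⟨t, hrep⟩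
  rw [rootLengthSq, dif_pos hex]
  congr 1
  obtain ⟨hs, hs'⟩ := hex.choose_spec
  set s := hex.choose
  obtain ⟨x, hx, hx0⟩ := h.exists_ne_zero
  have hsα : ∀ k : fixedSubalgebra H, killingForm ℂ (lieAlgebra G) s k = α k := by
    intro k
    have h1 := hs' k ((mem_fixedSubalgebra_iff hG hH).mp k.2) x hx
    rw [h.lie_eq hx k] at h1
    exact (smul_left_injective ℂ hx0 h1).symm
  have hs1 : s ∈ fixedSubalgebra H := (mem_fixedSubalgebra_iff hG hH).mpr hs
  -- s and t pair identically with 𝔥, so κ(s, s) = κ(t, s) = α(t) whichever representative was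
  -- chosen.
  have h1 : killingForm ℂ (lieAlgebra G) s s = α t :=
    ((hsα ⟨s, hs1⟩).trans (ht ⟨s, hs1⟩).symm).trans
      ((LieModule.traceForm_comm ℂ (lieAlgebra G) (lieAlgebra G) t s).trans (hsα t))
  rw [h1, eq_div_iff, apply_cartanEquivDual_symm_mul_corootLengthSq h.isNonZero]
  intro h0
  have := apply_cartanEquivDual_symm_mul_corootLengthSq h.isNonZero
  rw [h0, mul_zero] at this
  norm_num at this

theorem Corresponds.rootLengthSq_eq_iff (hG : IsSimplyConnectedSimple G) (hH : IsMaximalTorus H)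
    (h : Corresponds χ α) (h' : Corresponds ψ β) :
    rootLengthSq H χ = rootLengthSq H ψ ↔ corootLengthSq α = corootLengthSq β := by
  rw [h.rootLengthSq_eq hG hH, h'.rootLengthSq_eq hG hH]
  refine ⟨fun heq => ?_, fun heq => by rw [heq]⟩
  obtain ⟨N, hN, hN'⟩ := exists_corootLengthSq_eq_natCast h.isNonZero
  obtain ⟨M, hM, hM'⟩ := exists_corootLengthSq_eq_natCast h'.isNonZero
  rw [hN', hM'] at heq ⊢
  have hre : ∀ K : ℕ, (4 / (K : ℂ)).re = 4 / (K : ℝ) := by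
    intro K
    rw [show (4 / (K : ℂ)) = ((4 / (K : ℝ) : ℝ) : ℂ) by push_cast; rfl, Complex.ofReal_re]
  rw [hre, hre] at heq
  have hN0 : (N : ℝ) ≠ 0 := by positivity
  have hM0 : (M : ℝ) ≠ 0 := by positivity
  field_simp at heq
  have : N = M := by exact_mod_cast heq.symm
  rw [this]

/-- Let a, a' be the coroots. Then g • a - a' commutes with e', so it is orthogonal to the image of
ad e', which contains both a' and g • a because g • e is a multiple of e'. Hence κ(g • a, g • a) =
κ(g • a, a') = κ(a', a'). It does not matter whether g normalizes H. -/
theorem corootLengthSq_eq_of_smul (h : Corresponds χ α) (h' : Corresponds ψ β) {g : G}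
    (hg : (rootSpace H χ).map (Ad g) = rootSpace H ψ) : corootLengthSq α = corootLengthSq β := by
  obtain ⟨a, e, f, ht, he, hf⟩ := exists_isSl2Triple_of_weight_isNonZero h.isNonZero
  obtain ⟨a', e', f', ht', he', hf'⟩ := exists_isSl2Triple_of_weight_isNonZero h'.isNonZero
  have ha := ht.h_eq_coroot h.isNonZero he hf
  have ha' := ht'.h_eq_coroot h'.isNonZero he' hf'
  have hge : g • e ∈ rootSpace H ψ := by
    rw [← hg]
    exact ⟨e, h.mem_iff.mpr he, rfl⟩
  have he'0 : e' ≠ 0 := by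
    rintro rfl
    exact ht'.h_ne_zero (by rw [← ht'.lie_e_f, zero_lie])
  obtain ⟨c, hc⟩ := h'.exists_smul_eq he'0 (h'.mem_iff.mpr he') hge
  have hc0 : c ≠ 0 := by
    rintro rfl
    rw [zero_smul] at hc
    have he0 : e = 0 := (smul_eq_zero_iff_eq g).mp hc.symm
    exact ht.h_ne_zero (by rw [← ht.lie_e_f, he0, zero_lie])
  have h1 : ⁅g • a - a', e'⁆ = 0 := by
    have h2 : c • ⁅g • a, e'⁆ = c • (2 : ℂ) • e' := by
      rw [← lie_smul, hc, ← smul_lie_adjoint, ht.lie_h_e_nsmul, smul_comm c, hc, two_smul,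
        two_smul, smul_add]
    have h3 : ⁅g • a, e'⁆ = (2 : ℂ) • e' := smul_right_injective _ hc0 h2
    rw [sub_lie, h3, ht'.lie_h_e_nsmul, two_smul, two_smul, sub_self]
  have key : ∀ y : lieAlgebra G, killingForm ℂ (lieAlgebra G) ⁅e', y⁆ (g • a - a') = 0 := by
    intro y
    rw [LieModule.traceForm_comm, ← LieModule.traceForm_apply_lie_apply, h1, map_zero,
      LinearMap.zero_apply]
  have k1 : killingForm ℂ (lieAlgebra G) a' (g • a - a') = 0 := by
    have := key f'
    rwa [ht'.lie_e_f] at this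
  have k2 : killingForm ℂ (lieAlgebra G) (g • a) (g • a - a') = 0 := by
    have := key (c • (g • f))
    rwa [lie_smul, ← smul_lie, hc, ← smul_lie_adjoint, ht.lie_e_f] at this
  rw [map_sub, sub_eq_zero] at k1 k2
  have e1 : corootLengthSq α = killingForm ℂ (lieAlgebra G) a a := by rw [ha]; rfl
  have e2 : corootLengthSq β = killingForm ℂ (lieAlgebra G) a' a' := by rw [ha']; rfl
  rw [e1, e2, ← killingForm_smul_smul g, k2, LieModule.traceForm_comm, k1]

theorem exists_reflection (hG : IsSimplyConnectedSimple G) (hH : IsMaximalTorus H)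
    (hgen : GeneratedByExp hG.isClosed H) (hα : α.IsNonZero) :
    ∃ g : Subgroup.normalizer (H : Set G), ∀ k : fixedSubalgebra H,
      (g : G) • (k : lieAlgebra G) = k - α k • ((coroot α : fixedSubalgebra H) : lieAlgebra G) := by
  obtain ⟨a, e, f, ht, he, hf⟩ := exists_isSl2Triple_of_weight_isNonZero hα
  have ha := ht.h_eq_coroot hα he hf
  let g : G := expG hG.isClosed e * expG hG.isClosed (-f) * expG hG.isClosed e
  have hg : ∀ k : fixedSubalgebra H,
      g • (k : lieAlgebra G) = k - α k • ((coroot α : fixedSubalgebra H) : lieAlgebra G) := by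
    intro k
    rw [← ha]
    refine reflection_smul hG.isClosed ht (lie_eq_smul_of_mem_rootSpace he k) ?_
    have h1 := lie_eq_smul_of_mem_rootSpace hf k
    rw [Pi.neg_apply, neg_smul] at h1
    exact h1
  have hmem : ∀ k : fixedSubalgebra H, g • (k : lieAlgebra G) ∈ fixedSubalgebra H := by
    intro k
    rw [hg k]
    exact sub_mem k.2 ((fixedSubalgebra H).smul_mem _ (coroot α).2)
  -- Since g acts on 𝔥 as an involution, g⁻¹ preserves 𝔥 too, as membership in the normalizer
  -- demands.
  have hsq : ∀ k : fixedSubalgebra H, g • g • (k : lieAlgebra G) = k := by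
    intro k
    have h1 := hg (k - α k • coroot α)
    have h2 : α (k - α k • coroot α) = -α k := by
      rw [← LieModule.Weight.toLinear_apply, map_sub, map_smul, LieModule.Weight.toLinear_apply,
        LieModule.Weight.toLinear_apply, root_apply_coroot hα, smul_eq_mul]
      ring
    rw [hg k]
    refine h1.trans ?_
    rw [h2]
    change (k : lieAlgebra G) - α k • ((coroot α : fixedSubalgebra H) : lieAlgebra G) -
      -α k • ((coroot α : fixedSubalgebra H) : lieAlgebra G) = k
    module
  refine ⟨⟨g, mem_normalizer_of_smul_mem hH.prop.isClosed hgen (fun ξ hξ => ?_)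
    fun ξ hξ => ?_⟩, hg⟩
  · exact (mem_fixedSubalgebra_iff hG hH).mp
      (hmem ⟨ξ, (mem_fixedSubalgebra_iff hG hH).mpr hξ⟩)
  · have hξ' := (mem_fixedSubalgebra_iff hG hH).mpr hξ
    have h1 : g⁻¹ • ξ = g • ξ := inv_smul_eq_iff.mpr (hsq ⟨ξ, hξ'⟩).symm
    rw [h1]
    exact (mem_fixedSubalgebra_iff hG hH).mp (hmem ⟨ξ, hξ'⟩)

end Weights

end NilpotentOrbit
end

noncomputable section
namespace NilpotentOrbit

open LieModule (Weight)
open LieAlgebra.IsKilling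

variable {n : ℕ} {G : Subgroup (GL (Fin n) ℂ)} {H : Subgroup G}

/-! ### Conjugacy of roots of the same length -/

/-- Proportionality of g • ξ and ξ means that gξ and ξg are proportional matrices, that is, that the
2 × 2 minors of the pair vanish. These are polynomial equations in g, so they pass from T to its
Zariski closure H. -/
theorem exists_mem_rootSpace_of_fixed
    {T : Subgroup G} (hTH : closure[zariskiOn G] (T : Set G) = (H : Set G)) {ξ : lieAlgebra G}
    (hξ : ∀ t ∈ T, ∃ c : ℂ, t • ξ = c • ξ) : ∃ χ : H →* ℂˣ, ξ ∈ rootSpace H χ := by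
  rcases eq_or_ne ξ 0 with rfl | hξ0
  · exact ⟨1, zero_mem _⟩
  let f (p q : Fin n × Fin n) : MvPolynomial (Fin n × Fin n) ℂ :=
    (∑ k, MvPolynomial.X (p.1, k) * MvPolynomial.C (ξ.val k p.2)) *
      (∑ k, MvPolynomial.C (ξ.val q.1 k) * MvPolynomial.X (k, q.2))
  have hf : ∀ p q (g : GL (Fin n) ℂ), MvPolynomial.eval (entries g) (f p q) =
      (g.val * ξ.val) p.1 p.2 * (ξ.val * g.val) q.1 q.2 := by
    intro p q g
    simp [f, Matrix.mul_apply, entries]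
  let K : Set (GL (Fin n) ℂ) := {g | ∀ p q : Fin n × Fin n,
    (g.val * ξ.val) p.1 p.2 * (ξ.val * g.val) q.1 q.2 =
      (g.val * ξ.val) q.1 q.2 * (ξ.val * g.val) p.1 p.2}
  have hK : IsClosed[zariski n] K := by
    refine isClosed_zariski_of_forall {F | ∃ p q, F = f p q - f q p} fun g => ?_
    constructor
    · rintro h _ ⟨p, q, rfl⟩
      rw [map_sub, hf, hf, h p q, sub_self]
    · intro h p q
      have := h _ ⟨p, q, rfl⟩
      rw [map_sub, hf, hf, sub_eq_zero] at this
      exact this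
  have hK' : IsClosed[zariskiOn G] {g : G | (g : GL (Fin n) ℂ) ∈ K} :=
    (@isClosed_induced_iff _ _ (zariski n) _ _).mpr ⟨K, hK, rfl⟩
  have hTK : (T : Set G) ⊆ {g : G | (g : GL (Fin n) ℂ) ∈ K} := by
    intro t ht p q
    obtain ⟨c, hc⟩ := hξ t ht
    rw [smul_eq_iff] at hc
    have hc' : (t : GL (Fin n) ℂ).val * ξ.val = c • (ξ.val * (t : GL (Fin n) ℂ).val) := by
      rw [hc, ← smul_mul_assoc]
      rfl
    rw [hc', Matrix.smul_apply, Matrix.smul_apply, smul_eq_mul, smul_eq_mul]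
    ring
  have hHK : (H : Set G) ⊆ {g : G | (g : GL (Fin n) ℂ) ∈ K} := by
    rw [← hTH]
    exact @closure_minimal _ (zariskiOn G) _ _ hTK hK'
  refine exists_mem_rootSpace_of_smul_eq_smul fun h => ?_
  let g : GL (Fin n) ℂ := ((h : G) : GL (Fin n) ℂ)
  obtain ⟨i, j, hij⟩ : ∃ i j, (ξ.val * g.val) i j ≠ 0 := by
    by_contra! h0
    have h1 : ξ.val * g.val = 0 := Matrix.ext h0
    have h2 := congrArg (· * (g⁻¹).val) h1
    refine hξ0 (Subtype.ext ?_)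
    simpa [mul_assoc] using h2
  refine ⟨(g.val * ξ.val) i j / (ξ.val * g.val) i j, ?_⟩
  rw [smul_eq_iff]
  change g.val * ξ.val = (((g.val * ξ.val) i j / (ξ.val * g.val) i j) • ξ.val) * g.val
  rw [smul_mul_assoc]
  ext p q
  have h1 := hHK h.2 (p, q) (i, j)
  rw [Matrix.smul_apply, smul_eq_mul, div_mul_eq_mul_div, eq_div_iff hij]
  exact h1

theorem smul_mem_nilpotentCone (g : G) {ξ : lieAlgebra G} (hξ : ξ ∈ nilpotentCone G) :
    g • ξ ∈ nilpotentCone G := by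
  have h1 := (LieAlgebra.conj_ad_apply (R := ℂ) (AdEquiv g) ξ)
  have h2 : IsNilpotent (LieAlgebra.ad ℂ (lieAlgebra G) ξ) := hξ
  have h3 := h2.map (LinearEquiv.conjRingEquiv (AdEquiv g).toLinearEquiv)
  change IsNilpotent (LieAlgebra.ad ℂ (lieAlgebra G) (AdEquiv g ξ))
  rw [← h1]
  exact h3

theorem mem_fixedPoints_of_mem_rootSpace {T : Subgroup G} (hTH : T ≤ H) {ξ : lieAlgebra G}
    (hξ0 : ξ ≠ 0) {χ : H →* ℂˣ} (hξ : ξ ∈ rootSpace H χ) :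
    Projectivization.mk ℂ ξ hξ0 ∈ MulAction.fixedPoints T (ℙ ℂ (lieAlgebra G)) := by
  intro t
  change (t : G) • Projectivization.mk ℂ ξ hξ0 = Projectivization.mk ℂ ξ hξ0
  rw [Projectivization.smul_mk, Projectivization.mk_eq_mk_iff']
  exact ⟨_, (hξ ⟨t, hTH t.2⟩).symm⟩

theorem exists_smul_eq_smul_of_mem_fixedPoints {T : Subgroup G} {ξ : lieAlgebra G} (hξ0 : ξ ≠ 0)
    (hξ : Projectivization.mk ℂ ξ hξ0 ∈ MulAction.fixedPoints T (ℙ ℂ (lieAlgebra G)))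
    {t : G} (ht : t ∈ T) : ∃ c : ℂ, t • ξ = c • ξ := by
  have h1 : t • Projectivization.mk ℂ ξ hξ0 = Projectivization.mk ℂ ξ hξ0 := hξ ⟨t, ht⟩
  rw [Projectivization.smul_mk, Projectivization.mk_eq_mk_iff'] at h1
  obtain ⟨c, hc⟩ := h1
  exact ⟨c, hc.symm⟩

theorem isNilpotentOrbit_orbit {ξ : lieAlgebra G} (hξ : ξ ∈ nilpotentCone G) :
    IsNilpotentOrbit (MulAction.orbit G ξ) := by
  refine ⟨⟨ξ, rfl⟩, ?_⟩
  rintro _ ⟨g, rfl⟩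
  exact smul_mem_nilpotentCone g hξ

section Weights

variable [(fixedSubalgebra H).IsCartanSubalgebra]
variable {χ ψ : H →* ℂˣ} {α β : Weight ℂ (fixedSubalgebra H) (lieAlgebra G)}

theorem mem_nilpotentCone_of_mem_rootSpace (h : Corresponds χ α) {x : lieAlgebra G}
    (hx : x ∈ rootSpace H χ) : x ∈ nilpotentCone G :=
  LieAlgebra.isNilpotent_ad_of_mem_rootSpace (fixedSubalgebra H) h.isNonZero (h.mem_iff.mp hx)

variable [LieAlgebra.IsKilling ℂ (lieAlgebra G)]

/-- Here γ is the reflection of α in β. Since g is an involution on 𝔥, it carries an α-vector to a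
vector of weight γ, so the action on characters agrees with the reflection of weights. -/
theorem corresponds_reflection (hG : IsSimplyConnectedSimple G) (hH : IsMaximalTorus H)
    (hgen : GeneratedByExp hG.isClosed H) (h : Corresponds χ α) (hβ : β.IsNonZero)
    {g : Subgroup.normalizer (H : Set G)} (hg : ∀ k : fixedSubalgebra H,
      (g : G) • (k : lieAlgebra G) = k - β k • ((coroot β : fixedSubalgebra H) : lieAlgebra G))
    {γ : Weight ℂ (fixedSubalgebra H) (lieAlgebra G)} (hγ0 : γ.IsNonZero)
    (hγ : ∀ k, γ k = α k - α (coroot β) * β k) :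
    Corresponds (normalizerAction H g χ) γ := by
  obtain ⟨φ, -, hφ⟩ := exists_isRoot_corresponds hG hH hgen hγ0
  obtain ⟨x, hx, hx0⟩ := h.exists_ne_zero
  have hgx : (g : G) • x ∈ rootSpace H φ := by
    rw [hφ.mem_iff]
    refine LieModule.weightSpace_le_genWeightSpace _ _ ?_
    rw [LieModule.mem_weightSpace]
    intro k
    let m : fixedSubalgebra H := k - β k • coroot β
    have h2 : β m = -β k := by
      rw [← LieModule.Weight.toLinear_apply, map_sub, map_smul, LieModule.Weight.toLinear_apply,
        LieModule.Weight.toLinear_apply, root_apply_coroot hβ, smul_eq_mul]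
      ring
    have hm : (g : G) • (m : lieAlgebra G) = k := by
      rw [hg m, h2]
      change (k : lieAlgebra G) - β k • ((coroot β : fixedSubalgebra H) : lieAlgebra G) -
        -β k • ((coroot β : fixedSubalgebra H) : lieAlgebra G) = k
      module
    have hαm : α m = γ k := by
      rw [← LieModule.Weight.toLinear_apply, map_sub, map_smul, LieModule.Weight.toLinear_apply,
        LieModule.Weight.toLinear_apply, hγ, smul_eq_mul]
      ring
    change ⁅(k : lieAlgebra G), (g : G) • x⁆ = _
    rw [← hm, ← smul_lie_adjoint, h.lie_eq hx m, hαm, smul_comm]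
  have hgx0 : (g : G) • x ≠ 0 := fun h0 => hx0 ((smul_eq_zero_iff_eq (g : G)).mp h0)
  rw [eq_of_mem_rootSpace hgx0 (smul_mem_rootSpace g hx) hgx]
  exact hφ

/-- The roots reached from χ by N_G(H) form a set stable under all reflections, so it contains every
root of the length of α. -/
theorem exists_normalizerAction_eq [LieAlgebra.IsSimple ℂ (lieAlgebra G)]
    (hG : IsSimplyConnectedSimple G) (hH : IsMaximalTorus H)
    (hgen : GeneratedByExp hG.isClosed H) (h : Corresponds χ α) (h' : Corresponds ψ β)
    (heq : corootLengthSq α = corootLengthSq β) :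
    ∃ g : Subgroup.normalizer (H : Set G), normalizerAction H g χ = ψ := by
  have hα : α ∈ (fixedSubalgebra H).root := by simpa using h.isNonZero
  have hβ : β ∈ (fixedSubalgebra H).root := by simpa using h'.isNonZero
  let S : Set (fixedSubalgebra H).root := {γ | ∃ g : Subgroup.normalizer (H : Set G),
    Corresponds (normalizerAction H g χ) γ.1}
  have hmem : (⟨β, hβ⟩ : (fixedSubalgebra H).root) ∈ S := by
    have hαS : (⟨α, hα⟩ : (fixedSubalgebra H).root) ∈ S := by
      refine ⟨1, ?_⟩
      rw [map_one]
      exact h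
    refine mem_of_corootLengthSq_eq (H := fixedSubalgebra H) (α := ⟨α, hα⟩) (β := ⟨β, hβ⟩) heq S
      hαS ?_
    rintro a k ⟨g, hg⟩
    have ha : a.1.IsNonZero := LieSubalgebra.isNonZero_coe_root a
    obtain ⟨s, hs⟩ := exists_reflection hG hH hgen ha
    refine ⟨s * g, ?_⟩
    rw [map_mul]
    refine corresponds_reflection hG hH hgen hg ha hs
      (LieSubalgebra.isNonZero_coe_root _) fun x => ?_
    have h1 := (rootSystem (fixedSubalgebra H)).reflectionPerm_root a k
    exact (LinearMap.congr_fun h1 x).symm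
  obtain ⟨g, hg⟩ := hmem
  exact ⟨g, hg.char_eq h'⟩

theorem Corresponds.exists_smul_eq_smul (hG : IsClosed[zariski n] (G : Set (GL (Fin n) ℂ)))
    (h : Corresponds χ α) {x : lieAlgebra G} (hx : x ∈ rootSpace H χ) {c : ℂ} (hc : c ≠ 0) :
    ∃ g : G, g • x = c • x := by
  -- Halving the logarithm compensates for α(α^∨) = 2.
  refine ⟨expG hG ((Complex.log c / 2) • ((coroot α : fixedSubalgebra H) : lieAlgebra G)), ?_⟩
  rw [expG_smul_of_lie_eq_smul hG (c := Complex.log c), Complex.exp_log hc]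
  rw [smul_lie, h.lie_eq hx, root_apply_coroot h.isNonZero, smul_smul]
  congr 1
  ring

theorem exists_smul_eq_of_corootLengthSq_eq [LieAlgebra.IsSimple ℂ (lieAlgebra G)]
    (hG : IsSimplyConnectedSimple G) (hH : IsMaximalTorus H)
    (hgen : GeneratedByExp hG.isClosed H) (h : Corresponds χ α) (h' : Corresponds ψ β)
    (heq : corootLengthSq α = corootLengthSq β) {x y : lieAlgebra G} (hx0 : x ≠ 0)
    (hx : x ∈ rootSpace H χ) (hy0 : y ≠ 0) (hy : y ∈ rootSpace H ψ) : ∃ g : G, g • x = y := by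
  obtain ⟨g, rfl⟩ := exists_normalizerAction_eq hG hH hgen h h' heq
  have hgx := smul_mem_rootSpace g hx
  have hgx0 : (g : G) • x ≠ 0 := fun h0 => hx0 ((smul_eq_zero_iff_eq (g : G)).mp h0)
  obtain ⟨c, rfl⟩ := h'.exists_smul_eq hgx0 hgx hy
  obtain ⟨a, ha⟩ := h'.exists_smul_eq_smul hG.isClosed hgx (c := c) fun h0 => hy0 (by
    rw [h0, zero_smul])
  exact ⟨a * g, by rw [mul_smul, ha]⟩

theorem root_nonempty [LieAlgebra.IsSimple ℂ (lieAlgebra G)] :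
    (fixedSubalgebra H).root.Nonempty := by
  by_contra h0
  rw [Finset.not_nonempty_iff_eq_empty] at h0
  have := RootPairing.IsIrreducible.nontrivial (P := rootSystem (fixedSubalgebra H))
  have h1 := span_weight_isNonZero_eq_top ℂ (lieAlgebra G) (fixedSubalgebra H)
  have h2 : {α : Weight ℂ (fixedSubalgebra H) (lieAlgebra G) | α.IsNonZero} = ∅ := by
    refine Set.eq_empty_of_forall_notMem fun α hα => ?_
    have : α ∈ (fixedSubalgebra H).root := by simpa using hα
    rw [h0] at this
    exact Finset.notMem_empty α this
  rw [h2, Set.image_empty, Submodule.span_empty] at h1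
  exact bot_ne_top h1

theorem exists_isLongRootVector [LieAlgebra.IsSimple ℂ (lieAlgebra G)]
    (hG : IsSimplyConnectedSimple G) (hH : IsMaximalTorus H)
    (hgen : GeneratedByExp hG.isClosed H) : ∃ e, IsLongRootVector H e := by
  obtain ⟨α, hα, hmax⟩ := Finset.exists_max_image (fixedSubalgebra H).root
    (fun α => (4 / corootLengthSq α).re) root_nonempty
  obtain ⟨χ, hχ, hχα⟩ := exists_isRoot_corresponds hG hH hgen (α := α) (by simpa using hα)
  obtain ⟨x, hx, hx0⟩ := hχα.exists_ne_zero
  refine ⟨x, hx0, χ, ⟨hχ, fun γ hγ => ?_⟩, hx⟩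
  obtain ⟨δ, hδ⟩ := exists_corresponds hG hH hgen hγ
  rw [hχα.rootLengthSq_eq hG hH, hδ.rootLengthSq_eq hG hH]
  exact hmax δ (by simpa using hδ.isNonZero)

theorem exists_isShortRootVector [LieAlgebra.IsSimple ℂ (lieAlgebra G)]
    (hG : IsSimplyConnectedSimple G) (hH : IsMaximalTorus H)
    (hgen : GeneratedByExp hG.isClosed H) : ∃ e, IsShortRootVector H e := by
  obtain ⟨α, hα, hmin⟩ := Finset.exists_min_image (fixedSubalgebra H).root
    (fun α => (4 / corootLengthSq α).re) root_nonempty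
  obtain ⟨χ, hχ, hχα⟩ := exists_isRoot_corresponds hG hH hgen (α := α) (by simpa using hα)
  obtain ⟨x, hx, hx0⟩ := hχα.exists_ne_zero
  refine ⟨x, hx0, χ, ⟨hχ, fun γ hγ => ?_⟩, hx⟩
  obtain ⟨δ, hδ⟩ := exists_corresponds hG hH hgen hγ
  rw [hχα.rootLengthSq_eq hG hH, hδ.rootLengthSq_eq hG hH]
  exact hmin δ (by simpa using hδ.isNonZero)

theorem rootLengthSq_eq_or [LieAlgebra.IsSimple ℂ (lieAlgebra G)]
    (hG : IsSimplyConnectedSimple G) (hH : IsMaximalTorus H)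
    (hgen : GeneratedByExp hG.isClosed H) {φ : H →* ℂˣ} (hφ : IsRoot H φ) (hχ : IsLongRoot H χ)
    (hψ : IsShortRoot H ψ) :
    rootLengthSq H φ = rootLengthSq H χ ∨ rootLengthSq H φ = rootLengthSq H ψ := by
  obtain ⟨a, ha⟩ := exists_corresponds hG hH hgen hφ
  obtain ⟨b, hb⟩ := exists_corresponds hG hH hgen hχ.1
  obtain ⟨c, hc⟩ := exists_corresponds hG hH hgen hψ.1
  have h := corootLengthSq_eq_or (H := fixedSubalgebra H) ⟨a, by simpa using ha.isNonZero⟩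
    ⟨b, by simpa using hb.isNonZero⟩ ⟨c, by simpa using hc.isNonZero⟩
  rw [← ha.rootLengthSq_eq_iff hG hH hb, ← ha.rootLengthSq_eq_iff hG hH hc,
    ← hb.rootLengthSq_eq_iff hG hH hc] at h
  rcases h with h | h | h
  · exact Or.inl h
  · exact Or.inr h
  -- Long and short lengths coincide here, and the length of φ is squeezed between them.
  · exact Or.inl (le_antisymm (hχ.2 φ hφ) (h ▸ hψ.2 φ hφ))

theorem exists_smul_eq_of_rootLengthSq_eq [LieAlgebra.IsSimple ℂ (lieAlgebra G)]
    (hG : IsSimplyConnectedSimple G) (hH : IsMaximalTorus H)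
    (hgen : GeneratedByExp hG.isClosed H) (hχ : IsRoot H χ) (hψ : IsRoot H ψ)
    (heq : rootLengthSq H χ = rootLengthSq H ψ) {x y : lieAlgebra G} (hx0 : x ≠ 0)
    (hx : x ∈ rootSpace H χ) (hy0 : y ≠ 0) (hy : y ∈ rootSpace H ψ) : ∃ g : G, g • x = y := by
  obtain ⟨α, hα⟩ := exists_corresponds hG hH hgen hχ
  obtain ⟨β, hβ⟩ := exists_corresponds hG hH hgen hψ
  exact exists_smul_eq_of_corootLengthSq_eq hG hH hgen hα hβ
    ((hα.rootLengthSq_eq_iff hG hH hβ).mp heq) hx0 hx hy0 hy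

theorem map_Ad_eq_iff_exists_weylAction [LieAlgebra.IsSimple ℂ (lieAlgebra G)]
    (hG : IsSimplyConnectedSimple G) (hH : IsMaximalTorus H)
    (hgen : GeneratedByExp hG.isClosed H) (hχ : IsRoot H χ) (hψ : IsRoot H ψ) :
    (∃ g : G, (rootSpace H χ).map (Ad g) = rootSpace H ψ) ↔
      ∃ w : WeylGroup H, weylAction H w χ = ψ := by
  constructor
  · rintro ⟨g, hg⟩
    obtain ⟨α, hα⟩ := exists_corresponds hG hH hgen hχ
    obtain ⟨β, hβ⟩ := exists_corresponds hG hH hgen hψ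
    obtain ⟨a, ha⟩ := exists_normalizerAction_eq hG hH hgen hα hβ
      (corootLengthSq_eq_of_smul hα hβ hg)
    exact ⟨QuotientGroup.mk a, ha⟩
  · rintro ⟨w, hw⟩
    obtain ⟨a, rfl⟩ := QuotientGroup.mk_surjective w
    rw [weylAction_mk] at hw
    exact ⟨a, by rw [map_Ad_rootSpace, hw]⟩

/-! ### Nilpotent orbits with fixed points -/

/-- The trivial weight space is a Cartan subalgebra of a Killing Lie algebra, and its only
ad-nilpotent element is 0. -/
theorem exists_isRoot_of_mem_nilpotentCone {ξ : lieAlgebra G} (hξ : ξ ∈ nilpotentCone G)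
    (hξ0 : ξ ≠ 0) (hχ : ξ ∈ rootSpace H χ) : IsRoot H χ := by
  refine ⟨?_, (Submodule.ne_bot_iff _).mpr ⟨ξ, hχ, hξ0⟩⟩
  rintro rfl
  exact hξ0 (eq_zero_of_isNilpotent_ad_of_mem_isCartanSubalgebra ℂ (lieAlgebra G)
    (fixedSubalgebra H) hχ hξ)

end Weights

end NilpotentOrbit
end

/-! ### Conjugacy of root spaces and the orbits with fixed points -/

open NilpotentOrbit

theorem mainTheorem11 {n : ℕ} (G : Subgroup (GL (Fin n) ℂ))
    (hG : NilpotentOrbit.IsSimplyConnectedSimple G)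
    (T H : Subgroup G) (hT : IsCompact (T : Set G))
    (hTH : closure[NilpotentOrbit.zariskiOn G] (T : Set G) = (H : Set G))
    (hH : NilpotentOrbit.IsMaximalTorus H) :
    (∀ β γ : H →* ℂˣ, NilpotentOrbit.IsRoot H β → NilpotentOrbit.IsRoot H γ →
      ((∃ g : G, (NilpotentOrbit.rootSpace H β).map (NilpotentOrbit.Ad g) =
          NilpotentOrbit.rootSpace H γ) ↔
        ∃ w : NilpotentOrbit.WeylGroup H, NilpotentOrbit.weylAction H w β = γ)) ∧
    (∃ e, NilpotentOrbit.IsLongRootVector H e) ∧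
    (∃ e, NilpotentOrbit.IsShortRootVector H e) ∧
    ∀ eLong eShort : NilpotentOrbit.lieAlgebra G,
      NilpotentOrbit.IsLongRootVector H eLong → NilpotentOrbit.IsShortRootVector H eShort →
      {Θ : Set (NilpotentOrbit.lieAlgebra G) |
        NilpotentOrbit.IsNilpotentOrbit Θ ∧ Θ ≠ {0} ∧
        (NilpotentOrbit.projectivize Θ ∩
          MulAction.fixedPoints T (ℙ ℂ (NilpotentOrbit.lieAlgebra G))).Nonempty} =
      {MulAction.orbit G eLong, MulAction.orbit G eShort} := by
  have := isKilling hG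
  have := isSimple hG
  have hgen := generatedByExp hG.isClosed hT hTH hH.prop
  have := isCartanSubalgebra hG hH hgen
  have hle : T ≤ H := fun t ht => by
    have := @subset_closure _ (zariskiOn G) (T : Set G) t ht
    rwa [hTH] at this
  have key : ∀ {e : lieAlgebra G} {χ : H →* ℂˣ}, e ≠ 0 → IsRoot H χ → e ∈ rootSpace H χ →
      IsNilpotentOrbit (MulAction.orbit G e) ∧ MulAction.orbit G e ≠ {0} ∧
        (projectivize (MulAction.orbit G e) ∩
          MulAction.fixedPoints T (ℙ ℂ (lieAlgebra G))).Nonempty := by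
    intro e χ he0 hχ he
    obtain ⟨α, hα⟩ := exists_corresponds hG hH hgen hχ
    refine ⟨isNilpotentOrbit_orbit (mem_nilpotentCone_of_mem_rootSpace hα he), fun h => he0 ?_,
      Projectivization.mk ℂ e he0, ⟨e, he0, MulAction.mem_orbit_self e, rfl⟩,
      mem_fixedPoints_of_mem_rootSpace hle he0 he⟩
    simpa [h] using MulAction.mem_orbit_self (M := G) e
  refine ⟨fun β γ hβ hγ => map_Ad_eq_iff_exists_weylAction hG hH hgen hβ hγ,
    exists_isLongRootVector hG hH hgen, exists_isShortRootVector hG hH hgen, ?_⟩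
  rintro eLong eShort ⟨hl0, χ, hχ, hl⟩ ⟨hs0, ψ, hψ, hs⟩
  ext Θ
  constructor
  · rintro ⟨⟨⟨ξ₀, rfl⟩, hcone⟩, -, _, ⟨ξ, hξ0, hξ, rfl⟩, hfix⟩
    obtain ⟨φ, hφ⟩ := exists_mem_rootSpace_of_fixed hTH fun t ht =>
      exists_smul_eq_smul_of_mem_fixedPoints hξ0 hfix ht
    have hroot := exists_isRoot_of_mem_nilpotentCone (hcone hξ) hξ0 hφ
    rw [← MulAction.orbit_eq_iff.mpr hξ]
    rcases rootLengthSq_eq_or hG hH hgen hroot hχ hψ with h | h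
    · obtain ⟨g, hg⟩ := exists_smul_eq_of_rootLengthSq_eq hG hH hgen hroot hχ.1 h hξ0 hφ hl0 hl
      exact Or.inl (by rw [← hg, MulAction.orbit_smul])
    · obtain ⟨g, hg⟩ := exists_smul_eq_of_rootLengthSq_eq hG hH hgen hroot hψ.1 h hξ0 hφ hs0 hs
      exact Or.inr (by rw [← hg, MulAction.orbit_smul, Set.mem_singleton_iff])
  · rintro (rfl | rfl)
    · exact key hl0 hχ.1 hl
    · exact key hs0 hψ.1 hs
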